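/- **Syntax.** De Bruijn indices: ordinary variables $x_n$ and meta-variables $X_n$ ($n\ge1$); constants $a$; sorts $s::=\mathsf{kind}\mid\mathsf{type}$. - Expressions $E,F,A,B,K,L,M,N::=s\mid a\mid\Pi A.E\mid x_n\mid X_n\mid\lambda M\mid E\,N\mid[\sigma]E\mid[\![\theta]\!]E$ - Substitutions $\sigma,\tau::=\uparrow^n\mid(\sigma,M)\mid[\sigma]\tau\mid[\![\theta]\!]\sigma$ ($n\ge 0$) - Meta-substitutions $\theta::=\Uparrow^n\mid(\theta,M)\mid[\![\theta]\!]\theta'$ ($n\ge 0$) - Contexts $\Gamma,\Psi::=\cdot\mid\Gamma,A$; meta-contexts $\Delta::=\cdot\mid\Delta,\Psi[A]$. $[\![\theta]\!]\Gamma$ applies $[\![\theta]\!]$ to each entry of $\Gamma$; $|\cdot|$ is length. Write $\sigma^{+}=([\uparrow^1]\sigma,x_1)$. As classifiers, $[\sigma]\mathsf{kind}$ and $[\![\theta]\!]\mathsf{kind}$ stand for $\mathsf{kind}$. A rule is written "premises $\Rightarrow$ conclusion", and a judgement about expressions, substitutions or contexts is relative to $\Delta$ unless another meta-context is displayed. The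 signature $\Sigma$ is a fixed finite list of declarations $a:K$ with distinct names, such that each $K$ contains no closures and no meta-variables, and $\cdot;\cdot\vdash K:s$ for some sort $s$ over the earlier declarations. **Typing.** The judgements are inductively generated, simultaneously with definitional equality, by these rules. *Contexts.* $\vdash\cdot\ \mathsf{mctx}$; $\ \Delta;\Psi\vdash A:\mathsf{type}\Rightarrow{}\vdash\Delta,\Psi[A]\ \mathsf{mctx}$; $\ \vdash\Delta\ \mathsf{mctx}\Rightarrow\Delta\vdash\cdot\ \mathsf{ctx}$; $\ \Delta;\Psi\vdash A:\mathsf{type}\Rightarrow\Delta\vdash\Psi,A\ \mathsf{ctx}$. Context equality $\Delta\vdash\Gamma\equiv\Gamma'$: $\ \vdash\Delta\ \mathsf{mctx}\Rightarrow\Delta\vdash\cdot\equiv\cdot$; $\ \Delta\vdash\Gamma\equiv\Gamma'$, $\Delta;\Gamma\vdash A\equiv A':\mathsf{type}\Rightarrow\Delta\vdash(\Gamma,A)\equiv(\Gamma',A')$. *Expressions.* - $\Delta\vdash\Gamma\ \mathsf{ctx}\Rightarrow\Gamma\vdash\mathsf{type}:\mathsf{kind}$; $\ \Delta\vdash\Gamma\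 \mathsf{ctx}$, $(a:K)\in\Sigma\Rightarrow\Gamma\vdash a:K$; $\ \Gamma,A\vdash E:s\Rightarrow\Gamma\vdash\Pi A.E:s$ - $\Gamma\vdash A:\mathsf{type}\Rightarrow\Gamma,A\vdash x_1:[\uparrow^1]A$; $\ \Gamma\vdash x_n:A$, $\Gamma\vdash B:\mathsf{type}\Rightarrow\Gamma,B\vdash x_{n+1}:[\uparrow^1]A$ - $\Delta;\Gamma\vdash A:\mathsf{type}\Rightarrow\Delta,\Gamma[A];[\![\Uparrow^1]\!]\Gamma\vdash X_1:[\![\Uparrow^1]\!]A$; $\ \Delta;\Gamma\vdash X_n:A$, $\Delta;\Gamma'\vdash A':\mathsf{type}\Rightarrow\Delta,\Gamma'[A'];[\![\Uparrow^1]\!]\Gamma\vdash X_{n+1}:[\![\Uparrow^1]\!]A$ - $\Gamma,A\vdash M:B$, $\Gamma,A\vdash B:\mathsf{type}\Rightarrow\Gamma\vdash\lambda M:\Pi A.B$; $\ \Gamma\vdash E:\Pi A.F$, $\Gamma\vdash N:A\Rightarrow\Gamma\vdash E\,N:[\uparrow^0,N]F$ - $\Gamma\vdash\sigma:\Psi$,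 $\Psi\vdash E:F\Rightarrow\Gamma\vdash[\sigma]E:[\sigma]F$; $\ \Delta\vdash\theta:\Delta'$, $\Delta';\Gamma\vdash E:F\Rightarrow\Delta;[\![\theta]\!]\Gamma\vdash[\![\theta]\!]E:[\![\theta]\!]F$ - $\Gamma\vdash E:F_1$, $\Gamma\vdash F_1\equiv F_2:s\Rightarrow\Gamma\vdash E:F_2$; $\ \Gamma\vdash E:F$, $\Gamma\equiv\Gamma'\Rightarrow\Gamma'\vdash E:F$. *Substitutions.* - $\Delta\vdash\Psi,\Gamma\ \mathsf{ctx}$, $|\Gamma|=n\Rightarrow\Psi,\Gamma\vdash\uparrow^n:\Psi$; $\ \Gamma\vdash\sigma:\Psi$, $\Psi\vdash A:\mathsf{type}$, $\Gamma\vdash M:[\sigma]A\Rightarrow\Gamma\vdash(\sigma,M):(\Psi,A)$ - $\Gamma\vdash\tau:\Psi'$, $\Psi'\vdash\sigma:\Psi\Rightarrow\Gamma\vdash[\tau]\sigma:\Psi$; $\ \Delta\vdash\theta:\Delta'$, $\Delta';\Gamma\vdash\sigma:\Psi\Rightarrow\Delta;[\![\theta]\!]\Gamma\vdash[\![\theta]\!]\sigma:[\![\theta]\!]\Psi$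 - $\Gamma\vdash\sigma:\Psi$, $\Gamma\equiv\Gamma'$, $\Psi\equiv\Psi'\Rightarrow\Gamma'\vdash\sigma:\Psi'$. *Meta-substitutions.* - $\vdash\Delta,\Delta'\ \mathsf{mctx}$, $|\Delta'|=n\Rightarrow\Delta,\Delta'\vdash\Uparrow^n:\Delta$; $\ \Delta\vdash\theta:\Delta'$, $\Delta';\Gamma\vdash A:\mathsf{type}$, $\Delta;[\![\theta]\!]\Gamma\vdash M:[\![\theta]\!]A\Rightarrow\Delta\vdash(\theta,M):(\Delta',\Gamma[A])$ - $\Delta\vdash\theta:\Delta_0$, $\Delta_0\vdash\theta':\Delta'\Rightarrow\Delta\vdash[\![\theta]\!]\theta':\Delta'$. **Definitional equality** ($\Delta;\Gamma\vdash E_1\equiv E_2:F$, $\ \Delta;\Gamma\vdash\sigma_1\equiv\sigma_2:\Psi$, $\ \Delta\vdash\theta_1\equiv\theta_2:\Delta'$) is closed under reflexivity on well-typed objects, symmetry, transitivity; for expressions under the conversion rule $E\equiv E':F$, $F\equiv F':s\Rightarrow E\equiv E':F'$ and context conversion; for substitutions under conversion of both contexts; under congruence for each construction ($\Pi$, $\lambda$,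 application, pairing, and all closures, with side premises as in the typing rules); and under the following laws, each holding whenever the displayed typing premises hold (all displayed equations are in context $\Gamma$, resp. $[\![\theta]\!]\Gamma$, and at the classifier shown). *$\beta$ and $\eta$.* - $(\lambda M)N\equiv[\uparrow^0,N]M:[\uparrow^0,N]B$ if $\Gamma,A\vdash M:B$, $\Gamma,A\vdash B:\mathsf{type}$, $\Gamma\vdash N:A$ - $M\equiv\lambda(([\uparrow^1]M)\,x_1):\Pi A.B$ if $\Gamma\vdash M:\Pi A.B$, $\Gamma,A\vdash B:\mathsf{type}$ - in $\Gamma,A,\Gamma'$ with $\Delta\vdash\Gamma,A,\Gamma'\ \mathsf{ctx}$ and $|\Gamma'|=n$: $\uparrow^n\equiv(\uparrow^{n+1},x_{n+1}):\Gamma,A$ - over $\Delta,\Gamma[A],\Delta'$ well-formed with $|\Delta'|=n$: $\Uparrow^n\equiv(\Uparrow^{n+1},X_{n+1}):\Delta,\Gamma[A]$. *Ordinary substitutions on expressions* ($\Gamma\vdash\sigma:\Psi$). - $[\uparrow^0]E\equiv E:F$ if $\Gamma\vdash E:F$; $\ [\sigma][\tau]E\equiv[[\sigma]\tau]E:[[\sigma]\tau]F$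 if $\Psi\vdash\tau:\Psi'$, $\Psi'\vdash E:F$ - $[\sigma]\mathsf{type}\equiv\mathsf{type}:\mathsf{kind}$; $\ [\sigma]a\equiv a:[\sigma]K$ if $\Psi\vdash a:K$ - $[\sigma,M]x_1\equiv M:[\sigma]A$ if $\Psi\vdash A:\mathsf{type}$, $\Gamma\vdash M:[\sigma]A$; $\ x_{n+1}\equiv[\uparrow^1]x_n:A$ if $\Gamma\vdash x_{n+1}:A$ - $[\sigma](\Pi A.F)\equiv\Pi[\sigma]A.[\sigma^{+}]F:s$ if $\Psi,A\vdash F:s$ - $[\sigma](\lambda M)\equiv\lambda[\sigma^{+}]M:\Pi[\sigma]A.[\sigma^{+}]B$ if $\Psi,A\vdash M:B$, $\Psi,A\vdash B:\mathsf{type}$ - $[\sigma](E\,N)\equiv([\sigma]E)([\sigma]N):[\sigma,[\sigma]N]F$ if $\Psi\vdash E:\Pi A.F$, $\Psi\vdash N:A$. *Substitutions.* - $[\sigma,M]\uparrow^{n+1}\equiv[\sigma]\uparrow^n:\Psi$ if $\Gamma\vdash(\sigma,M):\Psi,\Psi',A$, $|\Psi'|=n$; $\ [\sigma](\tau,M)\equiv([\sigma]\tau,[\sigma]M):\Psi,A$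 if $\Gamma\vdash\sigma:\Psi'$, $\Psi'\vdash(\tau,M):\Psi,A$ - in $\Gamma,\Gamma_1,\Gamma_2$ well-formed with $|\Gamma_1|=m$, $|\Gamma_2|=n$: $[\uparrow^n]\uparrow^m\equiv\uparrow^{n+m}:\Gamma$ - $[\uparrow^0]\sigma\equiv\sigma\equiv[\sigma]\uparrow^0:\Psi$ if $\Gamma\vdash\sigma:\Psi$; $\ [\sigma_1][\sigma_2]\sigma_3\equiv[[\sigma_1]\sigma_2]\sigma_3$ for composable well-typed $\sigma_i$. *Meta-substitutions on expressions* ($\Delta\vdash\theta:\Delta'$, the remaining premises over $\Delta'$ unless indicated, the equations over $\Delta$). - $[\![\Uparrow^0]\!]E\equiv E:F$ in $\Delta;\Gamma$ if $\Delta;\Gamma\vdash E:F$; $\ [\![\theta]\!][\![\theta']\!]E\equiv[\![[\![\theta]\!]\theta']\!]E:[\![[\![\theta]\!]\theta']\!]F$ in $\Delta;[\![[\![\theta]\!]\theta']\!]\Gamma$ if $\Delta'\vdash\theta':\Delta''$, $\Delta'';\Gamma\vdash E:F$ - $[\![\theta]\!]\mathsf{type}\equiv\mathsf{type}:\mathsf{kind}$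 if $\Gamma\ \mathsf{ctx}$; $\ [\![\theta]\!]a\equiv a:[\![\theta]\!]K$ if $\Gamma\vdash a:K$; $\ [\![\theta]\!]x_n\equiv x_n:[\![\theta]\!]A$ if $\Gamma\vdash x_n:A$ - $[\![\theta,M]\!]X_1\equiv M:[\![\theta]\!]A$ if $\Gamma\vdash A:\mathsf{type}$, $\Delta;[\![\theta]\!]\Gamma\vdash M:[\![\theta]\!]A$; $\ X_{n+1}\equiv[\![\Uparrow^1]\!]X_n:A$ in $\Delta;\Gamma$ if $\Delta;\Gamma\vdash X_{n+1}:A$ - $[\![\theta]\!](\Pi A.F)\equiv\Pi[\![\theta]\!]A.[\![\theta]\!]F:s$ if $\Gamma,A\vdash F:s$; $\ [\![\theta]\!](\lambda M)\equiv\lambda[\![\theta]\!]M:\Pi[\![\theta]\!]A.[\![\theta]\!]B$ if $\Gamma,A\vdash M:B$, $\Gamma,A\vdash B:\mathsf{type}$ - $[\![\theta]\!](E\,N)\equiv([\![\theta]\!]E)([\![\theta]\!]N):[\uparrow^0,[\![\theta]\!]N][\![\theta]\!]F$ if $\Gamma\vdash E:\Pi A.F$, $\Gamma\vdash N:A$;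 $\ [\![\theta]\!][\sigma]E\equiv[[\![\theta]\!]\sigma][\![\theta]\!]E:[[\![\theta]\!]\sigma][\![\theta]\!]F$ if $\Gamma\vdash\sigma:\Psi$, $\Psi\vdash E:F$. *Meta-substitutions on substitutions* (same conventions). - $[\![\theta]\!]\uparrow^n\equiv\uparrow^n:[\![\theta]\!]\Gamma$ in $[\![\theta]\!]\Gamma,[\![\theta]\!]\Gamma'$ if $\Gamma,\Gamma'\ \mathsf{ctx}$, $|\Gamma'|=n$ - $[\![\theta]\!](\sigma,M)\equiv([\![\theta]\!]\sigma,[\![\theta]\!]M):[\![\theta]\!]\Psi,[\![\theta]\!]A$ if $\Gamma\vdash\sigma:\Psi$, $\Psi\vdash A:\mathsf{type}$, $\Gamma\vdash M:[\sigma]A$ - $[\![\theta]\!][\tau]\sigma\equiv[[\![\theta]\!]\tau][\![\theta]\!]\sigma:[\![\theta]\!]\Psi$ if $\Gamma\vdash\tau:\Psi'$, $\Psi'\vdash\sigma:\Psi$; $\ [\![\theta]\!][\![\theta']\!]\sigma\equiv[\![[\![\theta]\!]\theta']\!]\sigma:[\![[\![\theta]\!]\theta']\!]\Psi$ in $[\![[\![\theta]\!]\theta']\!]\Gamma$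 if $\Delta'\vdash\theta':\Delta''$, $\Delta'';\Gamma\vdash\sigma:\Psi$. *Meta-substitutions.* - $[\![\theta,M]\!]\Uparrow^{n+1}\equiv[\![\theta]\!]\Uparrow^n:\Delta_0$ if $\Delta\vdash(\theta,M):\Delta_0,\Delta_0',\Gamma[A]$, $|\Delta_0'|=n$; $\ [\![\theta]\!](\theta',M)\equiv([\![\theta]\!]\theta',[\![\theta]\!]M):\Delta_0,\Gamma[A]$ if $\Delta\vdash\theta:\Delta_0'$, $\Delta_0'\vdash(\theta',M):\Delta_0,\Gamma[A]$ - over $\Delta,\Delta_1,\Delta_2$ well-formed with $|\Delta_1|=m$, $|\Delta_2|=n$: $[\![\Uparrow^n]\!]\Uparrow^m\equiv\Uparrow^{n+m}:\Delta$ - $[\![\Uparrow^0]\!]\theta\equiv\theta\equiv[\![\theta]\!]\Uparrow^0$ for well-typed $\theta$; $\ [\![\theta_1]\!][\![\theta_2]\!]\theta_3\equiv[\![[\![\theta_1]\!]\theta_2]\!]\theta_3$ for composable well-typed $\theta_i$. **Evaluation.** Environments $\rho::=\uparrow^n\mid(\rho,L)\mid[\uparrow^n]\rho$; meta-environments $\eta::=\Uparrow^n\mid(\eta,M)$;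 closures $L::=x_n\mid[\rho][\![\eta]\!]E$; neutral forms $H::=a\mid x_n\mid[\rho]X_n\mid H\,L$; weak head normal forms $W::=s\mid[\rho][\![\eta]\!](\Pi A.B)\mid[\rho][\![\eta]\!](\lambda M)\mid H$. All of these are read as substitutions, meta-substitutions and expressions. Shifting of closures: $\uparrow^n(x_m)=x_{n+m}$, $\uparrow^n([\rho][\![\eta]\!]E)=[[\uparrow^n]\rho][\![\eta]\!]E$. The following clauses are tried in the given order. - $\mathsf{Env}$: $\ \mathsf{Env}\,\Uparrow^m\Uparrow^n=\Uparrow^{m+n}$; $\ \mathsf{Env}\,\eta\Uparrow^0=\eta$; $\ \mathsf{Env}\,(\eta,M)\Uparrow^{n+1}=\mathsf{Env}\,\eta\Uparrow^n$; $\ \mathsf{Env}\,\eta\,(\theta,M)=(\mathsf{Env}\,\eta\,\theta,[\![\eta]\!]M)$; $\ \mathsf{Env}\,\eta\,([\![\theta]\!]\theta')=\mathsf{Env}\,(\mathsf{Env}\,\eta\,\theta)\,\theta'$. - $\mathsf{env}$: $\ \mathsf{env}\,([\uparrow^k]\rho)\,\eta\,\sigma=[\uparrow^k](\mathsf{env}\,\rho\,\eta\,\sigma)$;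 $\ \mathsf{env}\,\rho\,\eta\uparrow^0=\rho$; $\ \mathsf{env}\uparrow^k\eta\uparrow^n=\uparrow^{k+n}$; $\ \mathsf{env}\,(\rho,L)\,\eta\uparrow^{n+1}=\mathsf{env}\,\rho\,\eta\uparrow^n$; $\ \mathsf{env}\,\rho\,\eta\,(\sigma,M)=(\mathsf{env}\,\rho\,\eta\,\sigma,[\rho][\![\eta]\!]M)$; $\ \mathsf{env}\,\rho\,\eta\,([\sigma]\tau)=\mathsf{env}\,(\mathsf{env}\,\rho\,\eta\,\sigma)\,\eta\,\tau$; $\ \mathsf{env}\,\rho\,\eta\,([\![\theta]\!]\sigma)=\mathsf{env}\,\rho\,(\mathsf{Env}\,\eta\,\theta)\,\sigma$. - $\mathsf{Lookup}$: $\ \mathsf{Lookup}\Uparrow^n m=X_{n+m}$; $\ \mathsf{Lookup}\,(\eta,E)\,1=E$; $\ \mathsf{Lookup}\,(\eta,E)\,(m+1)=\mathsf{Lookup}\,\eta\,m$. - $\mathsf{lookup}$: $\ \mathsf{lookup}\uparrow^n m=x_{n+m}$; $\ \mathsf{lookup}\,(\rho,L)\,1=L$; $\ \mathsf{lookup}\,(\rho,L)\,(m+1)=\mathsf{lookup}\,\rho\,m$;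 $\ \mathsf{lookup}\,([\uparrow^n]\rho)\,m=\uparrow^n(\mathsf{lookup}\,\rho\,m)$. - The partial functions $\mathsf{whnf}$ and $@$ are defined by the recursion $\mathsf{whnf}\,x_m=x_m$; $\ \mathsf{whnf}([\rho][\![\eta]\!]s)=s$; $\ \mathsf{whnf}([\rho][\![\eta]\!]a)=a$; $\ \mathsf{whnf}([\rho][\![\eta]\!]x_m)=\mathsf{whnf}(\mathsf{lookup}\,\rho\,m)$; $\ \mathsf{whnf}([\rho][\![\Uparrow^0]\!]X_m)=[\rho]X_m$; $\ \mathsf{whnf}([\rho][\![\eta]\!]X_m)=\mathsf{whnf}([\rho][\![\Uparrow^0]\!](\mathsf{Lookup}\,\eta\,m))$ for $\eta\ne\Uparrow^0$; $\ \mathsf{whnf}([\rho][\![\eta]\!](\Pi A.E))=[\rho][\![\eta]\!](\Pi A.E)$; $\ \mathsf{whnf}([\rho][\![\eta]\!](\lambda M))=[\rho][\![\eta]\!](\lambda M)$; $\ \mathsf{whnf}([\rho][\![\eta]\!](M\,N))=(\mathsf{whnf}([\rho][\![\eta]\!]M))\mathbin{@}([\rho][\![\eta]\!]N)$; $\ \mathsf{whnf}([\rho][\![\eta]\!][\sigma]M)=\mathsf{whnf}([\mathsf{env}\,\rho\,\eta\,\sigma][\![\eta]\!]M)$;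 $\ \mathsf{whnf}([\rho][\![\eta]\!][\![\theta]\!]M)=\mathsf{whnf}([\rho][\![\mathsf{Env}\,\eta\,\theta]\!]M)$; and $([\rho][\![\eta]\!](\lambda M))\mathbin{@}L=\mathsf{whnf}([\rho,L][\![\eta]\!]M)$; $\ H\mathbin{@}L=H\,L$. **Theorem (Subject reduction).** Let $\Delta\vdash\eta:\Delta'$. 1. If $\Delta'\vdash\theta:\Delta''$, then $\Delta\vdash\mathsf{Env}\,\eta\,\theta\equiv[\![\eta]\!]\theta:\Delta''$. 2. If $\Delta';\Psi\vdash\sigma:\Psi'$ and $\Delta;\Gamma\vdash\rho:[\![\eta]\!]\Psi$, then $\Delta;\Gamma\vdash\mathsf{env}\,\rho\,\eta\,\sigma\equiv[\rho][\![\eta]\!]\sigma:[\![\eta]\!]\Psi'$. 3. If $\Delta';\Psi\vdash X_m:A$, then $\Delta;[\![\eta]\!]\Psi\vdash\mathsf{Lookup}\,\eta\,m\equiv[\![\eta]\!]X_m:[\![\eta]\!]A$. 4. If $\Delta;\Psi\vdash x_m:A$ and $\Delta;\Gamma\vdash\rho:\Psi$, then $\Delta;\Gamma\vdash\mathsf{lookup}\,\rho\,m\equiv[\rho]x_m:[\rho]A$.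 5. Let $\Delta';\Psi\vdash E:F$ and $\Delta;\Gamma\vdash\rho:[\![\eta]\!]\Psi$. If $\mathsf{whnf}([\rho][\![\eta]\!]E)$ is defined, then $\Delta;\Gamma\vdash\mathsf{whnf}([\rho][\![\eta]\!]E)\equiv[\rho][\![\eta]\!]E:[\rho][\![\eta]\!]F$. 6. Let $\Delta;\Gamma\vdash W:\Pi A.F$ and $\Delta;\Gamma\vdash L:A$. If $W\mathbin{@}L$ is defined, then $\Delta;\Gamma\vdash W\mathbin{@}L\equiv W\,L:[\uparrow^0,L]F$. -/

import Mathlib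

/-!
An explicit substitution calculus with two kinds of de Bruijn variables: ordinary variables and
meta-variables.  Indices are counted from zero in the code: `Expr.var n` is the variable `x_{n+1}`
and `Expr.mvar n` is the meta-variable `X_{n+1}`.
-/

universe u

namespace CMTT

/-- The two sorts. -/
inductive Srt : Type
  | kind
  | type

mutual

/-- Expressions (terms, types and kinds). `C` is the type of names of constants. -/
inductive Expr (C : Type u) : Type u
  | sort (s : Srt)
  | const (a : C)
  | pi (A E : Expr C)
  | var (n : ℕ)
  | mvar (n : ℕ)
  | lam (M : Expr C)
  | app (E N : Expr C)
  /-- The closure `[σ]E`. -/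
  | clo (σ : Sub C) (E : Expr C)
  /-- The meta-closure `⟦θ⟧E`. -/
  | mclo (θ : MSub C) (E : Expr C)

/-- Ordinary substitutions. -/
inductive Sub (C : Type u) : Type u
  /-- The shift `↑ⁿ`. -/
  | shift (n : ℕ)
  | cons (σ : Sub C) (M : Expr C)
  /-- The closure `[σ]τ`. -/
  | clo (σ τ : Sub C)
  /-- The meta-closure `⟦θ⟧σ`. -/
  | mclo (θ : MSub C) (σ : Sub C)

/-- Meta-substitutions. -/
inductive MSub (C : Type u) : Type u
  /-- The meta-shift `⇑ⁿ`. -/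
  | shift (n : ℕ)
  | cons (θ : MSub C) (M : Expr C)
  /-- The meta-closure `⟦θ⟧θ'`. -/
  | mclo (θ θ' : MSub C)

end

/-- Contexts; the most recent declaration is the head, so `Γ, A` is `A :: Γ` and
`Γ, Γ'` is `Γ' ++ Γ`. -/
abbrev Ctx (C : Type u) : Type u := List (Expr C)

/-- Meta-contexts; a declaration `Ψ[A]` is the pair `(Ψ, A)`, and `Δ, Δ'` is `Δ' ++ Δ`. -/
abbrev MCtx (C : Type u) : Type u := List (Ctx C × Expr C)

/-- Signatures: lists of declarations `a : K`, the most recent one first. -/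
abbrev Sig (C : Type u) : Type u := List (C × Expr C)

variable {C : Type u}

/-- The meta-substitution of a context, pushed to every declaration. -/
def Ctx.msub (θ : MSub C) (Γ : Ctx C) : Ctx C := List.map (Expr.mclo θ) Γ

/-- `[σ]F` in the position of a classifier. The sort `kind` is not itself classified, and closures
of kinds are again kinds: there `[σ]kind` stands for `kind`. -/
def Expr.tclo (σ : Sub C) : Expr C → Expr C
  | .sort .kind => .sort .kind
  | F => .clo σ F

/-- `⟦θ⟧F` in the position of a classifier, with `⟦θ⟧kind` standing for `kind`. -/
def Expr.tmclo (θ : MSub C) : Expr C → Expr C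
  | .sort .kind => .sort .kind
  | F => .mclo θ F

/-- The lifting `([↑¹]σ, x₁)` of a substitution under a binder. -/
def Sub.lift (σ : Sub C) : Sub C := .cons (.clo (.shift 1) σ) (.var 0)

/-- The substitution `(↑⁰, N)`. -/
def Sub.single (N : Expr C) : Sub C := .cons (.shift 0) N

mutual

/-- `⊢ Δ mctx`. -/
inductive MCtxWf : Sig C → MCtx C → Prop
  | nil {Sg : Sig C} : MCtxWf Sg []
  | cons {Sg : Sig C} {Δ : MCtx C} {Ψ : Ctx C} {A : Expr C} :
      HasType Sg Δ Ψ A (.sort .type) → MCtxWf Sg ((Ψ, A) :: Δ)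

/-- `Δ ⊢ Ψ ctx`. -/
inductive CtxWf : Sig C → MCtx C → Ctx C → Prop
  | nil {Sg : Sig C} {Δ : MCtx C} : MCtxWf Sg Δ → CtxWf Sg Δ []
  | cons {Sg : Sig C} {Δ : MCtx C} {Ψ : Ctx C} {A : Expr C} :
      HasType Sg Δ Ψ A (.sort .type) → CtxWf Sg Δ (A :: Ψ)

/-- `Δ ⊢ Γ ≡ Γ' ctx`: declarationwise definitional equality of contexts. -/
inductive CtxEq : Sig C → MCtx C → Ctx C → Ctx C → Prop
  | nil {Sg : Sig C} {Δ : MCtx C} : MCtxWf Sg Δ → CtxEq Sg Δ [] []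
  | cons {Sg : Sig C} {Δ : MCtx C} {Γ Γ' : Ctx C} {A A' : Expr C} :
      CtxEq Sg Δ Γ Γ' → ExprEq Sg Δ Γ A A' (.sort .type) → CtxEq Sg Δ (A :: Γ) (A' :: Γ')

/-- `Δ; Γ ⊢ E : F`. -/
inductive HasType : Sig C → MCtx C → Ctx C → Expr C → Expr C → Prop
  | type {Sg : Sig C} {Δ : MCtx C} {Γ : Ctx C} :
      CtxWf Sg Δ Γ → HasType Sg Δ Γ (.sort .type) (.sort .kind)
  | const {Sg : Sig C} {Δ : MCtx C} {Γ : Ctx C} {a : C} {K : Expr C} :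
      CtxWf Sg Δ Γ → (a, K) ∈ Sg → HasType Sg Δ Γ (.const a) K
  | pi {Sg : Sig C} {Δ : MCtx C} {Γ : Ctx C} {A E : Expr C} {s : Srt} :
      HasType Sg Δ (A :: Γ) E (.sort s) → HasType Sg Δ Γ (.pi A E) (.sort s)
  | var_zero {Sg : Sig C} {Δ : MCtx C} {Γ : Ctx C} {A : Expr C} :
      HasType Sg Δ Γ A (.sort .type) → HasType Sg Δ (A :: Γ) (.var 0) (.clo (.shift 1) A)
  | var_succ {Sg : Sig C} {Δ : MCtx C} {Γ : Ctx C} {A B : Expr C} {n : ℕ} :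
      HasType Sg Δ Γ (.var n) A → HasType Sg Δ Γ B (.sort .type) →
      HasType Sg Δ (B :: Γ) (.var (n + 1)) (.clo (.shift 1) A)
  | mvar_zero {Sg : Sig C} {Δ : MCtx C} {Γ : Ctx C} {A : Expr C} :
      HasType Sg Δ Γ A (.sort .type) →
      HasType Sg ((Γ, A) :: Δ) (Γ.msub (.shift 1)) (.mvar 0) (.mclo (.shift 1) A)
  | mvar_succ {Sg : Sig C} {Δ : MCtx C} {Γ Γ' : Ctx C} {A A' : Expr C} {n : ℕ} :
      HasType Sg Δ Γ (.mvar n) A → HasType Sg Δ Γ' A' (.sort .type) →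
      HasType Sg ((Γ', A') :: Δ) (Γ.msub (.shift 1)) (.mvar (n + 1)) (.mclo (.shift 1) A)
  | lam {Sg : Sig C} {Δ : MCtx C} {Γ : Ctx C} {A B M : Expr C} :
      HasType Sg Δ (A :: Γ) M B → HasType Sg Δ (A :: Γ) B (.sort .type) →
      HasType Sg Δ Γ (.lam M) (.pi A B)
  | app {Sg : Sig C} {Δ : MCtx C} {Γ : Ctx C} {A E F N : Expr C} :
      HasType Sg Δ Γ E (.pi A F) → HasType Sg Δ Γ N A →
      HasType Sg Δ Γ (.app E N) (.clo (.single N) F)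
  | clo {Sg : Sig C} {Δ : MCtx C} {Γ Ψ : Ctx C} {σ : Sub C} {E F : Expr C} :
      SubHasType Sg Δ Γ σ Ψ → HasType Sg Δ Ψ E F →
      HasType Sg Δ Γ (.clo σ E) (F.tclo σ)
  | mclo {Sg : Sig C} {Δ Δ' : MCtx C} {Γ : Ctx C} {θ : MSub C} {E F : Expr C} :
      MSubHasType Sg Δ θ Δ' → HasType Sg Δ' Γ E F →
      HasType Sg Δ (Γ.msub θ) (.mclo θ E) (F.tmclo θ)
  | conv {Sg : Sig C} {Δ : MCtx C} {Γ : Ctx C} {E F₁ F₂ : Expr C} {s : Srt} :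
      HasType Sg Δ Γ E F₁ → ExprEq Sg Δ Γ F₁ F₂ (.sort s) → HasType Sg Δ Γ E F₂
  /-- Context conversion. -/
  | ctxConv {Sg : Sig C} {Δ : MCtx C} {Γ Γ' : Ctx C} {E F : Expr C} :
      HasType Sg Δ Γ E F → CtxEq Sg Δ Γ Γ' → HasType Sg Δ Γ' E F

/-- `Δ; Γ ⊢ σ : Ψ`. -/
inductive SubHasType : Sig C → MCtx C → Ctx C → Sub C → Ctx C → Prop
  | shift {Sg : Sig C} {Δ : MCtx C} {Ψ Γ : Ctx C} {n : ℕ} :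
      CtxWf Sg Δ (Γ ++ Ψ) → Γ.length = n → SubHasType Sg Δ (Γ ++ Ψ) (.shift n) Ψ
  | cons {Sg : Sig C} {Δ : MCtx C} {Γ Ψ : Ctx C} {σ : Sub C} {A M : Expr C} :
      SubHasType Sg Δ Γ σ Ψ → HasType Sg Δ Ψ A (.sort .type) → HasType Sg Δ Γ M (.clo σ A) →
      SubHasType Sg Δ Γ (.cons σ M) (A :: Ψ)
  | clo {Sg : Sig C} {Δ : MCtx C} {Γ Ψ' Ψ : Ctx C} {σ τ : Sub C} :
      SubHasType Sg Δ Γ τ Ψ' → SubHasType Sg Δ Ψ' σ Ψ → SubHasType Sg Δ Γ (.clo τ σ) Ψ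
  | mclo {Sg : Sig C} {Δ Δ' : MCtx C} {Γ Ψ : Ctx C} {θ : MSub C} {σ : Sub C} :
      MSubHasType Sg Δ θ Δ' → SubHasType Sg Δ' Γ σ Ψ →
      SubHasType Sg Δ (Γ.msub θ) (.mclo θ σ) (Ψ.msub θ)
  /-- Conversion of the two contexts of the judgement. -/
  | ctxConv {Sg : Sig C} {Δ : MCtx C} {Γ Γ' Ψ Ψ' : Ctx C} {σ : Sub C} :
      SubHasType Sg Δ Γ σ Ψ → CtxEq Sg Δ Γ Γ' → CtxEq Sg Δ Ψ Ψ' → SubHasType Sg Δ Γ' σ Ψ'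

/-- `Δ ⊢ θ : Δ'`. -/
inductive MSubHasType : Sig C → MCtx C → MSub C → MCtx C → Prop
  | shift {Sg : Sig C} {Δ Δ' : MCtx C} {n : ℕ} :
      MCtxWf Sg (Δ' ++ Δ) → Δ'.length = n → MSubHasType Sg (Δ' ++ Δ) (.shift n) Δ
  | cons {Sg : Sig C} {Δ Δ' : MCtx C} {Γ : Ctx C} {θ : MSub C} {A M : Expr C} :
      MSubHasType Sg Δ θ Δ' → HasType Sg Δ' Γ A (.sort .type) →
      HasType Sg Δ (Γ.msub θ) M (.mclo θ A) → MSubHasType Sg Δ (.cons θ M) ((Γ, A) :: Δ')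
  | mclo {Sg : Sig C} {Δ Δ₀ Δ' : MCtx C} {θ θ' : MSub C} :
      MSubHasType Sg Δ θ Δ₀ → MSubHasType Sg Δ₀ θ' Δ' → MSubHasType Sg Δ (.mclo θ θ') Δ'

/-- `Δ; Γ ⊢ E₁ ≡ E₂ : F`. -/
inductive ExprEq : Sig C → MCtx C → Ctx C → Expr C → Expr C → Expr C → Prop
  -- equivalence and conversion
  | refl {Sg : Sig C} {Δ : MCtx C} {Γ : Ctx C} {E F : Expr C} :
      HasType Sg Δ Γ E F → ExprEq Sg Δ Γ E E F
  | symm {Sg : Sig C} {Δ : MCtx C} {Γ : Ctx C} {E₁ E₂ F : Expr C} :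
      ExprEq Sg Δ Γ E₁ E₂ F → ExprEq Sg Δ Γ E₂ E₁ F
  | trans {Sg : Sig C} {Δ : MCtx C} {Γ : Ctx C} {E₁ E₂ E₃ F : Expr C} :
      ExprEq Sg Δ Γ E₁ E₂ F → ExprEq Sg Δ Γ E₂ E₃ F → ExprEq Sg Δ Γ E₁ E₃ F
  | conv {Sg : Sig C} {Δ : MCtx C} {Γ : Ctx C} {E E' F F' : Expr C} {s : Srt} :
      ExprEq Sg Δ Γ E E' F → ExprEq Sg Δ Γ F F' (.sort s) → ExprEq Sg Δ Γ E E' F'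
  /-- Context conversion. -/
  | ctxConv {Sg : Sig C} {Δ : MCtx C} {Γ Γ' : Ctx C} {E E' F : Expr C} :
      ExprEq Sg Δ Γ E E' F → CtxEq Sg Δ Γ Γ' → ExprEq Sg Δ Γ' E E' F
  -- congruence (the leaves are covered by reflexivity)
  | pi {Sg : Sig C} {Δ : MCtx C} {Γ : Ctx C} {A A' E E' : Expr C} {s : Srt} :
      ExprEq Sg Δ Γ A A' (.sort .type) → ExprEq Sg Δ (A :: Γ) E E' (.sort s) →
      ExprEq Sg Δ Γ (.pi A E) (.pi A' E') (.sort s)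
  | lam {Sg : Sig C} {Δ : MCtx C} {Γ : Ctx C} {A B M M' : Expr C} :
      ExprEq Sg Δ (A :: Γ) M M' B → HasType Sg Δ (A :: Γ) B (.sort .type) →
      ExprEq Sg Δ Γ (.lam M) (.lam M') (.pi A B)
  | app {Sg : Sig C} {Δ : MCtx C} {Γ : Ctx C} {A F E E' N N' : Expr C} :
      ExprEq Sg Δ Γ E E' (.pi A F) → ExprEq Sg Δ Γ N N' A →
      ExprEq Sg Δ Γ (.app E N) (.app E' N') (.clo (.single N) F)
  | clo {Sg : Sig C} {Δ : MCtx C} {Γ Ψ : Ctx C} {σ σ' : Sub C} {E E' F : Expr C} :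
      SubEq Sg Δ Γ σ σ' Ψ → ExprEq Sg Δ Ψ E E' F →
      ExprEq Sg Δ Γ (.clo σ E) (.clo σ' E') (F.tclo σ)
  | mclo {Sg : Sig C} {Δ Δ' : MCtx C} {Γ : Ctx C} {θ θ' : MSub C} {E E' F : Expr C} :
      MSubEq Sg Δ θ θ' Δ' → ExprEq Sg Δ' Γ E E' F →
      ExprEq Sg Δ (Γ.msub θ) (.mclo θ E) (.mclo θ' E') (F.tmclo θ)
  -- β and η
  | beta {Sg : Sig C} {Δ : MCtx C} {Γ : Ctx C} {A B M N : Expr C} :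
      HasType Sg Δ (A :: Γ) M B → HasType Sg Δ (A :: Γ) B (.sort .type) → HasType Sg Δ Γ N A →
      ExprEq Sg Δ Γ (.app (.lam M) N) (.clo (.single N) M) (.clo (.single N) B)
  | eta {Sg : Sig C} {Δ : MCtx C} {Γ : Ctx C} {A B M : Expr C} :
      HasType Sg Δ Γ M (.pi A B) → HasType Sg Δ (A :: Γ) B (.sort .type) →
      ExprEq Sg Δ Γ M (.lam (.app (.clo (.shift 1) M) (.var 0))) (.pi A B)
  -- propagation of ordinary substitutions
  | clo_id {Sg : Sig C} {Δ : MCtx C} {Γ : Ctx C} {E F : Expr C} :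
      HasType Sg Δ Γ E F → ExprEq Sg Δ Γ (.clo (.shift 0) E) E F
  | clo_clo {Sg : Sig C} {Δ : MCtx C} {Γ Γ' Ψ : Ctx C} {σ τ : Sub C} {E F : Expr C} :
      SubHasType Sg Δ Γ σ Γ' → SubHasType Sg Δ Γ' τ Ψ → HasType Sg Δ Ψ E F →
      ExprEq Sg Δ Γ (.clo σ (.clo τ E)) (.clo (.clo σ τ) E) (F.tclo (.clo σ τ))
  | clo_type {Sg : Sig C} {Δ : MCtx C} {Γ Ψ : Ctx C} {σ : Sub C} :
      SubHasType Sg Δ Γ σ Ψ →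
      ExprEq Sg Δ Γ (.clo σ (.sort .type)) (.sort .type) (.sort .kind)
  | clo_const {Sg : Sig C} {Δ : MCtx C} {Γ Ψ : Ctx C} {σ : Sub C} {a : C} {K : Expr C} :
      SubHasType Sg Δ Γ σ Ψ → HasType Sg Δ Ψ (.const a) K →
      ExprEq Sg Δ Γ (.clo σ (.const a)) (.const a) (.clo σ K)
  | clo_var_zero {Sg : Sig C} {Δ : MCtx C} {Γ Ψ : Ctx C} {σ : Sub C} {A M : Expr C} :
      SubHasType Sg Δ Γ σ Ψ → HasType Sg Δ Ψ A (.sort .type) → HasType Sg Δ Γ M (.clo σ A) →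
      ExprEq Sg Δ Γ (.clo (.cons σ M) (.var 0)) M (.clo σ A)
  | var_succ {Sg : Sig C} {Δ : MCtx C} {Γ : Ctx C} {n : ℕ} {A : Expr C} :
      HasType Sg Δ Γ (.var (n + 1)) A →
      ExprEq Sg Δ Γ (.var (n + 1)) (.clo (.shift 1) (.var n)) A
  | clo_pi {Sg : Sig C} {Δ : MCtx C} {Γ Ψ : Ctx C} {σ : Sub C} {A F : Expr C} {s : Srt} :
      SubHasType Sg Δ Γ σ Ψ → HasType Sg Δ (A :: Ψ) F (.sort s) →
      ExprEq Sg Δ Γ (.clo σ (.pi A F)) (.pi (.clo σ A) (.clo σ.lift F)) (.sort s)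
  | clo_lam {Sg : Sig C} {Δ : MCtx C} {Γ Ψ : Ctx C} {σ : Sub C} {A B M : Expr C} :
      SubHasType Sg Δ Γ σ Ψ → HasType Sg Δ (A :: Ψ) M B →
      HasType Sg Δ (A :: Ψ) B (.sort .type) →
      ExprEq Sg Δ Γ (.clo σ (.lam M)) (.lam (.clo σ.lift M)) (.pi (.clo σ A) (.clo σ.lift B))
  | clo_app {Sg : Sig C} {Δ : MCtx C} {Γ Ψ : Ctx C} {σ : Sub C} {A E F N : Expr C} :
      SubHasType Sg Δ Γ σ Ψ → HasType Sg Δ Ψ E (.pi A F) → HasType Sg Δ Ψ N A →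
      ExprEq Sg Δ Γ (.clo σ (.app E N)) (.app (.clo σ E) (.clo σ N))
        (.clo (.cons σ (.clo σ N)) F)
  -- propagation of meta-substitutions
  | mclo_id {Sg : Sig C} {Δ : MCtx C} {Γ : Ctx C} {E F : Expr C} :
      HasType Sg Δ Γ E F → ExprEq Sg Δ Γ (.mclo (.shift 0) E) E F
  | mclo_mclo {Sg : Sig C} {Δ Δ' Δ'' : MCtx C} {Γ : Ctx C} {θ θ' : MSub C} {E F : Expr C} :
      MSubHasType Sg Δ θ Δ' → MSubHasType Sg Δ' θ' Δ'' → HasType Sg Δ'' Γ E F →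
      ExprEq Sg Δ (Γ.msub (.mclo θ θ')) (.mclo θ (.mclo θ' E)) (.mclo (.mclo θ θ') E)
        (F.tmclo (.mclo θ θ'))
  | mclo_type {Sg : Sig C} {Δ Δ' : MCtx C} {Γ : Ctx C} {θ : MSub C} :
      MSubHasType Sg Δ θ Δ' → CtxWf Sg Δ' Γ →
      ExprEq Sg Δ (Γ.msub θ) (.mclo θ (.sort .type)) (.sort .type) (.sort .kind)
  | mclo_const {Sg : Sig C} {Δ Δ' : MCtx C} {Γ : Ctx C} {θ : MSub C} {a : C} {K : Expr C} :
      MSubHasType Sg Δ θ Δ' → HasType Sg Δ' Γ (.const a) K →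
      ExprEq Sg Δ (Γ.msub θ) (.mclo θ (.const a)) (.const a) (.mclo θ K)
  | mclo_var {Sg : Sig C} {Δ Δ' : MCtx C} {Γ : Ctx C} {θ : MSub C} {n : ℕ} {A : Expr C} :
      MSubHasType Sg Δ θ Δ' → HasType Sg Δ' Γ (.var n) A →
      ExprEq Sg Δ (Γ.msub θ) (.mclo θ (.var n)) (.var n) (.mclo θ A)
  | mclo_mvar_zero {Sg : Sig C} {Δ Δ' : MCtx C} {Γ : Ctx C} {θ : MSub C} {A M : Expr C} :
      MSubHasType Sg Δ θ Δ' → HasType Sg Δ' Γ A (.sort .type) →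
      HasType Sg Δ (Γ.msub θ) M (.mclo θ A) →
      ExprEq Sg Δ (Γ.msub θ) (.mclo (.cons θ M) (.mvar 0)) M (.mclo θ A)
  | mvar_succ {Sg : Sig C} {Δ : MCtx C} {Γ : Ctx C} {n : ℕ} {A : Expr C} :
      HasType Sg Δ Γ (.mvar (n + 1)) A →
      ExprEq Sg Δ Γ (.mvar (n + 1)) (.mclo (.shift 1) (.mvar n)) A
  | mclo_pi {Sg : Sig C} {Δ Δ' : MCtx C} {Γ : Ctx C} {θ : MSub C} {A F : Expr C} {s : Srt} :
      MSubHasType Sg Δ θ Δ' → HasType Sg Δ' (A :: Γ) F (.sort s) →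
      ExprEq Sg Δ (Γ.msub θ) (.mclo θ (.pi A F)) (.pi (.mclo θ A) (.mclo θ F)) (.sort s)
  | mclo_lam {Sg : Sig C} {Δ Δ' : MCtx C} {Γ : Ctx C} {θ : MSub C} {A B M : Expr C} :
      MSubHasType Sg Δ θ Δ' → HasType Sg Δ' (A :: Γ) M B →
      HasType Sg Δ' (A :: Γ) B (.sort .type) →
      ExprEq Sg Δ (Γ.msub θ) (.mclo θ (.lam M)) (.lam (.mclo θ M))
        (.pi (.mclo θ A) (.mclo θ B))
  | mclo_app {Sg : Sig C} {Δ Δ' : MCtx C} {Γ : Ctx C} {θ : MSub C} {A E F N : Expr C} :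
      MSubHasType Sg Δ θ Δ' → HasType Sg Δ' Γ E (.pi A F) → HasType Sg Δ' Γ N A →
      ExprEq Sg Δ (Γ.msub θ) (.mclo θ (.app E N)) (.app (.mclo θ E) (.mclo θ N))
        (.clo (.single (.mclo θ N)) (.mclo θ F))
  | mclo_clo {Sg : Sig C} {Δ Δ' : MCtx C} {Γ Ψ : Ctx C} {θ : MSub C} {σ : Sub C}
      {E F : Expr C} :
      MSubHasType Sg Δ θ Δ' → SubHasType Sg Δ' Γ σ Ψ → HasType Sg Δ' Ψ E F →
      ExprEq Sg Δ (Γ.msub θ) (.mclo θ (.clo σ E)) (.clo (.mclo θ σ) (.mclo θ E))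
        ((F.tmclo θ).tclo (.mclo θ σ))

/-- `Δ; Γ ⊢ σ₁ ≡ σ₂ : Ψ`. -/
inductive SubEq : Sig C → MCtx C → Ctx C → Sub C → Sub C → Ctx C → Prop
  -- equivalence and conversion
  | refl {Sg : Sig C} {Δ : MCtx C} {Γ Ψ : Ctx C} {σ : Sub C} :
      SubHasType Sg Δ Γ σ Ψ → SubEq Sg Δ Γ σ σ Ψ
  | symm {Sg : Sig C} {Δ : MCtx C} {Γ Ψ : Ctx C} {σ₁ σ₂ : Sub C} :
      SubEq Sg Δ Γ σ₁ σ₂ Ψ → SubEq Sg Δ Γ σ₂ σ₁ Ψ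
  | trans {Sg : Sig C} {Δ : MCtx C} {Γ Ψ : Ctx C} {σ₁ σ₂ σ₃ : Sub C} :
      SubEq Sg Δ Γ σ₁ σ₂ Ψ → SubEq Sg Δ Γ σ₂ σ₃ Ψ → SubEq Sg Δ Γ σ₁ σ₃ Ψ
  /-- Conversion of the two contexts of the judgement. -/
  | ctxConv {Sg : Sig C} {Δ : MCtx C} {Γ Γ' Ψ Ψ' : Ctx C} {σ σ' : Sub C} :
      SubEq Sg Δ Γ σ σ' Ψ → CtxEq Sg Δ Γ Γ' → CtxEq Sg Δ Ψ Ψ' → SubEq Sg Δ Γ' σ σ' Ψ'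
  -- congruence
  | cons {Sg : Sig C} {Δ : MCtx C} {Γ Ψ : Ctx C} {σ σ' : Sub C} {A M M' : Expr C} :
      SubEq Sg Δ Γ σ σ' Ψ → HasType Sg Δ Ψ A (.sort .type) → ExprEq Sg Δ Γ M M' (.clo σ A) →
      SubEq Sg Δ Γ (.cons σ M) (.cons σ' M') (A :: Ψ)
  | clo {Sg : Sig C} {Δ : MCtx C} {Γ Ψ' Ψ : Ctx C} {σ σ' τ τ' : Sub C} :
      SubEq Sg Δ Γ τ τ' Ψ' → SubEq Sg Δ Ψ' σ σ' Ψ → SubEq Sg Δ Γ (.clo τ σ) (.clo τ' σ') Ψ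
  | mclo {Sg : Sig C} {Δ Δ' : MCtx C} {Γ Ψ : Ctx C} {θ θ' : MSub C} {σ σ' : Sub C} :
      MSubEq Sg Δ θ θ' Δ' → SubEq Sg Δ' Γ σ σ' Ψ →
      SubEq Sg Δ (Γ.msub θ) (.mclo θ σ) (.mclo θ' σ') (Ψ.msub θ)
  -- pairing, shifting, category laws
  | cons_shift {Sg : Sig C} {Δ : MCtx C} {Γ Ψ Ψ' : Ctx C} {σ : Sub C} {A M : Expr C} {n : ℕ} :
      SubHasType Sg Δ Γ (.cons σ M) (A :: (Ψ' ++ Ψ)) → Ψ'.length = n →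
      SubEq Sg Δ Γ (.clo (.cons σ M) (.shift (n + 1))) (.clo σ (.shift n)) Ψ
  | clo_cons {Sg : Sig C} {Δ : MCtx C} {Γ Ψ' Ψ : Ctx C} {σ τ : Sub C} {A M : Expr C} :
      SubHasType Sg Δ Γ σ Ψ' → SubHasType Sg Δ Ψ' (.cons τ M) (A :: Ψ) →
      SubEq Sg Δ Γ (.clo σ (.cons τ M)) (.cons (.clo σ τ) (.clo σ M)) (A :: Ψ)
  | shift_shift {Sg : Sig C} {Δ : MCtx C} {Γ Γ₁ Γ₂ : Ctx C} {m n : ℕ} :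
      CtxWf Sg Δ (Γ₂ ++ (Γ₁ ++ Γ)) → Γ₁.length = m → Γ₂.length = n →
      SubEq Sg Δ (Γ₂ ++ (Γ₁ ++ Γ)) (.clo (.shift n) (.shift m)) (.shift (n + m)) Γ
  | id_clo {Sg : Sig C} {Δ : MCtx C} {Γ Ψ : Ctx C} {σ : Sub C} :
      SubHasType Sg Δ Γ σ Ψ → SubEq Sg Δ Γ (.clo (.shift 0) σ) σ Ψ
  | clo_id {Sg : Sig C} {Δ : MCtx C} {Γ Ψ : Ctx C} {σ : Sub C} :
      SubHasType Sg Δ Γ σ Ψ → SubEq Sg Δ Γ (.clo σ (.shift 0)) σ Ψ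
  | assoc {Sg : Sig C} {Δ : MCtx C} {Γ₁ Γ₂ Γ₃ Γ₄ : Ctx C} {σ₁ σ₂ σ₃ : Sub C} :
      SubHasType Sg Δ Γ₁ σ₁ Γ₂ → SubHasType Sg Δ Γ₂ σ₂ Γ₃ → SubHasType Sg Δ Γ₃ σ₃ Γ₄ →
      SubEq Sg Δ Γ₁ (.clo σ₁ (.clo σ₂ σ₃)) (.clo (.clo σ₁ σ₂) σ₃) Γ₄
  -- propagation of meta-substitutions
  | mclo_shift {Sg : Sig C} {Δ Δ' : MCtx C} {Γ Γ' : Ctx C} {θ : MSub C} {n : ℕ} :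
      MSubHasType Sg Δ θ Δ' → CtxWf Sg Δ' (Γ' ++ Γ) → Γ'.length = n →
      SubEq Sg Δ (Γ'.msub θ ++ Γ.msub θ) (.mclo θ (.shift n)) (.shift n) (Γ.msub θ)
  | mclo_cons {Sg : Sig C} {Δ Δ' : MCtx C} {Γ Ψ : Ctx C} {θ : MSub C} {σ : Sub C}
      {A M : Expr C} :
      MSubHasType Sg Δ θ Δ' → SubHasType Sg Δ' Γ σ Ψ → HasType Sg Δ' Ψ A (.sort .type) →
      HasType Sg Δ' Γ M (.clo σ A) →
      SubEq Sg Δ (Γ.msub θ) (.mclo θ (.cons σ M)) (.cons (.mclo θ σ) (.mclo θ M))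
        (.mclo θ A :: Ψ.msub θ)
  | mclo_clo {Sg : Sig C} {Δ Δ' : MCtx C} {Γ Ψ' Ψ : Ctx C} {θ : MSub C} {τ σ : Sub C} :
      MSubHasType Sg Δ θ Δ' → SubHasType Sg Δ' Γ τ Ψ' → SubHasType Sg Δ' Ψ' σ Ψ →
      SubEq Sg Δ (Γ.msub θ) (.mclo θ (.clo τ σ)) (.clo (.mclo θ τ) (.mclo θ σ)) (Ψ.msub θ)
  | mclo_mclo {Sg : Sig C} {Δ Δ' Δ'' : MCtx C} {Γ Ψ : Ctx C} {θ θ' : MSub C} {σ : Sub C} :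
      MSubHasType Sg Δ θ Δ' → MSubHasType Sg Δ' θ' Δ'' → SubHasType Sg Δ'' Γ σ Ψ →
      SubEq Sg Δ (Γ.msub (.mclo θ θ')) (.mclo θ (.mclo θ' σ)) (.mclo (.mclo θ θ') σ)
        (Ψ.msub (.mclo θ θ'))
  -- extensionality
  | eta {Sg : Sig C} {Δ : MCtx C} {Γ Γ' : Ctx C} {A : Expr C} {n : ℕ} :
      CtxWf Sg Δ (Γ' ++ A :: Γ) → Γ'.length = n →
      SubEq Sg Δ (Γ' ++ A :: Γ) (.shift n) (.cons (.shift (n + 1)) (.var n)) (A :: Γ)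

/-- `Δ ⊢ θ₁ ≡ θ₂ : Δ'`. -/
inductive MSubEq : Sig C → MCtx C → MSub C → MSub C → MCtx C → Prop
  -- equivalence
  | refl {Sg : Sig C} {Δ Δ' : MCtx C} {θ : MSub C} :
      MSubHasType Sg Δ θ Δ' → MSubEq Sg Δ θ θ Δ'
  | symm {Sg : Sig C} {Δ Δ' : MCtx C} {θ₁ θ₂ : MSub C} :
      MSubEq Sg Δ θ₁ θ₂ Δ' → MSubEq Sg Δ θ₂ θ₁ Δ'
  | trans {Sg : Sig C} {Δ Δ' : MCtx C} {θ₁ θ₂ θ₃ : MSub C} :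
      MSubEq Sg Δ θ₁ θ₂ Δ' → MSubEq Sg Δ θ₂ θ₃ Δ' → MSubEq Sg Δ θ₁ θ₃ Δ'
  -- congruence
  | cons {Sg : Sig C} {Δ Δ' : MCtx C} {Γ : Ctx C} {θ θ' : MSub C} {A M M' : Expr C} :
      MSubEq Sg Δ θ θ' Δ' → HasType Sg Δ' Γ A (.sort .type) →
      ExprEq Sg Δ (Γ.msub θ) M M' (.mclo θ A) →
      MSubEq Sg Δ (.cons θ M) (.cons θ' M') ((Γ, A) :: Δ')
  | mclo {Sg : Sig C} {Δ Δ₀ Δ' : MCtx C} {θ₁ θ₁' θ₂ θ₂' : MSub C} :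
      MSubEq Sg Δ θ₁ θ₁' Δ₀ → MSubEq Sg Δ₀ θ₂ θ₂' Δ' →
      MSubEq Sg Δ (.mclo θ₁ θ₂) (.mclo θ₁' θ₂') Δ'
  -- pairing, shifting, category laws
  | cons_shift {Sg : Sig C} {Δ Δ₀ Δ₀' : MCtx C} {Γ : Ctx C} {θ : MSub C} {A M : Expr C}
      {n : ℕ} :
      MSubHasType Sg Δ (.cons θ M) ((Γ, A) :: (Δ₀' ++ Δ₀)) → Δ₀'.length = n →
      MSubEq Sg Δ (.mclo (.cons θ M) (.shift (n + 1))) (.mclo θ (.shift n)) Δ₀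
  | mclo_cons {Sg : Sig C} {Δ Δ₀' Δ₀ : MCtx C} {Γ : Ctx C} {θ θ' : MSub C} {A M : Expr C} :
      MSubHasType Sg Δ θ Δ₀' → MSubHasType Sg Δ₀' (.cons θ' M) ((Γ, A) :: Δ₀) →
      MSubEq Sg Δ (.mclo θ (.cons θ' M)) (.cons (.mclo θ θ') (.mclo θ M)) ((Γ, A) :: Δ₀)
  | shift_shift {Sg : Sig C} {Δ Δ₁ Δ₂ : MCtx C} {m n : ℕ} :
      MCtxWf Sg (Δ₂ ++ (Δ₁ ++ Δ)) → Δ₁.length = m → Δ₂.length = n →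
      MSubEq Sg (Δ₂ ++ (Δ₁ ++ Δ)) (.mclo (.shift n) (.shift m)) (.shift (n + m)) Δ
  | id_mclo {Sg : Sig C} {Δ Δ₀ : MCtx C} {θ : MSub C} :
      MSubHasType Sg Δ θ Δ₀ → MSubEq Sg Δ (.mclo (.shift 0) θ) θ Δ₀
  | mclo_id {Sg : Sig C} {Δ Δ₀ : MCtx C} {θ : MSub C} :
      MSubHasType Sg Δ θ Δ₀ → MSubEq Sg Δ (.mclo θ (.shift 0)) θ Δ₀
  | assoc {Sg : Sig C} {Δ₁ Δ₂ Δ₃ Δ₄ : MCtx C} {θ₁ θ₂ θ₃ : MSub C} :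
      MSubHasType Sg Δ₁ θ₁ Δ₂ → MSubHasType Sg Δ₂ θ₂ Δ₃ → MSubHasType Sg Δ₃ θ₃ Δ₄ →
      MSubEq Sg Δ₁ (.mclo θ₁ (.mclo θ₂ θ₃)) (.mclo (.mclo θ₁ θ₂) θ₃) Δ₄
  -- extensionality
  | eta {Sg : Sig C} {Δ Δ' : MCtx C} {Γ : Ctx C} {A : Expr C} {n : ℕ} :
      MCtxWf Sg (Δ' ++ (Γ, A) :: Δ) → Δ'.length = n →
      MSubEq Sg (Δ' ++ (Γ, A) :: Δ) (.shift n) (.cons (.shift (n + 1)) (.mvar n))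
        ((Γ, A) :: Δ)

end

/-- Plain LF expressions: no meta-variables and no closures. -/
inductive Expr.IsPlain : Expr C → Prop
  | sort (s : Srt) : IsPlain (.sort s)
  | const (a : C) : IsPlain (.const a)
  | pi {A E : Expr C} : IsPlain A → IsPlain E → IsPlain (.pi A E)
  | var (n : ℕ) : IsPlain (.var n)
  | lam {M : Expr C} : IsPlain M → IsPlain (.lam M)
  | app {E N : Expr C} : IsPlain E → IsPlain N → IsPlain (.app E N)

/-- Well-formed LF signatures: distinct names, and every declared classifier is a closed plain
type or kind over the earlier declarations. -/
inductive SigWf : Sig C → Prop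
  | nil : SigWf []
  | cons {Sg : Sig C} {a : C} {K : Expr C} {s : Srt} :
      SigWf Sg → (∀ K', (a, K') ∉ Sg) → K.IsPlain → HasType Sg [] [] K (.sort s) →
      SigWf ((a, K) :: Sg)

/-- Meta-environments `η`. -/
inductive MEnv (C : Type u) : Type u
  | shift (n : ℕ)
  | cons (η : MEnv C) (M : Expr C)

mutual

/-- Environments `ρ`. -/
inductive Env (C : Type u) : Type u
  | shift (n : ℕ)
  | cons (ρ : Env C) (L : Clos C)
  /-- The shifted environment `[↑ⁿ]ρ`. -/
  | shiftBy (n : ℕ) (ρ : Env C)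

/-- Closures `L`. -/
inductive Clos (C : Type u) : Type u
  | var (n : ℕ)
  /-- The closure `[ρ]⟦η⟧E`. -/
  | clo (ρ : Env C) (η : MEnv C) (E : Expr C)

end

/-- Neutral weak head normal forms `H`. -/
inductive Neut (C : Type u) : Type u
  | const (a : C)
  | var (n : ℕ)
  /-- `[ρ]X_{n+1}`. -/
  | mvar (ρ : Env C) (n : ℕ)
  | app (H : Neut C) (L : Clos C)

/-- Weak head normal forms `W`. (The untypable sort `kind` is included, as evaluation returns
every sort unchanged.) -/
inductive Whnf (C : Type u) : Type u
  | sort (s : Srt)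
  /-- `[ρ]⟦η⟧(Π A. B)`. -/
  | pi (ρ : Env C) (η : MEnv C) (A B : Expr C)
  /-- `[ρ]⟦η⟧(λ M)`. -/
  | lam (ρ : Env C) (η : MEnv C) (M : Expr C)
  | neut (H : Neut C)

/-- A meta-environment as a meta-substitution. -/
def MEnv.toMSub : MEnv C → MSub C
  | .shift n => .shift n
  | .cons η M => .cons η.toMSub M

mutual

/-- An environment as a substitution. -/
def Env.toSub : Env C → Sub C
  | .shift n => .shift n
  | .cons ρ L => .cons ρ.toSub L.toExpr
  | .shiftBy n ρ => .clo (.shift n) ρ.toSub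

/-- A closure as an expression. -/
def Clos.toExpr : Clos C → Expr C
  | .var n => .var n
  | .clo ρ η E => .clo ρ.toSub (.mclo η.toMSub E)

end

/-- A neutral weak head normal form as an expression. -/
def Neut.toExpr : Neut C → Expr C
  | .const a => .const a
  | .var n => .var n
  | .mvar ρ n => .clo ρ.toSub (.mvar n)
  | .app H L => .app H.toExpr L.toExpr

/-- A weak head normal form as an expression. -/
def Whnf.toExpr : Whnf C → Expr C
  | .sort s => .sort s
  | .pi ρ η A B => .clo ρ.toSub (.mclo η.toMSub (.pi A B))
  | .lam ρ η M => .clo ρ.toSub (.mclo η.toMSub (.lam M))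
  | .neut H => H.toExpr

/-- Shifting of a closure. -/
def Clos.shiftBy (n : ℕ) : Clos C → Clos C
  | .var m => .var (n + m)
  | .clo ρ η E => .clo (.shiftBy n ρ) η E

/-- Meta-substitution evaluation: the meta-environment form of `⟦η⟧θ`. -/
def menvEval : MEnv C → MSub C → MEnv C
  | .shift m, .shift n => .shift (m + n)
  | .cons η M, .shift 0 => .cons η M
  | .cons η _, .shift (n + 1) => menvEval η (.shift n)
  | η, .cons θ M => .cons (menvEval η θ) (.mclo η.toMSub M)
  | η, .mclo θ θ' => menvEval (menvEval η θ) θ'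
termination_by η θ => (sizeOf θ, sizeOf η)

/-- Substitution evaluation: the environment form of `[ρ]⟦η⟧σ`. -/
def envEval : Env C → MEnv C → Sub C → Env C
  | .shiftBy k ρ, η, σ => .shiftBy k (envEval ρ η σ)
  | ρ, _, .shift 0 => ρ
  | .shift k, _, .shift n => .shift (k + n)
  | .cons ρ _, η, .shift (n + 1) => envEval ρ η (.shift n)
  | ρ, η, .cons σ M => .cons (envEval ρ η σ) (.clo ρ η M)
  | ρ, η, .clo σ τ => envEval (envEval ρ η σ) η τ
  | ρ, η, .mclo θ σ => envEval ρ (menvEval η θ) σ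
termination_by ρ _ σ => (sizeOf σ, sizeOf ρ)

/-- Meta-variable lookup: the binding of `X_{m+1}` in `η`. -/
def mlookup : MEnv C → ℕ → Expr C
  | .shift n, m => .mvar (n + m)
  | .cons _ E, 0 => E
  | .cons η _, m + 1 => mlookup η m

/-- Variable lookup: the closure form of `[ρ]x_{m+1}`. -/
def lookup : Env C → ℕ → Clos C
  | .shift n, m => .var (n + m)
  | .cons _ L, 0 => L
  | .cons ρ _, m + 1 => lookup ρ m
  | .shiftBy n ρ, m => (lookup ρ m).shiftBy n

mutual

/-- The graph of the partial function `whnf`: `WhnfTo L W` says that `whnf L` is defined and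
equal to `W`. -/
inductive WhnfTo : Clos C → Whnf C → Prop
  | var {m : ℕ} : WhnfTo (.var m) (.neut (.var m))
  | sort {ρ : Env C} {η : MEnv C} {s : Srt} : WhnfTo (.clo ρ η (.sort s)) (.sort s)
  | const {ρ : Env C} {η : MEnv C} {a : C} : WhnfTo (.clo ρ η (.const a)) (.neut (.const a))
  | clo_var {ρ : Env C} {η : MEnv C} {m : ℕ} {W : Whnf C} :
      WhnfTo (lookup ρ m) W → WhnfTo (.clo ρ η (.var m)) W
  | mvar_id {ρ : Env C} {m : ℕ} :
      WhnfTo (.clo ρ (.shift 0) (.mvar m)) (.neut (.mvar ρ m))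
  | mvar {ρ : Env C} {η : MEnv C} {m : ℕ} {W : Whnf C} :
      η ≠ .shift 0 → WhnfTo (.clo ρ (.shift 0) (mlookup η m)) W →
      WhnfTo (.clo ρ η (.mvar m)) W
  | pi {ρ : Env C} {η : MEnv C} {A E : Expr C} : WhnfTo (.clo ρ η (.pi A E)) (.pi ρ η A E)
  | lam {ρ : Env C} {η : MEnv C} {M : Expr C} : WhnfTo (.clo ρ η (.lam M)) (.lam ρ η M)
  | app {ρ : Env C} {η : MEnv C} {M N : Expr C} {W W' : Whnf C} :
      WhnfTo (.clo ρ η M) W → AppTo W (.clo ρ η N) W' → WhnfTo (.clo ρ η (.app M N)) W'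
  | clo {ρ : Env C} {η : MEnv C} {σ : Sub C} {M : Expr C} {W : Whnf C} :
      WhnfTo (.clo (envEval ρ η σ) η M) W → WhnfTo (.clo ρ η (.clo σ M)) W
  | mclo {ρ : Env C} {η : MEnv C} {θ : MSub C} {M : Expr C} {W : Whnf C} :
      WhnfTo (.clo ρ (menvEval η θ) M) W → WhnfTo (.clo ρ η (.mclo θ M)) W

/-- The graph of the partial function `@`: `AppTo W L W'` says that `W @ L` is defined and equal
to `W'`. -/
inductive AppTo : Whnf C → Clos C → Whnf C → Prop
  | lam {ρ : Env C} {η : MEnv C} {M : Expr C} {L : Clos C} {W : Whnf C} :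
      WhnfTo (.clo (.cons ρ L) η M) W → AppTo (.lam ρ η M) L W
  | neut {H : Neut C} {L : Clos C} : AppTo (.neut H) L (.neut (.app H L))

end

end CMTT

namespace CMTT

set_option linter.unusedSectionVars false

variable {C : Type u} {Sg : Sig C}

/-! ### Levels of expressions -/

/-- The level of an expression, given the levels of the constants: `0` for terms, `1` for types and
type families, `2` for kinds, and `3` for the sort `kind`. -/
def Expr.level (lv : C → ℕ) : Expr C → ℕ
  | .sort .kind => 3
  | .sort .type => 2
  | .const a => lv a
  | .pi _ E => E.level lv
  | .var _ => 0
  | .mvar _ => 0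
  | .lam _ => 0
  | .app E _ => E.level lv
  | .clo _ E => E.level lv
  | .mclo _ E => E.level lv

/-- Whether an expression has a sort at its head, below products, applications and closures. -/
def Expr.EndsInSort : Expr C → Prop
  | .sort _ => True
  | .const _ => False
  | .pi _ E => E.EndsInSort
  | .var _ => False
  | .mvar _ => False
  | .lam _ => False
  | .app E _ => E.EndsInSort
  | .clo _ E => E.EndsInSort
  | .mclo _ E => E.EndsInSort

theorem Expr.two_le_level_iff {lv : C → ℕ} (hlv : ∀ a, lv a ≤ 1) :
    ∀ E : Expr C, 2 ≤ E.level lv ↔ E.EndsInSort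
  | .sort .kind => by simp [level, EndsInSort]
  | .sort .type => by simp [level, EndsInSort]
  | .const a => by have := hlv a; simp only [level, EndsInSort, iff_false]; omega
  | .pi _ E => by simpa [level, EndsInSort] using two_le_level_iff hlv E
  | .var _ => by simp [level, EndsInSort]
  | .mvar _ => by simp [level, EndsInSort]
  | .lam _ => by simp [level, EndsInSort]
  | .app E _ => by simpa [level, EndsInSort] using two_le_level_iff hlv E
  | .clo _ E => by simpa [level, EndsInSort] using two_le_level_iff hlv E
  | .mclo _ E => by simpa [level, EndsInSort] using two_le_level_iff hlv E

/-- `lv` assigns to every constant the level determined by its declared classifier. -/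
def Sig.Levels (Sg : Sig C) (lv : C → ℕ) : Prop :=
  ∀ a K, (a, K) ∈ Sg → K.level lv = lv a + 1 ∧ lv a ≤ 1

/-- The relation between the levels of an expression and of its classifier. -/
def LevelOk (lv : C → ℕ) (E F : Expr C) : Prop :=
  F.level lv = E.level lv + 1 ∧ E.level lv ≤ 2 ∧ (E.level lv = 2 → F = .sort .kind)

@[simp] theorem Expr.level_tclo (lv : C → ℕ) (σ : Sub C) (F : Expr C) :
    (F.tclo σ).level lv = F.level lv := by
  unfold Expr.tclo; split <;> rfl

@[simp] theorem Expr.level_tmclo (lv : C → ℕ) (θ : MSub C) (F : Expr C) :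
    (F.tmclo θ).level lv = F.level lv := by
  unfold Expr.tmclo; split <;> rfl

@[simp] theorem Expr.level_clo (lv : C → ℕ) (σ : Sub C) (F : Expr C) :
    (Expr.clo σ F).level lv = F.level lv := rfl

@[simp] theorem Expr.level_mclo (lv : C → ℕ) (θ : MSub C) (F : Expr C) :
    (Expr.mclo θ F).level lv = F.level lv := rfl

theorem LevelOk.of_level_lt {lv : C → ℕ} {E F : Expr C} (h : F.level lv = E.level lv + 1)
    (h' : E.level lv < 2) : LevelOk lv E F := ⟨h, h'.le, fun h'' => by omega⟩

theorem LevelOk.clo {lv : C → ℕ} {E F : Expr C} (h : LevelOk lv E F) (σ : Sub C) :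
    LevelOk lv (.clo σ E) (F.tclo σ) :=
  ⟨by simpa using h.1, h.2.1, fun h' => by rw [h.2.2 h']; rfl⟩

theorem LevelOk.mclo {lv : C → ℕ} {E F : Expr C} (h : LevelOk lv E F) (θ : MSub C) :
    LevelOk lv (.mclo θ E) (F.tmclo θ) :=
  ⟨by simpa using h.1, h.2.1, fun h' => by rw [h.2.2 h']; rfl⟩

theorem LevelOk.level_of_type {lv : C → ℕ} {A : Expr C} (h : LevelOk lv A (.sort .type)) :
    A.level lv = 1 := by
  have := h.1; simp only [Expr.level] at this; omega

theorem LevelOk.congr {lv : C → ℕ} {E E' F : Expr C} (h : LevelOk lv E F)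
    (h' : E.level lv = E'.level lv) : LevelOk lv E' F := by
  unfold LevelOk at *; rwa [← h']

theorem LevelOk.conv {lv : C → ℕ} {E F₁ F₂ : Expr C} {s : Srt} (h : LevelOk lv E F₁)
    (h₁ : LevelOk lv F₁ (.sort s)) (h' : F₁.level lv = F₂.level lv) : LevelOk lv E F₂ :=
  .of_level_lt (h' ▸ h.1) (by
    have h₂ := h₁.1
    have h₃ := h.1
    have h₄ := h₁.2.1
    omega)

theorem LevelOk.app {lv : C → ℕ} {E A F N : Expr C} {σ : Sub C} (h : LevelOk lv E (.pi A F)) :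
    LevelOk lv (.app E N) (.clo σ F) := by
  refine .of_level_lt h.1 (lt_of_le_of_ne h.2.1 fun h' => ?_)
  cases h.2.2 h'

mutual

theorem HasType.levelOk {lv : C → ℕ} (hlv : Sg.Levels lv) {Δ : MCtx C} {Γ : Ctx C}
    {E F : Expr C} : HasType Sg Δ Γ E F → LevelOk lv E F
  | .type _ => ⟨rfl, le_rfl, fun _ => rfl⟩
  | .const _ h => .of_level_lt (hlv _ _ h).1 (Nat.lt_succ_of_le (hlv _ _ h).2)
  | .pi h => h.levelOk hlv
  | .var_zero h => .of_level_lt (h.levelOk hlv).level_of_type (Nat.zero_lt_two)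
  | .var_succ h _ => .of_level_lt (h.levelOk hlv).1 (Nat.zero_lt_two)
  | .mvar_zero h => .of_level_lt (h.levelOk hlv).level_of_type (Nat.zero_lt_two)
  | .mvar_succ h _ => .of_level_lt (h.levelOk hlv).1 (Nat.zero_lt_two)
  | .lam _ h => .of_level_lt (h.levelOk hlv).level_of_type (Nat.zero_lt_two)
  | .app h _ => (h.levelOk hlv).app
  | .clo _ h => (h.levelOk hlv).clo _
  | .mclo _ h => (h.levelOk hlv).mclo _
  | .conv h e => (h.levelOk hlv).conv (e.levelOk hlv).1 (e.levelOk hlv).2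
  | .ctxConv h _ => h.levelOk hlv

theorem ExprEq.levelOk {lv : C → ℕ} (hlv : Sg.Levels lv) {Δ : MCtx C} {Γ : Ctx C}
    {E E' F : Expr C} : ExprEq Sg Δ Γ E E' F → LevelOk lv E F ∧ E.level lv = E'.level lv
  | .refl h => ⟨h.levelOk hlv, rfl⟩
  | .symm e => ⟨(e.levelOk hlv).1.congr (e.levelOk hlv).2, (e.levelOk hlv).2.symm⟩
  | .trans e e' => ⟨(e.levelOk hlv).1, (e.levelOk hlv).2.trans (e'.levelOk hlv).2⟩
  | .conv e e' => ⟨(e.levelOk hlv).1.conv (e'.levelOk hlv).1 (e'.levelOk hlv).2,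
      (e.levelOk hlv).2⟩
  | .ctxConv e _ => e.levelOk hlv
  | .pi _ e => e.levelOk hlv
  | .lam _ h => ⟨.of_level_lt (h.levelOk hlv).level_of_type (Nat.zero_lt_two), rfl⟩
  | .app e _ => ⟨(e.levelOk hlv).1.app, (e.levelOk hlv).2⟩
  | .clo _ e => ⟨(e.levelOk hlv).1.clo _, (e.levelOk hlv).2⟩
  | .mclo _ e => ⟨(e.levelOk hlv).1.mclo _, (e.levelOk hlv).2⟩
  | .beta (M := M) (B := B) h h' _ => by
      have h₁ := (h'.levelOk hlv).level_of_type
      have h₂ := (h.levelOk hlv).1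
      exact ⟨.of_level_lt h₁ (Nat.zero_lt_two), by simp only [Expr.level]; omega⟩
  | .eta h h' => by
      have h₁ := (h'.levelOk hlv).level_of_type
      have h₂ := (h.levelOk hlv).1
      simp only [Expr.level] at h₂
      exact ⟨h.levelOk hlv, by simp only [Expr.level]; omega⟩
  | .clo_id h => ⟨h.levelOk hlv, rfl⟩
  | .clo_clo _ _ h => ⟨((h.levelOk hlv).clo _), rfl⟩
  | .clo_type _ => ⟨⟨rfl, le_rfl, fun _ => rfl⟩, rfl⟩
  | .clo_const (a := a) _ h => by
      have h₁ := h.levelOk hlv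
      refine ⟨⟨h₁.1, h₁.2.1, fun h₂ => ?_⟩, rfl⟩
      exact absurd (h.const_level hlv _ rfl) (by simp only [Expr.level] at h₂; omega)
  | .clo_var_zero _ h h' => by
      have h₁ := (h.levelOk hlv).level_of_type
      have h₂ := (h'.levelOk hlv).1
      simp only [Expr.level] at h₂
      exact ⟨.of_level_lt h₁ (Nat.zero_lt_two), by simp only [Expr.level]; omega⟩
  | .var_succ h => ⟨h.levelOk hlv, rfl⟩
  | .clo_pi _ h => ⟨h.levelOk hlv, rfl⟩
  | .clo_lam _ _ h => ⟨.of_level_lt (h.levelOk hlv).level_of_type (Nat.zero_lt_two), rfl⟩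
  | .clo_app _ h _ => by
      have h' := (h.levelOk hlv).app (N := .sort .type) (σ := .shift 0)
      exact ⟨⟨h'.1, h'.2.1, fun h'' => by cases h'.2.2 h''⟩, rfl⟩
  | .mclo_id h => ⟨h.levelOk hlv, rfl⟩
  | .mclo_mclo _ _ h => ⟨((h.levelOk hlv).mclo _), rfl⟩
  | .mclo_type _ _ => ⟨⟨rfl, le_rfl, fun _ => rfl⟩, rfl⟩
  | .mclo_const _ h => by
      have h₁ := h.levelOk hlv
      refine ⟨⟨h₁.1, h₁.2.1, fun h₂ => ?_⟩, rfl⟩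
      exact absurd (h.const_level hlv _ rfl) (by simp only [Expr.level] at h₂; omega)
  | .mclo_var _ h => ⟨.of_level_lt (h.levelOk hlv).1 (Nat.zero_lt_two), rfl⟩
  | .mclo_mvar_zero _ h h' => by
      have h₁ := (h.levelOk hlv).level_of_type
      have h₂ := (h'.levelOk hlv).1
      simp only [Expr.level] at h₂
      exact ⟨.of_level_lt h₁ (Nat.zero_lt_two), by simp only [Expr.level]; omega⟩
  | .mvar_succ h => ⟨h.levelOk hlv, rfl⟩
  | .mclo_pi _ h => ⟨h.levelOk hlv, rfl⟩
  | .mclo_lam _ _ h => ⟨.of_level_lt (h.levelOk hlv).level_of_type (Nat.zero_lt_two), rfl⟩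
  | .mclo_app _ h _ => by
      have h' := (h.levelOk hlv).app (N := .sort .type) (σ := .shift 0)
      exact ⟨⟨h'.1, h'.2.1, fun h'' => by cases h'.2.2 h''⟩, rfl⟩
  | .mclo_clo _ _ h => ⟨((h.levelOk hlv).clo (.shift 0)).mclo (.shift 0) |> fun h' =>
      ⟨by simpa using h'.1, h'.2.1, fun h'' => by rw [(h.levelOk hlv).2.2 h'']; rfl⟩, rfl⟩

theorem HasType.const_level {lv : C → ℕ} (hlv : Sg.Levels lv) {Δ : MCtx C} {Γ : Ctx C}
    {E F : Expr C} : HasType Sg Δ Γ E F → ∀ a, E = .const a → lv a ≤ 1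
  | .const _ h, _, rfl => (hlv _ _ h).2
  | .conv h _, a, h' => h.const_level hlv a h'
  | .ctxConv h _, a, h' => h.const_level hlv a h'

end

theorem SigWf.unique (hSg : SigWf Sg) {a : C} {K K' : Expr C} (h : (a, K) ∈ Sg)
    (h' : (a, K') ∈ Sg) : K = K' := by
  induction hSg with
  | nil => cases h
  | cons _ h₁ _ _ ih =>
    rcases List.mem_cons.1 h with h₂ | h₂ <;> rcases List.mem_cons.1 h' with h₃ | h₃
    · cases h₂; cases h₃; rfl
    · cases h₂; exact absurd h₃ (h₁ _)
    · cases h₃; exact absurd h₂ (h₁ _)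
    · exact ih h₂ h₃

open Classical in
/-- The level of a constant, read off from its declaration. -/
noncomputable def Sig.level (Sg : Sig C) (a : C) : ℕ :=
  if ∃ K, (a, K) ∈ Sg ∧ K.EndsInSort then 1 else 0

theorem Sig.level_le (Sg : Sig C) (a : C) : Sg.level a ≤ 1 := by
  unfold Sig.level; split <;> omega

theorem SigWf.level_eq_one_iff (hSg : SigWf Sg) {a : C} {K : Expr C} (h : (a, K) ∈ Sg) :
    Sg.level a = 1 ↔ K.EndsInSort := by
  unfold Sig.level
  split
  · next h' =>
    obtain ⟨K', h₁, h₂⟩ := h'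
    simpa [hSg.unique h h₁] using h₂
  · next h' => simpa using fun h₁ => h' ⟨K, h, h₁⟩

theorem SigWf.levels_aux (hSg : SigWf Sg) {lv : C → ℕ} (h₀ : ∀ a, lv a ≤ 1)
    (h₁ : ∀ a K, (a, K) ∈ Sg → (lv a = 1 ↔ K.EndsInSort)) : Sg.Levels lv := by
  induction hSg with
  | nil => intro a K h; cases h
  | @cons Sg a K s hSg h₂ h₃ h₄ ih =>
    have ih := ih fun a K h => h₁ a K (List.mem_cons_of_mem _ h)
    intro a' K' h
    rcases List.mem_cons.1 h with h | h
    · cases h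
      refine ⟨?_, h₀ a⟩
      have h₅ := (h₄.levelOk ih).1
      have h₆ := h₁ a K List.mem_cons_self
      have h₇ := Expr.two_le_level_iff h₀ K
      have h₈ := h₀ a
      cases s <;> simp only [Expr.level] at h₅
      · have := h₆.2 (h₇.1 (by omega)); omega
      · have : ¬ lv a = 1 := fun h => by have := h₇.2 (h₆.1 h); omega
        omega
    · exact ih a' K' h

theorem SigWf.levels (hSg : SigWf Sg) : Sg.Levels Sg.level :=
  hSg.levels_aux Sg.level_le fun _ _ h => hSg.level_eq_one_iff h

/-! ### Classifiers -/

section Classifiers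

variable [hSg : Fact (SigWf Sg)] {Δ Δ' Δ'' : MCtx C} {Γ Γ' Ψ : Ctx C}
  {A A' E E' F F' F'' : Expr C} {σ σ' τ : Sub C} {θ θ' : MSub C} {s s' : Srt}

theorem HasType.ne_kind (h : HasType Sg Δ Γ E F) : E ≠ .sort .kind := by
  rintro rfl
  have := (h.levelOk hSg.out.levels).2.1
  simp [Expr.level] at this

theorem ExprEq.ne_kind (h : ExprEq Sg Δ Γ E E' F) : E ≠ .sort .kind := by
  rintro rfl
  have := (h.levelOk hSg.out.levels).1.2.1
  simp [Expr.level] at this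

theorem HasType.eq_kind_of_sort (h : HasType Sg Δ Γ (.sort s) F) :
    s = .type ∧ F = .sort .kind := by
  have h' := h.levelOk hSg.out.levels
  cases s
  · exact absurd rfl h.ne_kind
  · exact ⟨rfl, h'.2.2 rfl⟩

theorem Expr.tclo_eq (h : A ≠ .sort .kind) : A.tclo σ = .clo σ A := by
  unfold Expr.tclo
  split
  · exact absurd rfl h
  · rfl

theorem Expr.tmclo_eq (h : A ≠ .sort .kind) : A.tmclo θ = .mclo θ A := by
  unfold Expr.tmclo
  split
  · exact absurd rfl h
  · rfl

theorem HasType.tclo_eq (h : HasType Sg Δ Γ E F) : E.tclo σ = .clo σ E :=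
  Expr.tclo_eq h.ne_kind

theorem HasType.tmclo_eq (h : HasType Sg Δ Γ E F) : E.tmclo θ = .mclo θ E :=
  Expr.tmclo_eq h.ne_kind

/-- `F` is a possible classifier: `kind`, a kind or a type. -/
def IsClass (Sg : Sig C) (Δ : MCtx C) (Γ : Ctx C) (F : Expr C) : Prop :=
  F = .sort .kind ∨ ∃ s, HasType Sg Δ Γ F (.sort s)

/-- Equality of classifiers. -/
def ClassEq (Sg : Sig C) (Δ : MCtx C) (Γ : Ctx C) (F F' : Expr C) : Prop :=
  F = F' ∨ ∃ s, ExprEq Sg Δ Γ F F' (.sort s)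

theorem IsClass.of_sort (h : HasType Sg Δ Γ F (.sort s)) : IsClass Sg Δ Γ F := .inr ⟨s, h⟩

theorem ClassEq.refl (F : Expr C) : ClassEq Sg Δ Γ F F := .inl rfl

theorem ClassEq.of_eq (h : ExprEq Sg Δ Γ F F' (.sort s)) : ClassEq Sg Δ Γ F F' := .inr ⟨s, h⟩

theorem ClassEq.symm (h : ClassEq Sg Δ Γ F F') : ClassEq Sg Δ Γ F' F := by
  rcases h with rfl | ⟨s, h⟩
  · exact .refl _
  · exact .of_eq h.symm

theorem ClassEq.trans (h : ClassEq Sg Δ Γ F F') (h' : ClassEq Sg Δ Γ F' F'') :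
    ClassEq Sg Δ Γ F F'' := by
  rcases h with rfl | ⟨s, h⟩
  · exact h'
  rcases h' with rfl | ⟨s', h'⟩
  · exact .of_eq h
  have h₁ := h.levelOk hSg.out.levels
  have h₂ := h'.levelOk hSg.out.levels
  have h₃ : (Expr.sort s : Expr C).level Sg.level = (Expr.sort s' : Expr C).level Sg.level := by
    rw [h₁.1.1, h₂.1.1, h₁.2]
  have : s = s' := by cases s <;> cases s' <;> simp_all [Expr.level]
  subst this
  exact .of_eq (h.trans h')

theorem ClassEq.ctxConv (h : ClassEq Sg Δ Γ F F') (e : CtxEq Sg Δ Γ Γ') :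
    ClassEq Sg Δ Γ' F F' := by
  rcases h with rfl | ⟨s, h⟩
  · exact .refl _
  · exact .of_eq (h.ctxConv e)

theorem IsClass.ctxConv (h : IsClass Sg Δ Γ F) (e : CtxEq Sg Δ Γ Γ') : IsClass Sg Δ Γ' F := by
  rcases h with rfl | ⟨s, h⟩
  · exact .inl rfl
  · exact .of_sort (h.ctxConv e)

theorem HasType.classConv (h : HasType Sg Δ Γ E F) (e : ClassEq Sg Δ Γ F F') :
    HasType Sg Δ Γ E F' := by
  rcases e with rfl | ⟨s, e⟩
  · exact h
  · exact h.conv e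

theorem ExprEq.classConv (h : ExprEq Sg Δ Γ E E' F) (e : ClassEq Sg Δ Γ F F') :
    ExprEq Sg Δ Γ E E' F' := by
  rcases e with rfl | ⟨s, e⟩
  · exact h
  · exact h.conv e

theorem IsClass.clo (h : IsClass Sg Δ Ψ F) (hσ : SubHasType Sg Δ Γ σ Ψ) :
    IsClass Sg Δ Γ (F.tclo σ) := by
  rcases h with rfl | ⟨s, h⟩
  · exact .inl rfl
  · rw [h.tclo_eq]
    cases s
    · exact .of_sort (s := .kind) (.clo hσ h)
    · exact .of_sort (s := .type) ((HasType.clo hσ h).conv (.clo_type hσ))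

theorem ClassEq.clo_sort (hσ : SubHasType Sg Δ Γ σ Ψ) (s : Srt) :
    ClassEq Sg Δ Γ ((Expr.sort s).tclo σ) (.sort s) := by
  cases s
  · exact .refl _
  · exact .of_eq (.clo_type hσ)

theorem ClassEq.mclo_sort (hθ : MSubHasType Sg Δ θ Δ') (hΓ : CtxWf Sg Δ' Γ) (s : Srt) :
    ClassEq Sg Δ (Γ.msub θ) ((Expr.sort s).tmclo θ) (.sort s) := by
  cases s
  · exact .refl _
  · exact .of_eq (.mclo_type hθ hΓ)

theorem HasType.clo_sort (h : HasType Sg Δ Ψ A (.sort s)) (hσ : SubHasType Sg Δ Γ σ Ψ) :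
    HasType Sg Δ Γ (.clo σ A) (.sort s) :=
  (HasType.clo hσ h).classConv (.clo_sort hσ s)

theorem HasType.mclo_sort (h : HasType Sg Δ' Γ A (.sort s)) (hθ : MSubHasType Sg Δ θ Δ')
    (hΓ : CtxWf Sg Δ' Γ) : HasType Sg Δ (Γ.msub θ) (.mclo θ A) (.sort s) :=
  (HasType.mclo hθ h).classConv (.mclo_sort hθ hΓ s)

theorem ExprEq.clo_sort (h : ExprEq Sg Δ Ψ A A' (.sort s)) (e : SubEq Sg Δ Γ σ σ' Ψ)
    (hσ : SubHasType Sg Δ Γ σ Ψ) : ExprEq Sg Δ Γ (.clo σ A) (.clo σ' A') (.sort s) :=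
  (ExprEq.clo e h).classConv (.clo_sort hσ s)

theorem ExprEq.mclo_sort (h : ExprEq Sg Δ' Γ A A' (.sort s)) (e : MSubEq Sg Δ θ θ' Δ')
    (hθ : MSubHasType Sg Δ θ Δ') (hΓ : CtxWf Sg Δ' Γ) :
    ExprEq Sg Δ (Γ.msub θ) (.mclo θ A) (.mclo θ' A') (.sort s) :=
  (ExprEq.mclo e h).classConv (.mclo_sort hθ hΓ s)

theorem ExprEq.clo_clo_sort (h : HasType Sg Δ Ψ A (.sort s)) (hσ : SubHasType Sg Δ Γ σ Γ')
    (hτ : SubHasType Sg Δ Γ' τ Ψ) :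
    ExprEq Sg Δ Γ (.clo σ (.clo τ A)) (.clo (.clo σ τ) A) (.sort s) :=
  (ExprEq.clo_clo hσ hτ h).classConv (.clo_sort (.clo hσ hτ) s)

theorem ExprEq.mclo_mclo_sort (h : HasType Sg Δ'' Γ A (.sort s)) (hθ : MSubHasType Sg Δ θ Δ')
    (hθ' : MSubHasType Sg Δ' θ' Δ'') (hΓ : CtxWf Sg Δ'' Γ) :
    ExprEq Sg Δ (Γ.msub (.mclo θ θ')) (.mclo θ (.mclo θ' A)) (.mclo (.mclo θ θ') A) (.sort s) :=
  (ExprEq.mclo_mclo hθ hθ' h).classConv (.mclo_sort (.mclo hθ hθ') hΓ s)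

theorem ExprEq.mclo_clo_sort (h : HasType Sg Δ' Ψ A (.sort s)) (hθ : MSubHasType Sg Δ θ Δ')
    (hσ : SubHasType Sg Δ' Γ σ Ψ) (hΨ : CtxWf Sg Δ' Ψ) :
    ExprEq Sg Δ (Γ.msub θ) (.mclo θ (.clo σ A)) (.clo (.mclo θ σ) (.mclo θ A)) (.sort s) := by
  refine (ExprEq.mclo_clo hθ hσ h).classConv ?_
  cases s
  · exact .refl _
  · have hθσ := SubHasType.mclo hθ hσ
    exact .of_eq ((ExprEq.clo (.refl hθσ) (.mclo_type hθ hΨ)).trans (.clo_type hθσ))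

theorem ClassEq.clo (h : ClassEq Sg Δ Ψ F F') (hF : IsClass Sg Δ Ψ F)
    (e : SubEq Sg Δ Γ σ σ' Ψ) (hσ : SubHasType Sg Δ Γ σ Ψ) :
    ClassEq Sg Δ Γ (F.tclo σ) (F'.tclo σ') := by
  rcases h with rfl | ⟨s, h⟩
  · rcases hF with rfl | ⟨s, hF⟩
    · exact .refl _
    · rw [hF.tclo_eq, hF.tclo_eq]
      exact .of_eq (ExprEq.clo_sort (.refl hF) e hσ)
  · rw [Expr.tclo_eq h.ne_kind, Expr.tclo_eq h.symm.ne_kind]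
    exact .of_eq (h.clo_sort e hσ)

theorem ClassEq.mclo (h : ClassEq Sg Δ' Γ F F') (hF : IsClass Sg Δ' Γ F)
    (e : MSubEq Sg Δ θ θ' Δ') (hθ : MSubHasType Sg Δ θ Δ') (hΓ : CtxWf Sg Δ' Γ) :
    ClassEq Sg Δ (Γ.msub θ) (F.tmclo θ) (F'.tmclo θ') := by
  rcases h with rfl | ⟨s, h⟩
  · rcases hF with rfl | ⟨s, hF⟩
    · exact .refl _
    · rw [hF.tmclo_eq, hF.tmclo_eq]
      exact .of_eq (ExprEq.mclo_sort (.refl hF) e hθ hΓ)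
  · rw [Expr.tmclo_eq h.ne_kind, Expr.tmclo_eq h.symm.ne_kind]
    exact .of_eq (h.mclo_sort e hθ hΓ)

theorem IsClass.mclo (h : IsClass Sg Δ' Γ F) (hθ : MSubHasType Sg Δ θ Δ')
    (hΓ : CtxWf Sg Δ' Γ) : IsClass Sg Δ (Γ.msub θ) (F.tmclo θ) := by
  rcases h with rfl | ⟨s, h⟩
  · exact .inl rfl
  · rw [h.tmclo_eq]
    exact .of_sort (h.mclo_sort hθ hΓ)

theorem ClassEq.clo_id (h : IsClass Sg Δ Γ F) : ClassEq Sg Δ Γ (F.tclo (.shift 0)) F := by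
  rcases h with rfl | ⟨s, h⟩
  · exact .refl _
  · rw [h.tclo_eq]; exact .of_eq (.clo_id h)

theorem ClassEq.mclo_id (h : IsClass Sg Δ Γ F) : ClassEq Sg Δ Γ (F.tmclo (.shift 0)) F := by
  rcases h with rfl | ⟨s, h⟩
  · exact .refl _
  · rw [h.tmclo_eq]; exact .of_eq (.mclo_id h)

theorem ClassEq.clo_clo (h : IsClass Sg Δ Ψ F) (hσ : SubHasType Sg Δ Γ σ Γ')
    (hτ : SubHasType Sg Δ Γ' τ Ψ) :
    ClassEq Sg Δ Γ ((F.tclo τ).tclo σ) (F.tclo (.clo σ τ)) := by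
  rcases h with rfl | ⟨s, h⟩
  · exact .refl _
  · rw [h.tclo_eq, h.tclo_eq]; exact .of_eq (ExprEq.clo_clo_sort h hσ hτ)

theorem ClassEq.mclo_mclo (h : IsClass Sg Δ'' Γ F) (hθ : MSubHasType Sg Δ θ Δ')
    (hθ' : MSubHasType Sg Δ' θ' Δ'') (hΓ : CtxWf Sg Δ'' Γ) :
    ClassEq Sg Δ (Γ.msub (.mclo θ θ')) ((F.tmclo θ').tmclo θ) (F.tmclo (.mclo θ θ')) := by
  rcases h with rfl | ⟨s, h⟩
  · exact .refl _
  · rw [h.tmclo_eq, h.tmclo_eq]; exact .of_eq (ExprEq.mclo_mclo_sort h hθ hθ' hΓ)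

theorem ClassEq.mclo_clo (h : IsClass Sg Δ' Ψ F) (hθ : MSubHasType Sg Δ θ Δ')
    (hσ : SubHasType Sg Δ' Γ σ Ψ) (hΨ : CtxWf Sg Δ' Ψ) :
    ClassEq Sg Δ (Γ.msub θ) ((F.tclo σ).tmclo θ) ((F.tmclo θ).tclo (.mclo θ σ)) := by
  rcases h with rfl | ⟨s, h⟩
  · exact .refl _
  · rw [h.tclo_eq, h.tmclo_eq]; exact .of_eq (ExprEq.mclo_clo_sort h hθ hσ hΨ)

end Classifiers

/-! ### Hereditarily well-formed contexts -/

/-- All declarations of a context are types over the preceding ones. -/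
def TypedCtx (Sg : Sig C) (Δ : MCtx C) : Ctx C → Prop
  | [] => True
  | A :: Γ => HasType Sg Δ Γ A (.sort .type) ∧ TypedCtx Sg Δ Γ

/-- A meta-context all of whose declarations are well-typed over the preceding ones. -/
def GoodMCtx (Sg : Sig C) : MCtx C → Prop
  | [] => True
  | (Ψ, A) :: Δ => (HasType Sg Δ Ψ A (.sort .type) ∧ TypedCtx Sg Δ Ψ) ∧ GoodMCtx Sg Δ

/-- A context all of whose declarations are well-typed over the preceding ones. -/
def GoodCtx (Sg : Sig C) (Δ : MCtx C) : Ctx C → Prop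
  | [] => GoodMCtx Sg Δ
  | A :: Γ => HasType Sg Δ Γ A (.sort .type) ∧ GoodCtx Sg Δ Γ

theorem Ctx.msub_append (θ : MSub C) (Γ Γ' : Ctx C) :
    Ctx.msub θ (Γ' ++ Γ) = Γ'.msub θ ++ Γ.msub θ := List.map_append

@[simp] theorem Ctx.length_msub (θ : MSub C) (Γ : Ctx C) : (Γ.msub θ).length = Γ.length :=
  List.length_map _

section Contexts

variable {Δ Δ' Δ'' Δ₁ Δ₂ : MCtx C} {Γ Γ' Γ₁ Γ₂ Ψ : Ctx C} {A : Expr C} {θ θ' : MSub C}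

theorem GoodMCtx.wf (h : GoodMCtx Sg Δ) : MCtxWf Sg Δ := by
  cases Δ with
  | nil => exact .nil
  | cons D Δ => exact .cons h.1.1

theorem GoodMCtx.suffix : ∀ {Δ₂ : MCtx C}, GoodMCtx Sg (Δ₂ ++ Δ₁) → GoodMCtx Sg Δ₁
  | [], h => h
  | _ :: _, h => GoodMCtx.suffix h.2

theorem GoodCtx.mctx : ∀ {Γ : Ctx C}, GoodCtx Sg Δ Γ → GoodMCtx Sg Δ
  | [], h => h
  | _ :: _, h => GoodCtx.mctx h.2

theorem GoodCtx.typed : ∀ {Γ : Ctx C}, GoodCtx Sg Δ Γ → TypedCtx Sg Δ Γ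
  | [], _ => trivial
  | _ :: _, h => ⟨h.1, GoodCtx.typed h.2⟩

theorem TypedCtx.good (h : GoodMCtx Sg Δ) : ∀ {Γ : Ctx C}, TypedCtx Sg Δ Γ → GoodCtx Sg Δ Γ
  | [], _ => h
  | _ :: _, h' => ⟨h'.1, TypedCtx.good h h'.2⟩

theorem GoodMCtx.ctx (h : GoodMCtx Sg ((Γ, A) :: Δ)) : GoodCtx Sg Δ Γ := h.1.2.good h.2

theorem GoodCtx.mctx_cons (h : GoodCtx Sg Δ Γ) (hA : HasType Sg Δ Γ A (.sort .type)) :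
    GoodMCtx Sg ((Γ, A) :: Δ) := ⟨⟨hA, h.typed⟩, h.mctx⟩

theorem GoodCtx.wf (h : GoodCtx Sg Δ Γ) : CtxWf Sg Δ Γ := by
  cases Γ with
  | nil => exact .nil h.wf
  | cons A Γ => exact .cons h.1

theorem GoodCtx.suffix : ∀ {Γ₂ : Ctx C}, GoodCtx Sg Δ (Γ₂ ++ Γ₁) → GoodCtx Sg Δ Γ₁
  | [], h => h
  | _ :: _, h => GoodCtx.suffix h.2

theorem GoodCtx.refl : ∀ {Γ : Ctx C}, GoodCtx Sg Δ Γ → CtxEq Sg Δ Γ Γ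
  | [], h => .nil h.mctx.wf
  | _ :: _, h => .cons (GoodCtx.refl h.2) (.refl h.1)

variable [hSg : Fact (SigWf Sg)]

theorem GoodCtx.msub (hθ : MSubHasType Sg Δ θ Δ') (hΔ : GoodMCtx Sg Δ) :
    ∀ {Γ : Ctx C}, GoodCtx Sg Δ' Γ → GoodCtx Sg Δ (Γ.msub θ)
  | [], _ => hΔ
  | _ :: _, h => ⟨h.1.mclo_sort hθ h.2.wf, GoodCtx.msub hθ hΔ h.2⟩

theorem GoodCtx.msub_congr (e : MSubEq Sg Δ θ θ' Δ') (hθ : MSubHasType Sg Δ θ Δ')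
    (hΔ : GoodMCtx Sg Δ) : ∀ {Γ : Ctx C}, GoodCtx Sg Δ' Γ → CtxEq Sg Δ (Γ.msub θ) (Γ.msub θ')
  | [], _ => .nil hΔ.wf
  | _ :: _, h => .cons (GoodCtx.msub_congr e hθ hΔ h.2) (ExprEq.mclo_sort (.refl h.1) e hθ h.2.wf)

theorem GoodCtx.msub_id : ∀ {Γ : Ctx C}, GoodCtx Sg Δ Γ →
    CtxEq Sg Δ (Γ.msub (.shift 0)) Γ ∧ CtxEq Sg Δ Γ (Γ.msub (.shift 0))
  | [], h => ⟨.nil h.mctx.wf, .nil h.mctx.wf⟩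
  | _ :: _, h =>
    have ih := GoodCtx.msub_id h.2
    have e := ExprEq.mclo_id h.1
    ⟨.cons ih.1 (e.ctxConv ih.2), .cons ih.2 e.symm⟩

theorem GoodCtx.msub_msub (hθ : MSubHasType Sg Δ θ Δ') (hθ' : MSubHasType Sg Δ' θ' Δ'')
    (hΔ : GoodMCtx Sg Δ) : ∀ {Γ : Ctx C}, GoodCtx Sg Δ'' Γ →
      CtxEq Sg Δ ((Γ.msub θ').msub θ) (Γ.msub (.mclo θ θ')) ∧
      CtxEq Sg Δ (Γ.msub (.mclo θ θ')) ((Γ.msub θ').msub θ)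
  | [], _ => ⟨.nil hΔ.wf, .nil hΔ.wf⟩
  | _ :: _, h =>
    have ih := GoodCtx.msub_msub hθ hθ' hΔ h.2
    have e := ExprEq.mclo_mclo_sort h.1 hθ hθ' h.2.wf
    ⟨.cons ih.1 (e.ctxConv ih.2), .cons ih.2 e.symm⟩

theorem CtxEq.msub (hθ : MSubHasType Sg Δ θ Δ') (hΔ : GoodMCtx Sg Δ) :
    ∀ {Γ Γ' : Ctx C}, CtxEq Sg Δ' Γ Γ' → GoodCtx Sg Δ' Γ → CtxEq Sg Δ (Γ.msub θ) (Γ'.msub θ)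
  | [], [], _, _ => .nil hΔ.wf
  | _ :: _, _ :: _, .cons h e, hΓ =>
    .cons (h.msub hθ hΔ hΓ.2) (e.mclo_sort (.refl hθ) hθ hΓ.2.wf)

end Contexts

/-! ### Basic substitutions -/

section Substitutions

variable [hSg : Fact (SigWf Sg)] {Δ Δ' : MCtx C} {Γ Γ' Ψ : Ctx C}
  {A A' M M' N P B F : Expr C} {σ σ' τ : Sub C} {θ : MSub C} {s : Srt}

theorem GoodCtx.id (h : GoodCtx Sg Δ Γ) : SubHasType Sg Δ Γ (.shift 0) Γ :=
  .shift (Γ := []) h.wf rfl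

theorem GoodCtx.shift (h : GoodCtx Sg Δ (A :: Γ)) : SubHasType Sg Δ (A :: Γ) (.shift 1) Γ :=
  .shift (Γ := [A]) h.wf rfl

theorem SubEq.cons_shift_one (h : SubHasType Sg Δ Γ (.cons σ M) (A :: Ψ))
    (hσ : SubHasType Sg Δ Γ σ Ψ) : SubEq Sg Δ Γ (.clo (.cons σ M) (.shift 1)) σ Ψ :=
  (SubEq.cons_shift (Ψ' := []) h rfl).trans (.clo_id hσ)

theorem SubHasType.single (hΓ : GoodCtx Sg Δ Γ) (hA : HasType Sg Δ Γ A (.sort .type))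
    (hN : HasType Sg Δ Γ N A) : SubHasType Sg Δ Γ (.single N) (A :: Γ) :=
  .cons hΓ.id hA (hN.conv (ExprEq.clo_id hA).symm)

theorem SubEq.single (hΓ : GoodCtx Sg Δ Γ) (hA : HasType Sg Δ Γ A (.sort .type))
    (e : ExprEq Sg Δ Γ M N A) : SubEq Sg Δ Γ (.single M) (.single N) (A :: Γ) :=
  .cons (.refl hΓ.id) hA (e.conv (ExprEq.clo_id hA).symm)

theorem GoodCtx.cons_clo (hΓ : GoodCtx Sg Δ Γ) (hσ : SubHasType Sg Δ Γ σ Ψ)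
    (hA : HasType Sg Δ Ψ A (.sort .type)) : GoodCtx Sg Δ (.clo σ A :: Γ) :=
  ⟨hA.clo_sort hσ, hΓ⟩

theorem SubHasType.lift (hΓ : GoodCtx Sg Δ Γ) (hσ : SubHasType Sg Δ Γ σ Ψ)
    (hA : HasType Sg Δ Ψ A (.sort .type)) :
    SubHasType Sg Δ (.clo σ A :: Γ) σ.lift (A :: Ψ) := by
  have h := (hΓ.cons_clo hσ hA).shift
  exact .cons (.clo h hσ) hA
    ((HasType.var_zero (hA.clo_sort hσ)).conv (ExprEq.clo_clo_sort hA h hσ))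

theorem SubEq.lift (hΓ : GoodCtx Sg Δ Γ) (hσ : SubHasType Sg Δ Γ σ Ψ)
    (e : SubEq Sg Δ Γ σ σ' Ψ) (hA : HasType Sg Δ Ψ A (.sort .type)) :
    SubEq Sg Δ (.clo σ A :: Γ) σ.lift σ'.lift (A :: Ψ) := by
  have h := (hΓ.cons_clo hσ hA).shift
  exact .cons (.clo (.refl h) e) hA
    (.refl ((HasType.var_zero (hA.clo_sort hσ)).conv (ExprEq.clo_clo_sort hA h hσ)))

theorem SubEq.clo_single (hΨ : GoodCtx Sg Δ Ψ)
    (hσ : SubHasType Sg Δ Γ σ Ψ) (hA : HasType Sg Δ Ψ A (.sort .type))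
    (hN : HasType Sg Δ Ψ N A) :
    SubEq Sg Δ Γ (.clo σ (.single N)) (.cons σ (.clo σ N)) (A :: Ψ) := by
  refine (SubEq.clo_cons hσ (.single hΨ hA hN)).trans (.cons (.clo_id hσ) hA (.refl ?_))
  have h := HasType.clo hσ hN
  rw [hA.tclo_eq] at h
  exact h.conv (ExprEq.clo_sort (.refl hA) (.symm (.clo_id hσ)) hσ)

theorem SubEq.single_lift (hΓ : GoodCtx Sg Δ Γ) (hσ : SubHasType Sg Δ Γ σ Ψ)
    (hA : HasType Sg Δ Ψ A (.sort .type)) (hP : HasType Sg Δ Γ P (.clo σ A)) :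
    SubEq Sg Δ Γ (.clo (.single P) σ.lift) (.cons σ P) (A :: Ψ) := by
  have hσA := hA.clo_sort hσ
  have hs := SubHasType.single hΓ hσA hP
  have h₁ := (hΓ.cons_clo hσ hA).shift
  refine (SubEq.clo_cons hs (.lift hΓ hσ hA)).trans (.symm (.cons ?_ hA ?_))
  · exact (((SubEq.assoc hs h₁ hσ).trans
      (.clo (.cons_shift_one hs hΓ.id) (.refl hσ))).trans (.id_clo hσ)).symm
  · have := ExprEq.clo_var_zero hΓ.id hσA (hP.conv (ExprEq.clo_id hσA).symm)
    exact (this.conv (.clo_id hσA)).symm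

theorem SubEq.lift_lift (hΓ : GoodCtx Sg Δ Γ) (hΓ' : GoodCtx Sg Δ Γ')
    (hσ : SubHasType Sg Δ Γ σ Γ') (hτ : SubHasType Sg Δ Γ' τ Ψ)
    (hA : HasType Sg Δ Ψ A (.sort .type)) :
    SubEq Sg Δ (.clo σ (.clo τ A) :: Γ) (.clo σ.lift τ.lift) (Sub.lift (.clo σ τ)) (A :: Ψ) := by
  have hτA := hA.clo_sort hτ
  have hl := SubHasType.lift hΓ hσ hτA
  have h₁ := (hΓ'.cons_clo hτ hA).shift
  have h₂ := (hΓ.cons_clo hσ hτA).shift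
  have e : SubEq Sg Δ (.clo σ (.clo τ A) :: Γ) (.clo σ.lift (.clo (.shift 1) τ))
      (.clo (.shift 1) (.clo σ τ)) Ψ :=
    ((SubEq.assoc hl h₁ hτ).trans (.clo (.cons_shift_one hl (.clo h₂ hσ)) (.refl hτ))).trans
      (SubEq.assoc h₂ hσ hτ).symm
  refine (SubEq.clo_cons hl (.lift hΓ' hτ hA)).trans (.cons e hA ?_)
  have hx := (HasType.var_zero (hτA.clo_sort hσ)).conv (ExprEq.clo_clo_sort hτA h₂ hσ)
  refine (ExprEq.clo_var_zero (.clo h₂ hσ) hτA hx).conv (s := .type) ?_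
  exact ((ExprEq.clo_clo_sort hA (.clo h₂ hσ) hτ).trans
    (ExprEq.clo_sort (.refl hA) (SubEq.assoc h₂ hσ hτ).symm (.clo (.clo h₂ hσ) hτ))).trans
    (ExprEq.clo_sort (.refl hA) e.symm (.clo h₂ (.clo hσ hτ)))

theorem SubEq.lift_id (hΓ : GoodCtx Sg Δ (A :: Γ)) :
    SubEq Sg Δ (A :: Γ) (Sub.lift (.shift 0)) (.shift 0) (A :: Γ) := by
  have h : SubEq Sg Δ (A :: Γ) (.shift 0) (.cons (.shift 1) (.var 0)) (A :: Γ) :=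
    .eta (Γ' := []) hΓ.wf rfl
  refine (h.trans (.cons (SubEq.clo_id hΓ.shift).symm hΓ.1 (.refl (.var_zero hΓ.1)))).symm

theorem SubEq.mclo_single (hΓ : GoodCtx Sg Δ' Γ)
    (hθ : MSubHasType Sg Δ θ Δ') (hA : HasType Sg Δ' Γ A (.sort .type))
    (hN : HasType Sg Δ' Γ N A) :
    SubEq Sg Δ (Γ.msub θ) (.mclo θ (.single N)) (.single (.mclo θ N))
      (.mclo θ A :: Γ.msub θ) := by
  refine (SubEq.mclo_cons hθ hΓ.id hA (hN.conv (ExprEq.clo_id hA).symm)).trans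
    (.symm (.cons (.symm (.mclo_shift (Γ' := []) hθ hΓ.wf rfl)) (hA.mclo_sort hθ hΓ.wf)
      (.refl ?_)))
  have h := HasType.mclo hθ hN
  rw [hA.tmclo_eq] at h
  exact h.conv (ExprEq.clo_id (hA.mclo_sort hθ hΓ.wf)).symm

theorem SubEq.mclo_lift (hΓ : GoodCtx Sg Δ' Γ) (hΨ : GoodCtx Sg Δ' Ψ)
    (hθ : MSubHasType Sg Δ θ Δ') (hσ : SubHasType Sg Δ' Γ σ Ψ)
    (hA : HasType Sg Δ' Ψ A (.sort .type)) :
    SubEq Sg Δ (Ctx.msub θ (.clo σ A :: Γ)) (.mclo θ σ.lift) (Sub.lift (.mclo θ σ))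
      (.mclo θ A :: Ψ.msub θ) := by
  have hσA := hA.clo_sort hσ
  have h₁ := (hΓ.cons_clo hσ hA).shift
  have hx := (HasType.var_zero (hA.clo_sort hσ)).conv (ExprEq.clo_clo_sort hA h₁ hσ)
  have hθA := hA.mclo_sort hθ hΨ.wf
  have es : SubEq Sg Δ (Ctx.msub θ (.clo σ A :: Γ)) (.mclo θ (.shift 1)) (.shift 1) (Γ.msub θ) :=
    .mclo_shift (Γ' := [.clo σ A]) hθ (hΓ.cons_clo hσ hA).wf rfl
  have e : SubEq Sg Δ (Ctx.msub θ (.clo σ A :: Γ)) (.mclo θ (.clo (.shift 1) σ))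
      (.clo (.shift 1) (.mclo θ σ)) (Ψ.msub θ) :=
    (SubEq.mclo_clo hθ h₁ hσ).trans (.clo es (.refl (.mclo hθ hσ)))
  refine (SubEq.mclo_cons hθ (.clo h₁ hσ) hA hx).trans (.cons e hθA ?_)
  refine (ExprEq.mclo_var hθ hx).conv (s := .type) ?_
  exact ExprEq.mclo_clo_sort hA hθ (.clo h₁ hσ) hΨ.wf

theorem ExprEq.clo_mclo_pi (hθ : MSubHasType Sg Δ θ Δ') (hσ : SubHasType Sg Δ Γ σ (Ψ.msub θ))
    (hΨ : GoodCtx Sg Δ' (A :: Ψ)) (hF : HasType Sg Δ' (A :: Ψ) F (.sort s)) :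
    ExprEq Sg Δ Γ (.clo σ (.mclo θ (.pi A F)))
      (.pi (.clo σ (.mclo θ A)) (.clo σ.lift (.mclo θ F))) (.sort s) :=
  ((ExprEq.mclo_pi hθ hF).clo_sort (.refl hσ) hσ).trans (.clo_pi hσ (hF.mclo_sort hθ hΨ.wf))

theorem ExprEq.clo_mclo_lam (hθ : MSubHasType Sg Δ θ Δ') (hσ : SubHasType Sg Δ Γ σ (Ψ.msub θ))
    (hΨ : GoodCtx Sg Δ' (A :: Ψ)) (hM : HasType Sg Δ' (A :: Ψ) M B)
    (hB : HasType Sg Δ' (A :: Ψ) B (.sort .type)) :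
    ExprEq Sg Δ Γ (.clo σ (.mclo θ (.lam M))) (.lam (.clo σ.lift (.mclo θ M)))
      (.pi (.clo σ (.mclo θ A)) (.clo σ.lift (.mclo θ B))) := by
  have hB' := hB.mclo_sort hθ hΨ.wf
  have hM' := HasType.mclo hθ hM
  rw [hB.tmclo_eq] at hM'
  exact ((ExprEq.clo (.refl hσ) (.mclo_lam hθ hM hB)).conv (.clo_pi hσ hB')).trans
    (.clo_lam hσ hM' hB')

theorem HasType.clo_mclo_arg (hθ : MSubHasType Sg Δ θ Δ')
    (hσ : SubHasType Sg Δ Γ σ (Ψ.msub θ)) (hΨ : GoodCtx Sg Δ' (A :: Ψ))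
    (hN : HasType Sg Δ' Ψ N A) :
    HasType Sg Δ Γ (.clo σ (.mclo θ N)) (.clo σ (.mclo θ A)) := by
  have h := HasType.clo hσ (HasType.mclo hθ hN)
  rwa [hΨ.1.tmclo_eq, (hΨ.1.mclo_sort hθ hΨ.2.wf).tclo_eq] at h

theorem ExprEq.clo_mclo_single_sort (hΓ : GoodCtx Sg Δ Γ) (hθ : MSubHasType Sg Δ θ Δ')
    (hσ : SubHasType Sg Δ Γ σ (Ψ.msub θ)) (hΨ : GoodCtx Sg Δ' (A :: Ψ))
    (hF : HasType Sg Δ' (A :: Ψ) F (.sort s)) (hN : HasType Sg Δ' Ψ N A) :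
    ExprEq Sg Δ Γ (.clo σ (.mclo θ (.clo (.single N) F)))
      (.clo (.cons σ (.clo σ (.mclo θ N))) (.mclo θ F)) (.sort s) ∧
    ExprEq Sg Δ Γ (.clo (.cons σ (.clo σ (.mclo θ N))) (.mclo θ F))
      (.clo (.single (.clo σ (.mclo θ N))) (.clo σ.lift (.mclo θ F))) (.sort s) := by
  have hΨ₁ := hΨ.2.msub hθ hΓ.mctx
  have hA' := hΨ.1.mclo_sort hθ hΨ.2.wf
  have hF' := hF.mclo_sort hθ hΨ.wf
  have hN' := HasType.mclo hθ hN
  rw [hΨ.1.tmclo_eq] at hN'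
  have hN'' := hN.clo_mclo_arg hθ hσ hΨ
  have hs₀ := SubHasType.single hΨ.2 hΨ.1 hN
  have hs₁ := SubHasType.single hΨ₁ hA' hN'
  have hs₂ := SubHasType.single hΓ (hA'.clo_sort hσ) hN''
  have hl := SubHasType.lift hΓ hσ hA'
  refine ⟨?_, ((ExprEq.clo_clo_sort hF' hs₂ hl).trans
    (ExprEq.clo_sort (.refl hF') (.single_lift hΓ hσ hA' hN'') (.clo hs₂ hl))).symm⟩
  exact (((ExprEq.mclo_clo_sort hF hθ hs₀ hΨ.wf).trans
    (ExprEq.clo_sort (.refl hF') (.mclo_single hΨ.2 hθ hΨ.1 hN) (.mclo hθ hs₀))).clo_sort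
    (.refl hσ) hσ).trans ((ExprEq.clo_clo_sort hF' hσ hs₁).trans
      (ExprEq.clo_sort (.refl hF') (.clo_single hΨ₁ hσ hA' hN') (.clo hσ hs₁)))

theorem ExprEq.clo_mclo_app (hΓ : GoodCtx Sg Δ Γ) (hθ : MSubHasType Sg Δ θ Δ')
    (hσ : SubHasType Sg Δ Γ σ (Ψ.msub θ)) (hΨ : GoodCtx Sg Δ' (A :: Ψ))
    (hF : HasType Sg Δ' (A :: Ψ) F (.sort s)) (hM : HasType Sg Δ' Ψ M (.pi A F))
    (hN : HasType Sg Δ' Ψ N A) :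
    ExprEq Sg Δ Γ (.clo σ (.mclo θ (.app M N)))
      (.app (.clo σ (.mclo θ M)) (.clo σ (.mclo θ N)))
      (.clo σ (.mclo θ (.clo (.single N) F))) := by
  have hN' := HasType.mclo hθ hN
  rw [hΨ.1.tmclo_eq] at hN'
  have hs₀ := SubHasType.single hΨ.2 hΨ.1 hN
  have c₁ := (ExprEq.mclo_clo_sort hF hθ hs₀ hΨ.wf).trans (ExprEq.clo_sort
    (.refl (hF.mclo_sort hθ hΨ.wf)) (.mclo_single hΨ.2 hθ hΨ.1 hN) (.mclo hθ hs₀))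
  exact (ExprEq.clo (.refl hσ) ((ExprEq.mclo_app hθ hM hN).conv c₁.symm)).trans
    ((ExprEq.clo_app hσ ((HasType.mclo hθ hM).conv (.mclo_pi hθ hF)) hN').conv
      (ExprEq.clo_mclo_single_sort hΓ hθ hσ hΨ hF hN).1.symm)

end Substitutions

/-! ### Presuppositions of the judgements -/

/-- The inversion principle for products, for a typed expression `E`. -/
def PiInv (Sg : Sig C) (Δ : MCtx C) (Γ : Ctx C) (E : Expr C) : Prop :=
  ∀ A F, E = .pi A F → HasType Sg Δ Γ A (.sort .type) ∧ ∃ s, HasType Sg Δ (A :: Γ) F (.sort s)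

/-- `K` is well-typed over all contexts and invariant under all substitutions. -/
def DeclOk (Sg : Sig C) (K : Expr C) : Prop :=
  ∃ s, (∀ Δ Γ, GoodCtx Sg Δ Γ → HasType Sg Δ Γ K (.sort s) ∧ PiInv Sg Δ Γ K) ∧
    ∀ Δ Γ θ τ, GoodCtx Sg Δ Γ → MSubHasType Sg Δ θ [] → SubHasType Sg Δ Γ τ [] →
      ExprEq Sg Δ Γ (.clo τ (.mclo θ K)) K (.sort s)

/-- The declared classifiers are well-typed over all contexts and invariant under all
substitutions. -/
class ConstsOk (Sg : Sig C) : Prop where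
  ok : ∀ a K, (a, K) ∈ Sg → DeclOk Sg K

section Inv

variable {Δ : MCtx C} {Γ Γ' : Ctx C} {E : Expr C}

/-- A classifier whose products can be inverted. -/
def PiClass (Sg : Sig C) (Δ : MCtx C) (Γ : Ctx C) (F : Expr C) : Prop :=
  IsClass Sg Δ Γ F ∧ PiInv Sg Δ Γ F

/-- The inversion principles for constants and variables. -/
def AtomInv (Sg : Sig C) (Δ : MCtx C) (Γ : Ctx C) (F : Expr C) : Expr C → Prop
  | .const a =>
    (∀ Γ' σ, GoodCtx Sg Δ Γ' → SubHasType Sg Δ Γ' σ Γ →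
      HasType Sg Δ Γ' (.const a) (.clo σ F)) ∧
    ∀ Δ' θ, GoodMCtx Sg Δ' → MSubHasType Sg Δ' θ Δ →
      HasType Sg Δ' (Γ.msub θ) (.const a) (.mclo θ F)
  | .var n =>
    (∀ k, n = k + 1 → HasType Sg Δ Γ (.clo (.shift 1) (.var k)) F) ∧
    ∀ Δ' θ, GoodMCtx Sg Δ' → MSubHasType Sg Δ' θ Δ →
      HasType Sg Δ' (Γ.msub θ) (.var n) (.mclo θ F)
  | .mvar n => ∀ k, n = k + 1 → HasType Sg Δ Γ (.mclo (.shift 1) (.mvar k)) F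
  | _ => True

/-- What is presupposed by `Δ; Γ ⊢ E : F`. -/
structure TypePresup (Sg : Sig C) (Δ : MCtx C) (Γ : Ctx C) (E F : Expr C) : Prop where
  good : GoodCtx Sg Δ Γ
  cls : PiClass Sg Δ Γ F
  piInv : PiInv Sg Δ Γ E
  atomInv : AtomInv Sg Δ Γ F E

/-- What is presupposed by `Δ; Γ ⊢ E₁ ≡ E₂ : F`. -/
structure EqPresup (Sg : Sig C) (Δ : MCtx C) (Γ : Ctx C) (E₁ E₂ F : Expr C) : Prop where
  good : GoodCtx Sg Δ Γ
  cls : PiClass Sg Δ Γ F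
  left : HasType Sg Δ Γ E₁ F
  right : HasType Sg Δ Γ E₂ F
  piLeft : PiInv Sg Δ Γ E₁
  piRight : PiInv Sg Δ Γ E₂

/-- What is presupposed by `Δ; Γ ⊢ σ : Ψ`. -/
structure SubPresup (Sg : Sig C) (Δ : MCtx C) (Γ : Ctx C) (σ : Sub C) (Ψ : Ctx C) : Prop where
  dom : GoodCtx Sg Δ Γ
  cod : GoodCtx Sg Δ Ψ
  consInv : ∀ τ M, σ = .cons τ M → ∀ A Ψ', Ψ = A :: Ψ' →
    SubHasType Sg Δ Γ τ Ψ' ∧ HasType Sg Δ Γ M (.clo τ A)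

/-- What is presupposed by `Δ; Γ ⊢ σ₁ ≡ σ₂ : Ψ`. -/
structure SubEqPresup (Sg : Sig C) (Δ : MCtx C) (Γ : Ctx C) (σ₁ σ₂ : Sub C) (Ψ : Ctx C) :
    Prop where
  dom : GoodCtx Sg Δ Γ
  cod : GoodCtx Sg Δ Ψ
  left : SubHasType Sg Δ Γ σ₁ Ψ
  right : SubHasType Sg Δ Γ σ₂ Ψ

/-- What is presupposed by `Δ ⊢ θ₁ ≡ θ₂ : Δ'`. -/
structure MSubEqPresup (Sg : Sig C) (Δ : MCtx C) (θ₁ θ₂ : MSub C) (Δ' : MCtx C) : Prop where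
  dom : GoodMCtx Sg Δ
  cod : GoodMCtx Sg Δ'
  left : MSubHasType Sg Δ θ₁ Δ'
  right : MSubHasType Sg Δ θ₂ Δ'

theorem PiInv.ctxConv (h : PiInv Sg Δ Γ E) (e : CtxEq Sg Δ Γ Γ') : PiInv Sg Δ Γ' E := by
  rintro A F rfl
  obtain ⟨h₁, s, h₂⟩ := h _ _ rfl
  exact ⟨h₁.ctxConv e, s, h₂.ctxConv (.cons e (.refl h₁))⟩

end Inv

section Presup

variable [hSg : Fact (SigWf Sg)] {Δ Δ' Δ'' : MCtx C} {Γ Γ' Γ₁ Γ₂ Ψ : Ctx C}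
  {A B E E' F F' K M N : Expr C} {σ τ : Sub C} {θ θ' : MSub C} {s : Srt} {n : ℕ} {a : C}

theorem PiClass.ctxConv (h : PiClass Sg Δ Γ F) (e : CtxEq Sg Δ Γ Γ') : PiClass Sg Δ Γ' F :=
  ⟨h.1.ctxConv e, h.2.ctxConv e⟩

theorem PiClass.kind : PiClass Sg Δ Γ (.sort .kind) := ⟨.inl rfl, fun _ _ h => nomatch h⟩

theorem PiClass.sort (hΓ : GoodCtx Sg Δ Γ) (s : Srt) : PiClass Sg Δ Γ (.sort s) := by
  cases s
  · exact .kind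
  · exact ⟨.of_sort (s := .kind) (.type hΓ.wf), fun _ _ h => nomatch h⟩

theorem PiClass.of_clo (h : HasType Sg Δ Γ (.clo σ F) (.sort s)) : PiClass Sg Δ Γ (.clo σ F) :=
  ⟨.of_sort h, fun _ _ h => nomatch h⟩

theorem PiClass.of_mclo (h : HasType Sg Δ Γ (.mclo θ F) (.sort s)) :
    PiClass Sg Δ Γ (.mclo θ F) :=
  ⟨.of_sort h, fun _ _ h => nomatch h⟩

theorem PiClass.of_pi (hA : HasType Sg Δ Γ A (.sort .type))
    (hF : HasType Sg Δ (A :: Γ) F (.sort s)) : PiClass Sg Δ Γ (.pi A F) :=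
  ⟨.of_sort hF.pi, by rintro _ _ ⟨⟩; exact ⟨hA, s, hF⟩⟩

theorem PiClass.clo (h : PiClass Sg Δ Ψ F) (hσ : SubHasType Sg Δ Γ σ Ψ) :
    PiClass Sg Δ Γ (F.tclo σ) := by
  refine ⟨h.1.clo hσ, ?_⟩
  unfold Expr.tclo
  split <;> exact fun _ _ h => nomatch h

theorem PiClass.mclo (h : PiClass Sg Δ' Γ F) (hθ : MSubHasType Sg Δ θ Δ')
    (hΓ : CtxWf Sg Δ' Γ) : PiClass Sg Δ (Γ.msub θ) (F.tmclo θ) := by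
  refine ⟨h.1.mclo hθ hΓ, ?_⟩
  unfold Expr.tmclo
  split <;> exact fun _ _ h => nomatch h

theorem PiClass.exists_sort (h : PiClass Sg Δ Γ F) (hF : F ≠ .sort .kind) :
    ∃ s, HasType Sg Δ Γ F (.sort s) := h.1.resolve_left hF

theorem PiClass.pi_inv (h : PiClass Sg Δ Γ (.pi A F)) :
    HasType Sg Δ Γ A (.sort .type) ∧ ∃ s, HasType Sg Δ (A :: Γ) F (.sort s) := h.2 _ _ rfl

theorem HasType.var_class_ne_kind (h : HasType Sg Δ Γ (.var n) F) : F ≠ .sort .kind := by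
  rintro rfl
  have := (h.levelOk hSg.out.levels).1
  simp [Expr.level] at this

theorem HasType.mvar_class_ne_kind (h : HasType Sg Δ Γ (.mvar n) F) : F ≠ .sort .kind := by
  rintro rfl
  have := (h.levelOk hSg.out.levels).1
  simp [Expr.level] at this

theorem HasType.const_class_ne_kind (h : HasType Sg Δ Γ (.const a) F) : F ≠ .sort .kind := by
  rintro rfl
  have := (h.levelOk hSg.out.levels).1
  have := Sg.level_le a
  simp only [Expr.level] at *
  omega

theorem GoodMCtx.terminal (h : GoodMCtx Sg Δ) : MSubHasType Sg Δ (.shift Δ.length) [] := by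
  have := MSubHasType.shift (Sg := Sg) (Δ := []) (Δ' := Δ) (n := Δ.length)
    (by simpa using h.wf) rfl
  simpa using this

theorem GoodCtx.terminal (h : GoodCtx Sg Δ Γ) : SubHasType Sg Δ Γ (.shift Γ.length) [] := by
  have := SubHasType.shift (Sg := Sg) (Δ := Δ) (Ψ := []) (Γ := Γ) (n := Γ.length)
    (by simpa using h.wf) rfl
  simpa using this

theorem GoodMCtx.shift {D : Ctx C × Expr C} (h : GoodMCtx Sg (D :: Δ)) :
    MSubHasType Sg (D :: Δ) (.shift 1) Δ :=
  .shift (Δ' := [D]) h.wf rfl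

theorem GoodMCtx.id (h : GoodMCtx Sg Δ) : MSubHasType Sg Δ (.shift 0) Δ :=
  .shift (Δ' := []) h.wf rfl

theorem MSubEq.cons_shift_one (h : MSubHasType Sg Δ (.cons θ M) ((Γ, A) :: Δ'))
    (hθ : MSubHasType Sg Δ θ Δ') : MSubEq Sg Δ (.mclo (.cons θ M) (.shift 1)) θ Δ' :=
  (MSubEq.cons_shift (Δ₀' := []) h rfl).trans (.mclo_id hθ)

theorem ExprEq.mclo_shift_one (hΓ : GoodCtx Sg Δ' (B :: Γ)) (hθ : MSubHasType Sg Δ θ Δ')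
    (hA : HasType Sg Δ' Γ A (.sort s)) :
    ExprEq Sg Δ (Ctx.msub θ (B :: Γ)) (.mclo θ (.clo (.shift 1) A)) (.clo (.shift 1) (.mclo θ A))
      (.sort s) :=
  (ExprEq.mclo_clo_sort hA hθ hΓ.shift hΓ.2.wf).trans
    (ExprEq.clo_sort (.refl (hA.mclo_sort hθ hΓ.2.wf))
      (.mclo_shift (Γ' := [B]) hθ hΓ.wf rfl) (.mclo hθ hΓ.shift))

theorem GoodCtx.shift_append_append {m : ℕ} (h : GoodCtx Sg Δ (Γ₂ ++ (Γ₁ ++ Γ)))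
    (hm : Γ₁.length = m) (hn : Γ₂.length = n) :
    SubHasType Sg Δ (Γ₂ ++ (Γ₁ ++ Γ)) (.shift (n + m)) Γ := by
  have := SubHasType.shift (Sg := Sg) (Δ := Δ) (Ψ := Γ) (Γ := Γ₂ ++ Γ₁) (n := n + m)
    (by simpa using h.wf) (by simp [hm, hn])
  simpa using this

theorem GoodMCtx.shift_append_append {Δ₁ Δ₂ : MCtx C} {m : ℕ}
    (h : GoodMCtx Sg (Δ₂ ++ (Δ₁ ++ Δ))) (hm : Δ₁.length = m) (hn : Δ₂.length = n) :
    MSubHasType Sg (Δ₂ ++ (Δ₁ ++ Δ)) (.shift (n + m)) Δ := by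
  have := MSubHasType.shift (Sg := Sg) (Δ := Δ) (Δ' := Δ₂ ++ Δ₁) (n := n + m)
    (by simpa using h.wf) (by simp [hm, hn])
  simpa using this

theorem GoodCtx.shift_append (h : GoodCtx Sg Δ (Γ' ++ A :: Γ)) (hn : Γ'.length = n) :
    SubHasType Sg Δ (Γ' ++ A :: Γ) (.shift (n + 1)) Γ :=
  GoodCtx.shift_append_append (Γ₁ := [A]) h rfl hn

theorem GoodMCtx.shift_append {D : Ctx C × Expr C} (h : GoodMCtx Sg (Δ' ++ D :: Δ))
    (hn : Δ'.length = n) : MSubHasType Sg (Δ' ++ D :: Δ) (.shift (n + 1)) Δ :=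
  GoodMCtx.shift_append_append (Δ₁ := [D]) h rfl hn

theorem GoodCtx.shift_cons (h : GoodCtx Sg Δ (A :: (Γ' ++ Γ))) (hn : Γ'.length = n) :
    SubHasType Sg Δ (A :: (Γ' ++ Γ)) (.shift (n + 1)) Γ := by
  rw [Nat.add_comm]
  exact GoodCtx.shift_append_append (Γ₂ := [A]) h hn rfl

theorem GoodMCtx.shift_cons {D : Ctx C × Expr C} (h : GoodMCtx Sg (D :: (Δ' ++ Δ)))
    (hn : Δ'.length = n) : MSubHasType Sg (D :: (Δ' ++ Δ)) (.shift (n + 1)) Δ := by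
  rw [Nat.add_comm]
  exact GoodMCtx.shift_append_append (Δ₂ := [D]) h hn rfl

theorem GoodCtx.shift_shift (h : GoodCtx Sg Δ (B :: (Γ' ++ A :: Γ))) (hn : Γ'.length = n) :
    SubEq Sg Δ (B :: (Γ' ++ A :: Γ)) (.clo (.shift 1) (.shift (n + 1))) (.shift (n + 1 + 1)) Γ := by
  have := SubEq.shift_shift (Sg := Sg) (Δ := Δ) (Γ := Γ) (Γ₁ := Γ' ++ [A]) (Γ₂ := [B]) (n := 1)
    (m := n + 1) (by simpa using h.wf) (by simp [hn]) rfl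
  rw [Nat.add_comm 1] at this
  simpa using this

theorem GoodMCtx.shift_shift {D D' : Ctx C × Expr C} (h : GoodMCtx Sg (D' :: (Δ' ++ D :: Δ)))
    (hn : Δ'.length = n) :
    MSubEq Sg (D' :: (Δ' ++ D :: Δ)) (.mclo (.shift 1) (.shift (n + 1))) (.shift (n + 1 + 1)) Δ := by
  have := MSubEq.shift_shift (Sg := Sg) (Δ := Δ) (Δ₁ := Δ' ++ [D]) (Δ₂ := [D']) (n := 1)
    (m := n + 1) (by simpa using h.wf) (by simp [hn]) rfl
  rw [Nat.add_comm 1] at this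
  simpa using this

theorem GoodCtx.hasType_var : ∀ {Γ' : Ctx C} {n : ℕ}, GoodCtx Sg Δ (Γ' ++ A :: Γ) →
    Γ'.length = n → HasType Sg Δ (Γ' ++ A :: Γ) (.var n) (.clo (.shift (n + 1)) A)
  | [], _, h, rfl => .var_zero h.1
  | B :: Γ', _, h, rfl => by
    have hA : HasType Sg Δ Γ A (.sort .type) := (GoodCtx.suffix h.2).1
    refine ((GoodCtx.hasType_var h.2 rfl).var_succ h.1).conv (s := .type) ?_
    exact (ExprEq.clo_clo_sort hA h.shift (GoodCtx.shift_append h.2 rfl)).trans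
      (ExprEq.clo_sort (.refl hA) (GoodCtx.shift_shift h rfl)
        (.clo h.shift (GoodCtx.shift_append h.2 rfl)))

theorem GoodMCtx.hasType_mvar (hΓ : GoodCtx Sg Δ Γ) : ∀ {Δ' : MCtx C} {n : ℕ},
    GoodMCtx Sg (Δ' ++ (Γ, A) :: Δ) → Δ'.length = n →
    HasType Sg (Δ' ++ (Γ, A) :: Δ) (Γ.msub (.shift (n + 1))) (.mvar n) (.mclo (.shift (n + 1)) A)
  | [], _, h, rfl => .mvar_zero h.1.1
  | D :: Δ', _, h, rfl => by
    have hA : HasType Sg Δ Γ A (.sort .type) := (GoodMCtx.suffix h.2).1.1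
    have h₁ : MSubHasType Sg (D :: Δ' ++ (Γ, A) :: Δ) (.shift 1) _ := GoodMCtx.shift h
    have h₂ := GoodMCtx.shift_append h.2 rfl
    have e := GoodMCtx.shift_shift h rfl
    have h₃ := ((GoodMCtx.hasType_mvar hΓ h.2 rfl).mvar_succ h.1.1).ctxConv
      (GoodCtx.msub_msub h₁ h₂ h hΓ).1
    exact (h₃.conv ((ExprEq.mclo_mclo_sort hA h₁ h₂ hΓ.wf).trans
      (ExprEq.mclo_sort (.refl hA) e (.mclo h₁ h₂) hΓ.wf))).ctxConv
      (GoodCtx.msub_congr e (.mclo h₁ h₂) h hΓ)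

theorem DeclOk.clo (hK : DeclOk Sg K) (hΓ : GoodCtx Sg Δ Γ) (hΨ : GoodCtx Sg Δ Ψ)
    (hσ : SubHasType Sg Δ Γ σ Ψ) : ∃ s, ExprEq Sg Δ Γ (.clo σ K) K (.sort s) := by
  obtain ⟨s, h₁, h₂⟩ := hK
  have h₀ : GoodCtx Sg ([] : MCtx C) [] := trivial
  have hK' := ((h₁ _ _ h₀).1).mclo_sort hΨ.mctx.terminal h₀.wf
  have e := h₂ Δ Ψ _ _ hΨ hΨ.mctx.terminal hΨ.terminal
  exact ⟨s, ((e.symm.clo_sort (.refl hσ) hσ).trans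
    (ExprEq.clo_clo_sort hK' hσ hΨ.terminal)).trans
    (h₂ _ _ _ _ hΓ hΨ.mctx.terminal (.clo hσ hΨ.terminal))⟩

theorem DeclOk.mclo (hK : DeclOk Sg K) (hΓ : GoodCtx Sg Δ' Γ) (hΔ : GoodMCtx Sg Δ)
    (hθ : MSubHasType Sg Δ θ Δ') : ∃ s, ExprEq Sg Δ (Γ.msub θ) (.mclo θ K) K (.sort s) := by
  obtain ⟨s, h₁, h₂⟩ := hK
  have h₀ : GoodCtx Sg ([] : MCtx C) [] := trivial
  have hK₀ := (h₁ _ _ h₀).1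
  have hK' := hK₀.mclo_sort hΓ.mctx.terminal h₀.wf
  have e := h₂ _ Γ _ _ hΓ hΓ.mctx.terminal hΓ.terminal
  have hτ := SubHasType.mclo hθ hΓ.terminal
  have h₃ : GoodCtx Sg Δ' [] := hΓ.mctx
  refine ⟨s, ((e.symm.mclo_sort (.refl hθ) hθ hΓ.wf).trans
    (ExprEq.mclo_clo_sort hK' hθ hΓ.terminal h₃.wf)).trans
    ((ExprEq.clo_sort (ExprEq.mclo_mclo_sort hK₀ hθ hΓ.mctx.terminal h₀.wf) (.refl hτ) hτ).trans
    (h₂ _ _ _ _ (hΓ.msub hθ hΔ) (.mclo hθ hΓ.mctx.terminal) hτ))⟩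

theorem AtomInv.conv (h : AtomInv Sg Δ Γ F E) (hΓ : GoodCtx Sg Δ Γ)
    (e : ExprEq Sg Δ Γ F F' (.sort s)) : AtomInv Sg Δ Γ F' E := by
  cases E with
  | const a =>
    exact ⟨fun Γ' σ hΓ' hσ => (h.1 Γ' σ hΓ' hσ).conv (e.clo_sort (.refl hσ) hσ),
      fun Δ' θ hΔ' hθ => (h.2 Δ' θ hΔ' hθ).conv (e.mclo_sort (.refl hθ) hθ hΓ.wf)⟩
  | var n =>
    exact ⟨fun k hk => (h.1 k hk).conv e,
      fun Δ' θ hΔ' hθ => (h.2 Δ' θ hΔ' hθ).conv (e.mclo_sort (.refl hθ) hθ hΓ.wf)⟩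
  | mvar n => exact fun k hk => (h k hk).conv e
  | _ => trivial

theorem AtomInv.ctxConv (h : AtomInv Sg Δ Γ F E) (hΓ : GoodCtx Sg Δ Γ)
    (e : CtxEq Sg Δ Γ Γ') (e' : CtxEq Sg Δ Γ' Γ) : AtomInv Sg Δ Γ' F E := by
  cases E with
  | const a =>
    exact ⟨fun Γ'' σ hΓ'' hσ => h.1 Γ'' σ hΓ'' (hσ.ctxConv hΓ''.refl e'),
      fun Δ' θ hΔ' hθ => (h.2 Δ' θ hΔ' hθ).ctxConv (e.msub hθ hΔ' hΓ)⟩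
  | var n =>
    exact ⟨fun k hk => (h.1 k hk).ctxConv e,
      fun Δ' θ hΔ' hθ => (h.2 Δ' θ hΔ' hθ).ctxConv (e.msub hθ hΔ' hΓ)⟩
  | mvar n => exact fun k hk => (h k hk).ctxConv e
  | _ => trivial

variable [hC : ConstsOk Sg]

mutual

theorem MCtxWf.good {Δ : MCtx C} : MCtxWf Sg Δ → GoodMCtx Sg Δ
  | .nil => trivial
  | .cons h => h.presup.good.mctx_cons h

theorem CtxWf.good {Δ : MCtx C} {Γ : Ctx C} : CtxWf Sg Δ Γ → GoodCtx Sg Δ Γ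
  | .nil h => h.good
  | .cons h => ⟨h, h.presup.good⟩

theorem CtxEq.presup {Δ : MCtx C} {Γ Γ' : Ctx C} :
    CtxEq Sg Δ Γ Γ' → GoodCtx Sg Δ Γ ∧ GoodCtx Sg Δ Γ' ∧ CtxEq Sg Δ Γ' Γ
  | .nil h => ⟨h.good, h.good, .nil h⟩
  | .cons h e =>
    have ih := h.presup
    have ie := e.presup
    ⟨⟨ie.left, ih.1⟩, ⟨ie.right.ctxConv h, ih.2.1⟩, .cons ih.2.2 (e.symm.ctxConv h)⟩

theorem HasType.presup {Δ : MCtx C} {Γ : Ctx C} {E F : Expr C} :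
    HasType Sg Δ Γ E F → TypePresup Sg Δ Γ E F
  | .type h => ⟨h.good, .kind, fun _ _ h => (nomatch h), trivial⟩
  | .const h hK => by
    obtain ⟨s, h₁, h₂⟩ := hC.ok _ _ hK
    refine ⟨h.good, ⟨.of_sort (h₁ _ _ h.good).1, (h₁ _ _ h.good).2⟩, fun _ _ h => (nomatch h),
      fun Γ' σ hΓ' hσ => ?_, fun Δ' θ hΔ' hθ => ?_⟩
    · obtain ⟨s', e⟩ := (hC.ok _ _ hK).clo hΓ' h.good hσ
      exact (HasType.const hΓ'.wf hK).conv e.symm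
    · obtain ⟨s', e⟩ := (hC.ok _ _ hK).mclo h.good hΔ' hθ
      exact (HasType.const (h.good.msub hθ hΔ').wf hK).conv e.symm
  | .pi h => by
    have ih := h.presup
    refine ⟨ih.good.2, .sort ih.good.2 _, ?_, trivial⟩
    rintro _ _ ⟨⟩
    exact ⟨ih.good.1, _, h⟩
  | .var_zero h => by
    have hΓ : GoodCtx Sg Δ (_ :: _) := ⟨h, h.presup.good⟩
    refine ⟨hΓ, .of_clo (h.clo_sort hΓ.shift), fun _ _ h => (nomatch h),
      fun _ h => (nomatch h), fun Δ' θ hΔ' hθ => ?_⟩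
    exact (HasType.var_zero (h.mclo_sort hθ hΓ.2.wf)).conv
      (ExprEq.mclo_shift_one hΓ hθ h).symm
  | .var_succ h hB => by
    have ih := h.presup
    have hΓ : GoodCtx Sg Δ (_ :: _) := ⟨hB, ih.good⟩
    obtain ⟨s, hA⟩ := ih.cls.exists_sort h.var_class_ne_kind
    refine ⟨hΓ, .of_clo (hA.clo_sort hΓ.shift), fun _ _ h => (nomatch h), ?_,
      fun Δ' θ hΔ' hθ => ?_⟩
    · rintro k ⟨⟩
      have := HasType.clo hΓ.shift h
      rwa [hA.tclo_eq] at this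
    · exact ((ih.atomInv.2 Δ' θ hΔ' hθ).var_succ (hB.mclo_sort hθ hΓ.2.wf)).conv
        (ExprEq.mclo_shift_one hΓ hθ hA).symm
  | .mvar_zero h => by
    have ih := h.presup
    have hΔ := ih.good.mctx_cons h
    exact ⟨ih.good.msub hΔ.shift hΔ, .of_mclo (h.mclo_sort hΔ.shift ih.good.wf),
      fun _ _ h => (nomatch h), fun _ h => (nomatch h)⟩
  | .mvar_succ h hB => by
    have ih := h.presup
    have hΔ := hB.presup.good.mctx_cons hB
    obtain ⟨s, hA⟩ := ih.cls.exists_sort h.mvar_class_ne_kind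
    refine ⟨ih.good.msub hΔ.shift hΔ, .of_mclo (hA.mclo_sort hΔ.shift ih.good.wf),
      fun _ _ h => (nomatch h), ?_⟩
    rintro k ⟨⟩
    have := HasType.mclo hΔ.shift h
    rwa [hA.tmclo_eq] at this
  | .lam h hB => by
    have hΓ := hB.presup.good
    exact ⟨hΓ.2, .of_pi hΓ.1 hB, fun _ _ h => (nomatch h), trivial⟩
  | .app h hN => by
    have ih := h.presup
    obtain ⟨hA, s, hF⟩ := ih.cls.pi_inv
    exact ⟨ih.good, .of_clo (hF.clo_sort (.single ih.good hA hN)), fun _ _ h => (nomatch h),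
      trivial⟩
  | .clo hσ h => by
    have iσ := hσ.presup
    exact ⟨iσ.dom, h.presup.cls.clo hσ, fun _ _ h => (nomatch h), trivial⟩
  | .mclo hθ h => by
    have iθ := hθ.presup
    have ih := h.presup
    exact ⟨ih.good.msub hθ iθ.1, ih.cls.mclo hθ ih.good.wf, fun _ _ h => (nomatch h), trivial⟩
  | .conv h e => by
    have ih := h.presup
    have ie := e.presup
    exact ⟨ih.good, ⟨.of_sort ie.right, ie.piRight⟩, ih.piInv, ih.atomInv.conv ih.good e⟩
  | .ctxConv h e => by
    have ih := h.presup
    have ie := e.presup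
    exact ⟨ie.2.1, ih.cls.ctxConv e, ih.piInv.ctxConv e, ih.atomInv.ctxConv ih.good e ie.2.2⟩

theorem SubHasType.presup {Δ : MCtx C} {Γ Ψ : Ctx C} {σ : Sub C} :
    SubHasType Sg Δ Γ σ Ψ → SubPresup Sg Δ Γ σ Ψ
  | .shift h _ => ⟨h.good, h.good.suffix, fun _ _ h => (nomatch h)⟩
  | .cons hσ hA hM => by
    have iσ := hσ.presup
    refine ⟨iσ.dom, ⟨hA, iσ.cod⟩, ?_⟩
    rintro _ _ ⟨⟩ _ _ ⟨⟩
    exact ⟨hσ, hM⟩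
  | .clo hτ hσ => ⟨hτ.presup.dom, hσ.presup.cod, fun _ _ h => (nomatch h)⟩
  | .mclo hθ hσ => by
    have iθ := hθ.presup
    have iσ := hσ.presup
    exact ⟨iσ.dom.msub hθ iθ.1, iσ.cod.msub hθ iθ.1, fun _ _ h => (nomatch h)⟩
  | .ctxConv hσ e e' => by
    have iσ := hσ.presup
    have ie := e.presup
    have ie' := e'.presup
    refine ⟨ie.2.1, ie'.2.1, ?_⟩
    rintro τ M rfl A' Ψ' rfl
    cases e' with
    | cons e₁ e₂ =>
      obtain ⟨h₁, h₂⟩ := iσ.consInv _ _ rfl _ _ rfl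
      exact ⟨h₁.ctxConv e e₁, (h₂.conv (e₂.clo_sort (.refl h₁) h₁)).ctxConv e⟩

theorem MSubHasType.presup {Δ Δ' : MCtx C} {θ : MSub C} :
    MSubHasType Sg Δ θ Δ' → GoodMCtx Sg Δ ∧ GoodMCtx Sg Δ'
  | .shift h _ => ⟨h.good, h.good.suffix⟩
  | .cons hθ hA _ => ⟨hθ.presup.1, hA.presup.good.mctx_cons hA⟩
  | .mclo hθ hθ' => ⟨hθ.presup.1, hθ'.presup.2⟩

theorem ExprEq.presup {Δ : MCtx C} {Γ : Ctx C} {E E' F : Expr C} :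
    ExprEq Sg Δ Γ E E' F → EqPresup Sg Δ Γ E E' F
  | .refl h => ⟨h.presup.good, h.presup.cls, h, h, h.presup.piInv, h.presup.piInv⟩
  | .symm e => by
    have ie := e.presup
    exact ⟨ie.good, ie.cls, ie.right, ie.left, ie.piRight, ie.piLeft⟩
  | .trans e e' => by
    have ie := e.presup
    have ie' := e'.presup
    exact ⟨ie.good, ie.cls, ie.left, ie'.right, ie.piLeft, ie'.piRight⟩
  | .conv e e' => by
    have ie := e.presup
    have ie' := e'.presup
    exact ⟨ie.good, ⟨.of_sort ie'.right, ie'.piRight⟩, ie.left.conv e', ie.right.conv e',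
      ie.piLeft, ie.piRight⟩
  | .ctxConv e e' => by
    have ie := e.presup
    have ie' := e'.presup
    exact ⟨ie'.2.1, ie.cls.ctxConv e', ie.left.ctxConv e', ie.right.ctxConv e',
      ie.piLeft.ctxConv e', ie.piRight.ctxConv e'⟩
  | .pi e e' => by
    have ie := e.presup
    have ie' := e'.presup
    have h := ie'.right.ctxConv (.cons ie.good.refl e)
    exact ⟨ie.good, .sort ie.good _, .pi ie'.left, .pi h,
      (PiClass.of_pi ie.left ie'.left).2, (PiClass.of_pi ie.right h).2⟩
  | .lam e h => by
    have ie := e.presup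
    exact ⟨ie.good.2, .of_pi ie.good.1 h, .lam ie.left h, .lam ie.right h,
      fun _ _ h => (nomatch h), fun _ _ h => (nomatch h)⟩
  | .app e e' => by
    have ie := e.presup
    have ie' := e'.presup
    obtain ⟨hA, s, hF⟩ := ie.cls.pi_inv
    have h₁ := SubHasType.single ie.good hA ie'.left
    have h₂ := SubHasType.single ie.good hA ie'.right
    exact ⟨ie.good, .of_clo (hF.clo_sort h₁), .app ie.left ie'.left,
      (HasType.app ie.right ie'.right).conv
        (ExprEq.clo_sort (.refl hF) (SubEq.single ie.good hA e'.symm) h₂),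
      fun _ _ h => (nomatch h), fun _ _ h => (nomatch h)⟩
  | .clo eσ e => by
    have iσ := eσ.presup
    have ie := e.presup
    exact ⟨iσ.dom, ie.cls.clo iσ.left, .clo iσ.left ie.left,
      (HasType.clo iσ.right ie.right).classConv
        (ClassEq.clo (.refl _) ie.cls.1 eσ.symm iσ.right),
      fun _ _ h => (nomatch h), fun _ _ h => (nomatch h)⟩
  | .mclo eθ e => by
    have iθ := eθ.presup
    have ie := e.presup
    exact ⟨ie.good.msub iθ.left iθ.dom, ie.cls.mclo iθ.left ie.good.wf, .mclo iθ.left ie.left,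
      ((HasType.mclo iθ.right ie.right).classConv
        (ClassEq.mclo (.refl _) ie.cls.1 eθ.symm iθ.right ie.good.wf)).ctxConv
        (ie.good.msub_congr eθ.symm iθ.right iθ.dom),
      fun _ _ h => (nomatch h), fun _ _ h => (nomatch h)⟩
  | .beta h hB hN => by
    have hΓ := hB.presup.good
    have h₁ := SubHasType.single hΓ.2 hΓ.1 hN
    have h₂ := HasType.clo h₁ h
    rw [hB.tclo_eq] at h₂
    exact ⟨hΓ.2, .of_clo (hB.clo_sort h₁), .app (.lam h hB) hN, h₂,
      fun _ _ h => (nomatch h), fun _ _ h => (nomatch h)⟩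
  | .eta h hB => by
    have ih := h.presup
    have hΓ := hB.presup.good
    have h₁ := (HasType.clo hΓ.shift h).conv (ExprEq.clo_pi hΓ.shift hB)
    have hx := HasType.var_zero hΓ.1
    have hl := SubHasType.lift hΓ hΓ.shift hΓ.1
    have hs := SubHasType.single hΓ (hΓ.1.clo_sort hΓ.shift) hx
    have h₂ := (HasType.app h₁ hx).conv (((ExprEq.clo_clo_sort hB hs hl).trans
      (ExprEq.clo_sort (.refl hB) ((SubEq.single_lift hΓ hΓ.shift hΓ.1 hx).trans
        (SubEq.eta (Γ' := []) hΓ.wf rfl).symm) (.clo hs hl))).trans (.clo_id hB))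
    exact ⟨hΓ.2, .of_pi hΓ.1 hB, h, .lam h₂ hB, ih.piInv, fun _ _ h => (nomatch h)⟩
  | .clo_id h => by
    have ih := h.presup
    exact ⟨ih.good, ih.cls, (HasType.clo ih.good.id h).classConv (.clo_id ih.cls.1), h,
      fun _ _ h => (nomatch h), ih.piInv⟩
  | .clo_clo hσ hτ h => by
    have ih := h.presup
    have iσ := hσ.presup
    exact ⟨iσ.dom, ih.cls.clo (.clo hσ hτ), (HasType.clo hσ (.clo hτ h)).classConv
      (.clo_clo ih.cls.1 hσ hτ), .clo (.clo hσ hτ) h,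
      fun _ _ h => (nomatch h), fun _ _ h => (nomatch h)⟩
  | .clo_type hσ => by
    have iσ := hσ.presup
    exact ⟨iσ.dom, .kind, .clo hσ (.type iσ.cod.wf), .type iσ.dom.wf,
      fun _ _ h => (nomatch h), fun _ _ h => (nomatch h)⟩
  | .clo_const hσ h => by
    have iσ := hσ.presup
    have ih := h.presup
    have h₁ := HasType.clo hσ h
    have h₂ := ih.cls.clo hσ
    rw [Expr.tclo_eq h.const_class_ne_kind] at h₁ h₂
    exact ⟨iσ.dom, h₂, h₁, ih.atomInv.1 _ _ iσ.dom hσ,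
      fun _ _ h => (nomatch h), fun _ _ h => (nomatch h)⟩
  | .clo_var_zero hσ hA hM => by
    have iσ := hσ.presup
    have iM := hM.presup
    have hΨ : GoodCtx Sg Δ (_ :: _) := ⟨hA, iσ.cod⟩
    have h₁ := SubHasType.cons hσ hA hM
    refine ⟨iσ.dom, iM.cls, ?_, hM, fun _ _ h => (nomatch h), iM.piInv⟩
    exact (HasType.clo h₁ (.var_zero hA)).conv
      ((ExprEq.clo_clo_sort hA h₁ hΨ.shift).trans
        (ExprEq.clo_sort (.refl hA) (.cons_shift_one h₁ hσ) (.clo h₁ hΨ.shift)))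
  | .var_succ h => by
    have ih := h.presup
    exact ⟨ih.good, ih.cls, h, ih.atomInv.1 _ rfl, fun _ _ h => (nomatch h),
      fun _ _ h => (nomatch h)⟩
  | .clo_pi hσ h => by
    have iσ := hσ.presup
    have ih := h.presup
    have h₁ := h.clo_sort (.lift iσ.dom hσ ih.good.1)
    exact ⟨iσ.dom, .sort iσ.dom _, h.pi.clo_sort hσ, .pi h₁, fun _ _ h => (nomatch h),
      (PiClass.of_pi (ih.good.1.clo_sort hσ) h₁).2⟩
  | .clo_lam hσ h hB => by
    have iσ := hσ.presup
    have hΨ := hB.presup.good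
    have hl := SubHasType.lift iσ.dom hσ hΨ.1
    have h₁ := hB.clo_sort hl
    have h₂ := HasType.clo hl h
    rw [hB.tclo_eq] at h₂
    exact ⟨iσ.dom, .of_pi (hΨ.1.clo_sort hσ) h₁, (HasType.clo hσ (.lam h hB)).conv (.clo_pi hσ hB),
      .lam h₂ h₁, fun _ _ h => (nomatch h), fun _ _ h => (nomatch h)⟩
  | .clo_app hσ h hN => by
    have iσ := hσ.presup
    have ih := h.presup
    obtain ⟨hA, s, hF⟩ := ih.cls.pi_inv
    have hl := SubHasType.lift iσ.dom hσ hA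
    have hs := SubHasType.single iσ.cod hA hN
    have hN' := HasType.clo hσ hN
    rw [hA.tclo_eq] at hN'
    have hs' := SubHasType.single iσ.dom (hA.clo_sort hσ) hN'
    have hc := SubHasType.cons hσ hA hN'
    refine ⟨iσ.dom, .of_clo (hF.clo_sort hc), ?_, ?_, fun _ _ h => (nomatch h),
      fun _ _ h => (nomatch h)⟩
    · exact (HasType.clo hσ (.app h hN)).conv ((ExprEq.clo_clo_sort hF hσ hs).trans
        (ExprEq.clo_sort (.refl hF) (.clo_single iσ.cod hσ hA hN) (.clo hσ hs)))
    · exact (HasType.app ((HasType.clo hσ h).conv (.clo_pi hσ hF)) hN').conv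
        ((ExprEq.clo_clo_sort hF hs' hl).trans
          (ExprEq.clo_sort (.refl hF) (.single_lift iσ.dom hσ hA hN') (.clo hs' hl)))
  | .mclo_id h => by
    have ih := h.presup
    exact ⟨ih.good, ih.cls, ((HasType.mclo ih.good.mctx.id h).ctxConv
      ih.good.msub_id.1).classConv (.mclo_id ih.cls.1), h,
      fun _ _ h => (nomatch h), ih.piInv⟩
  | .mclo_mclo hθ hθ' h => by
    have ih := h.presup
    have iθ := hθ.presup
    exact ⟨ih.good.msub (.mclo hθ hθ') iθ.1, ih.cls.mclo (.mclo hθ hθ') ih.good.wf,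
      ((HasType.mclo hθ (.mclo hθ' h)).ctxConv (ih.good.msub_msub hθ hθ' iθ.1).1).classConv
        (.mclo_mclo ih.cls.1 hθ hθ' ih.good.wf), .mclo (.mclo hθ hθ') h,
      fun _ _ h => (nomatch h), fun _ _ h => (nomatch h)⟩
  | .mclo_type hθ hΓ => by
    have hΓ' := hΓ.good.msub hθ hθ.presup.1
    exact ⟨hΓ', .kind, .mclo hθ (.type hΓ), .type hΓ'.wf,
      fun _ _ h => (nomatch h), fun _ _ h => (nomatch h)⟩
  | .mclo_const hθ h => by
    have iθ := hθ.presup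
    have ih := h.presup
    have h₁ := HasType.mclo hθ h
    have h₂ := ih.cls.mclo hθ ih.good.wf
    rw [Expr.tmclo_eq h.const_class_ne_kind] at h₁ h₂
    exact ⟨ih.good.msub hθ iθ.1, h₂, h₁, ih.atomInv.2 _ _ iθ.1 hθ,
      fun _ _ h => (nomatch h), fun _ _ h => (nomatch h)⟩
  | .mclo_var hθ h => by
    have iθ := hθ.presup
    have ih := h.presup
    have h₁ := HasType.mclo hθ h
    have h₂ := ih.cls.mclo hθ ih.good.wf
    rw [Expr.tmclo_eq h.var_class_ne_kind] at h₁ h₂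
    exact ⟨ih.good.msub hθ iθ.1, h₂, h₁, ih.atomInv.2 _ _ iθ.1 hθ,
      fun _ _ h => (nomatch h), fun _ _ h => (nomatch h)⟩
  | .mclo_mvar_zero hθ hA hM => by
    have iθ := hθ.presup
    have iA := hA.presup
    have iM := hM.presup
    have hΔ' := iA.good.mctx_cons hA
    have h₁ := MSubHasType.cons hθ hA hM
    have e := MSubEq.cons_shift_one h₁ hθ
    have h₂ := MSubHasType.mclo h₁ hΔ'.shift
    refine ⟨iM.good, iM.cls, ?_, hM, fun _ _ h => (nomatch h), iM.piInv⟩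
    exact (((HasType.mclo h₁ (.mvar_zero hA)).ctxConv
      (iA.good.msub_msub h₁ hΔ'.shift iθ.1).1).conv
      ((ExprEq.mclo_mclo_sort hA h₁ hΔ'.shift iA.good.wf).trans
        (ExprEq.mclo_sort (.refl hA) e h₂ iA.good.wf))).ctxConv
      (iA.good.msub_congr e h₂ iθ.1)
  | .mvar_succ h => by
    have ih := h.presup
    exact ⟨ih.good, ih.cls, h, ih.atomInv _ rfl, fun _ _ h => (nomatch h),
      fun _ _ h => (nomatch h)⟩
  | .mclo_pi hθ h => by
    have iθ := hθ.presup
    have ih := h.presup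
    have h₁ := h.mclo_sort hθ ih.good.wf
    have hΓ := ih.good.msub hθ iθ.1
    exact ⟨hΓ.2, .sort hΓ.2 _, h.pi.mclo_sort hθ ih.good.2.wf, .pi h₁, fun _ _ h => (nomatch h),
      (PiClass.of_pi hΓ.1 h₁).2⟩
  | .mclo_lam hθ h hB => by
    have iθ := hθ.presup
    have iB := hB.presup
    have h₁ := hB.mclo_sort hθ iB.good.wf
    have hΓ := iB.good.msub hθ iθ.1
    have h₂ := HasType.mclo hθ h
    rw [hB.tmclo_eq] at h₂
    exact ⟨hΓ.2, .of_pi hΓ.1 h₁, (HasType.mclo hθ (.lam h hB)).conv (.mclo_pi hθ hB),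
      .lam h₂ h₁, fun _ _ h => (nomatch h), fun _ _ h => (nomatch h)⟩
  | .mclo_app hθ h hN => by
    have iθ := hθ.presup
    have ih := h.presup
    obtain ⟨hA, s, hF⟩ := ih.cls.pi_inv
    have hΓA : GoodCtx Sg _ (_ :: _) := ⟨hA, ih.good⟩
    have hΓ := hΓA.msub hθ iθ.1
    have hs := SubHasType.single ih.good hA hN
    have hN' := HasType.mclo hθ hN
    rw [hA.tmclo_eq] at hN'
    have hs' := SubHasType.single hΓ.2 hΓ.1 hN'
    have hF' := hF.mclo_sort hθ hΓA.wf
    refine ⟨hΓ.2, .of_clo (hF'.clo_sort hs'), ?_, ?_, fun _ _ h => (nomatch h),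
      fun _ _ h => (nomatch h)⟩
    · exact (HasType.mclo hθ (.app h hN)).conv ((ExprEq.mclo_clo_sort hF hθ hs hΓA.wf).trans
        (ExprEq.clo_sort (.refl hF') (.mclo_single ih.good hθ hA hN) (.mclo hθ hs)))
    · exact HasType.app ((HasType.mclo hθ h).conv (.mclo_pi hθ hF)) hN'
  | .mclo_clo hθ hσ h => by
    have iθ := hθ.presup
    have iσ := hσ.presup
    have ih := h.presup
    exact ⟨iσ.dom.msub hθ iθ.1, (ih.cls.mclo hθ ih.good.wf).clo (.mclo hθ hσ),
      (HasType.mclo hθ (.clo hσ h)).classConv (.mclo_clo ih.cls.1 hθ hσ ih.good.wf),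
      .clo (.mclo hθ hσ) (.mclo hθ h), fun _ _ h => (nomatch h), fun _ _ h => (nomatch h)⟩

theorem SubEq.presup {Δ : MCtx C} {Γ Ψ : Ctx C} {σ σ' : Sub C} :
    SubEq Sg Δ Γ σ σ' Ψ → SubEqPresup Sg Δ Γ σ σ' Ψ
  | .refl h => ⟨h.presup.dom, h.presup.cod, h, h⟩
  | .symm e => by
    have ie := e.presup
    exact ⟨ie.dom, ie.cod, ie.right, ie.left⟩
  | .trans e e' => by
    have ie := e.presup
    have ie' := e'.presup
    exact ⟨ie.dom, ie.cod, ie.left, ie'.right⟩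
  | .ctxConv e e₁ e₂ => by
    have ie := e.presup
    have i₁ := e₁.presup
    have i₂ := e₂.presup
    exact ⟨i₁.2.1, i₂.2.1, ie.left.ctxConv e₁ e₂, ie.right.ctxConv e₁ e₂⟩
  | .cons e hA e' => by
    have ie := e.presup
    have ie' := e'.presup
    exact ⟨ie.dom, ⟨hA, ie.cod⟩, .cons ie.left hA ie'.left,
      .cons ie.right hA (ie'.right.conv (ExprEq.clo_sort (.refl hA) e ie.left))⟩
  | .clo e e' => by
    have ie := e.presup
    have ie' := e'.presup
    exact ⟨ie.dom, ie'.cod, .clo ie.left ie'.left, .clo ie.right ie'.right⟩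
  | .mclo e e' => by
    have ie := e.presup
    have ie' := e'.presup
    exact ⟨ie'.dom.msub ie.left ie.dom, ie'.cod.msub ie.left ie.dom, .mclo ie.left ie'.left,
      (SubHasType.mclo ie.right ie'.right).ctxConv
        (ie'.dom.msub_congr e.symm ie.right ie.dom) (ie'.cod.msub_congr e.symm ie.right ie.dom)⟩
  | .cons_shift h hn => by
    have ih := h.presup
    obtain ⟨h₁, h₂⟩ := ih.consInv _ _ rfl _ _ rfl
    exact ⟨ih.dom, GoodCtx.suffix ih.cod.2, .clo h (GoodCtx.shift_cons ih.cod hn),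
      .clo h₁ (.shift ih.cod.2.wf hn)⟩
  | .clo_cons hσ h => by
    have iσ := hσ.presup
    have ih := h.presup
    obtain ⟨h₁, h₂⟩ := ih.consInv _ _ rfl _ _ rfl
    have hA := ih.cod.1
    exact ⟨iσ.dom, ih.cod, .clo hσ h, .cons (.clo hσ h₁) hA
      ((HasType.clo hσ h₂).conv (ExprEq.clo_clo_sort hA hσ h₁))⟩
  | .shift_shift h hm hn => by
    have hΓ := h.good
    have h₁ := GoodCtx.suffix hΓ
    exact ⟨hΓ, GoodCtx.suffix h₁, .clo (.shift hΓ.wf hn) (.shift h₁.wf hm),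
      GoodCtx.shift_append_append hΓ hm hn⟩
  | .id_clo h => by
    have ih := h.presup
    exact ⟨ih.dom, ih.cod, .clo ih.dom.id h, h⟩
  | .clo_id h => by
    have ih := h.presup
    exact ⟨ih.dom, ih.cod, .clo h ih.cod.id, h⟩
  | .assoc h₁ h₂ h₃ =>
    ⟨h₁.presup.dom, h₃.presup.cod, .clo h₁ (.clo h₂ h₃), .clo (.clo h₁ h₂) h₃⟩
  | .mclo_shift hθ h hn => by
    have iθ := hθ.presup
    have hΓ := h.good.msub hθ iθ.1
    have h₁ := SubHasType.mclo hθ (.shift h hn)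
    rw [Ctx.msub_append] at hΓ h₁
    exact ⟨hΓ, GoodCtx.suffix hΓ, h₁, .shift hΓ.wf (by simpa using hn)⟩
  | .mclo_cons hθ hσ hA hM => by
    have iθ := hθ.presup
    have iσ := hσ.presup
    have hA' := hA.mclo_sort hθ iσ.cod.wf
    exact ⟨iσ.dom.msub hθ iθ.1, ⟨hA', iσ.cod.msub hθ iθ.1⟩, .mclo hθ (.cons hσ hA hM),
      .cons (.mclo hθ hσ) hA'
        ((HasType.mclo hθ hM).conv (ExprEq.mclo_clo_sort hA hθ hσ iσ.cod.wf))⟩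
  | .mclo_clo hθ hτ hσ => by
    have iθ := hθ.presup
    exact ⟨hτ.presup.dom.msub hθ iθ.1, hσ.presup.cod.msub hθ iθ.1, .mclo hθ (.clo hτ hσ),
      .clo (.mclo hθ hτ) (.mclo hθ hσ)⟩
  | .mclo_mclo hθ hθ' hσ => by
    have iθ := hθ.presup
    have iσ := hσ.presup
    exact ⟨iσ.dom.msub (.mclo hθ hθ') iθ.1, iσ.cod.msub (.mclo hθ hθ') iθ.1,
      (SubHasType.mclo hθ (.mclo hθ' hσ)).ctxConv (iσ.dom.msub_msub hθ hθ' iθ.1).1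
        (iσ.cod.msub_msub hθ hθ' iθ.1).1, .mclo (.mclo hθ hθ') hσ⟩
  | .eta h hn => by
    have hΓ := h.good
    have h₁ := GoodCtx.suffix hΓ
    exact ⟨hΓ, h₁, .shift h hn, .cons (hΓ.shift_append hn) h₁.1 (hΓ.hasType_var hn)⟩

theorem MSubEq.presup {Δ Δ' : MCtx C} {θ θ' : MSub C} :
    MSubEq Sg Δ θ θ' Δ' → MSubEqPresup Sg Δ θ θ' Δ'
  | .refl h => ⟨h.presup.1, h.presup.2, h, h⟩
  | .symm e => by
    have ie := e.presup
    exact ⟨ie.dom, ie.cod, ie.right, ie.left⟩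
  | .trans e e' => by
    have ie := e.presup
    have ie' := e'.presup
    exact ⟨ie.dom, ie.cod, ie.left, ie'.right⟩
  | .cons e hA e' => by
    have ie := e.presup
    have iA := hA.presup
    have ie' := e'.presup
    exact ⟨ie.dom, iA.good.mctx_cons hA, .cons ie.left hA ie'.left,
      .cons ie.right hA ((ie'.right.conv
        (ExprEq.mclo_sort (.refl hA) e ie.left iA.good.wf)).ctxConv
        (iA.good.msub_congr e ie.left ie.dom))⟩
  | .mclo e e' => by
    have ie := e.presup
    have ie' := e'.presup
    exact ⟨ie.dom, ie'.cod, .mclo ie.left ie'.left, .mclo ie.right ie'.right⟩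
  | .cons_shift h hn => by
    have ih := h.presup
    cases h with
    | cons h₁ hA hM =>
      exact ⟨ih.1, GoodMCtx.suffix ih.2.2, .mclo (.cons h₁ hA hM)
        (GoodMCtx.shift_cons ih.2 hn), .mclo h₁ (.shift ih.2.2.wf hn)⟩
  | .mclo_cons hθ h => by
    have iθ := hθ.presup
    have ih := h.presup
    cases h with
    | cons h₁ hA hM =>
      have hΓ := GoodMCtx.ctx ih.2
      exact ⟨iθ.1, ih.2, .mclo hθ (.cons h₁ hA hM), .cons (.mclo hθ h₁) hA
        (((HasType.mclo hθ hM).ctxConv (hΓ.msub_msub hθ h₁ iθ.1).1).conv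
          (ExprEq.mclo_mclo_sort hA hθ h₁ hΓ.wf))⟩
  | .shift_shift h hm hn => by
    have hΔ := h.good
    have h₁ := GoodMCtx.suffix hΔ
    exact ⟨hΔ, GoodMCtx.suffix h₁, .mclo (.shift hΔ.wf hn) (.shift h₁.wf hm),
      GoodMCtx.shift_append_append hΔ hm hn⟩
  | .id_mclo h => by
    have ih := h.presup
    exact ⟨ih.1, ih.2, .mclo ih.1.id h, h⟩
  | .mclo_id h => by
    have ih := h.presup
    exact ⟨ih.1, ih.2, .mclo h ih.2.id, h⟩
  | .assoc h₁ h₂ h₃ =>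
    ⟨h₁.presup.1, h₃.presup.2, .mclo h₁ (.mclo h₂ h₃), .mclo (.mclo h₁ h₂) h₃⟩
  | .eta h hn => by
    have hΔ := h.good
    have h₁ := GoodMCtx.suffix hΔ
    exact ⟨hΔ, h₁, .shift h hn, .cons (hΔ.shift_append hn) h₁.1.1
      (hΔ.hasType_mvar (GoodMCtx.ctx h₁) hn)⟩

end

end Presup

/-! ### Inversion of the typing judgements -/

section Generation

variable [hSg : Fact (SigWf Sg)] [hC : ConstsOk Sg] {Δ Δ' : MCtx C} {Γ Γ' Γ'' Ψ Ψ' : Ctx C}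
  {E F F' M N A : Expr C} {σ τ : Sub C} {θ : MSub C} {s : Srt} {n : ℕ} {a : C}

theorem CtxEq.symm (h : CtxEq Sg Δ Γ Γ') : CtxEq Sg Δ Γ' Γ := h.presup.2.2

theorem CtxEq.left (h : CtxEq Sg Δ Γ Γ') : GoodCtx Sg Δ Γ := h.presup.1

theorem CtxEq.trans : ∀ {Γ Γ' Γ'' : Ctx C}, CtxEq Sg Δ Γ Γ' → CtxEq Sg Δ Γ' Γ'' →
    CtxEq Sg Δ Γ Γ''
  | [], [], [], h, _ => h
  | _ :: _, _ :: _, _ :: _, .cons h e, .cons h' e' =>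
    .cons (h.trans h') (e.trans (e'.ctxConv h.symm))

theorem CtxEq.split : ∀ {Γ₁ Γ₂ Γ' : Ctx C}, CtxEq Sg Δ (Γ₁ ++ Γ₂) Γ' →
    ∃ Γ₁' Γ₂', Γ' = Γ₁' ++ Γ₂' ∧ Γ₁'.length = Γ₁.length ∧ CtxEq Sg Δ Γ₂ Γ₂'
  | [], _, Γ', h => ⟨[], Γ', rfl, rfl, h⟩
  | _ :: _, _, A :: _, .cons h _ => by
    obtain ⟨Γ₁', Γ₂', rfl, h₁, h₂⟩ := h.split
    exact ⟨A :: Γ₁', Γ₂', rfl, by simp [h₁], h₂⟩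

theorem HasType.good (h : HasType Sg Δ Γ E F) : GoodCtx Sg Δ Γ := h.presup.good

theorem HasType.isClass (h : HasType Sg Δ Γ E F) : IsClass Sg Δ Γ F := h.presup.cls.1

theorem HasType.pi_inv (h : HasType Sg Δ Γ (.pi A E) F) :
    HasType Sg Δ Γ A (.sort .type) ∧ ∃ s, HasType Sg Δ (A :: Γ) E (.sort s) :=
  h.presup.piInv _ _ rfl

theorem HasType.class_pi_inv (h : HasType Sg Δ Γ E (.pi A F)) :
    HasType Sg Δ Γ A (.sort .type) ∧ ∃ s, HasType Sg Δ (A :: Γ) F (.sort s) :=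
  h.presup.cls.pi_inv

/-- The conclusion of the typing rule for the outermost construction of an expression, up to
conversion. -/
def Gen (Sg : Sig C) (Δ : MCtx C) (Γ : Ctx C) (F : Expr C) : Expr C → Prop
  | .sort _ => True
  | .const a => ∃ K, (a, K) ∈ Sg ∧ ClassEq Sg Δ Γ K F
  | .pi A E => ∃ s, HasType Sg Δ (A :: Γ) E (.sort s) ∧ ClassEq Sg Δ Γ (.sort s) F
  | .var 0 => ∃ A Γ', Γ = A :: Γ' ∧ ClassEq Sg Δ Γ (.clo (.shift 1) A) F
  | .var (n + 1) => ∃ B Γ' A, Γ = B :: Γ' ∧ HasType Sg Δ Γ' (.var n) A ∧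
      ClassEq Sg Δ Γ (.clo (.shift 1) A) F
  | .mvar 0 => ∃ Γ' A Δ', Δ = (Γ', A) :: Δ' ∧ CtxEq Sg Δ (Γ'.msub (.shift 1)) Γ ∧
      ClassEq Sg Δ Γ (.mclo (.shift 1) A) F
  | .mvar (n + 1) => ∃ D Δ' Γ' A, Δ = D :: Δ' ∧ HasType Sg Δ' Γ' (.mvar n) A ∧
      CtxEq Sg Δ (Γ'.msub (.shift 1)) Γ ∧ ClassEq Sg Δ Γ (.mclo (.shift 1) A) F
  | .lam M => ∃ A B, HasType Sg Δ (A :: Γ) M B ∧ HasType Sg Δ (A :: Γ) B (.sort .type) ∧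
      ClassEq Sg Δ Γ (.pi A B) F
  | .app E N => ∃ A F', HasType Sg Δ Γ E (.pi A F') ∧ HasType Sg Δ Γ N A ∧
      ClassEq Sg Δ Γ (.clo (.single N) F') F
  | .clo σ E => ∃ Ψ F', SubHasType Sg Δ Γ σ Ψ ∧ HasType Sg Δ Ψ E F' ∧
      ClassEq Sg Δ Γ (F'.tclo σ) F
  | .mclo θ E => ∃ Δ' Γ' F', MSubHasType Sg Δ θ Δ' ∧ HasType Sg Δ' Γ' E F' ∧
      CtxEq Sg Δ (Γ'.msub θ) Γ ∧ ClassEq Sg Δ Γ (F'.tmclo θ) F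

theorem Gen.classConv (h : Gen Sg Δ Γ F E) (e : ClassEq Sg Δ Γ F F') : Gen Sg Δ Γ F' E := by
  match E, h with
  | .sort _, _ => trivial
  | .const _, ⟨K, h₁, h₂⟩ => exact ⟨K, h₁, h₂.trans e⟩
  | .pi _ _, ⟨s, h₁, h₂⟩ => exact ⟨s, h₁, h₂.trans e⟩
  | .var 0, ⟨A, Γ', h₁, h₂⟩ => exact ⟨A, Γ', h₁, h₂.trans e⟩
  | .var (n + 1), ⟨B, Γ', A, h₁, h₂, h₃⟩ => exact ⟨B, Γ', A, h₁, h₂, h₃.trans e⟩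
  | .mvar 0, ⟨Γ', A, Δ', h₁, h₂, h₃⟩ => exact ⟨Γ', A, Δ', h₁, h₂, h₃.trans e⟩
  | .mvar (n + 1), ⟨D, Δ', Γ', A, h₁, h₂, h₃, h₄⟩ =>
    exact ⟨D, Δ', Γ', A, h₁, h₂, h₃, h₄.trans e⟩
  | .lam _, ⟨A, B, h₁, h₂, h₃⟩ => exact ⟨A, B, h₁, h₂, h₃.trans e⟩
  | .app _ _, ⟨A, F', h₁, h₂, h₃⟩ => exact ⟨A, F', h₁, h₂, h₃.trans e⟩
  | .clo _ _, ⟨Ψ, F', h₁, h₂, h₃⟩ => exact ⟨Ψ, F', h₁, h₂, h₃.trans e⟩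
  | .mclo _ _, ⟨Δ', Γ', F', h₁, h₂, h₃, h₄⟩ => exact ⟨Δ', Γ', F', h₁, h₂, h₃, h₄.trans e⟩

theorem Gen.ctxConv (h : Gen Sg Δ Γ F E) (hE : HasType Sg Δ Γ E F) (e : CtxEq Sg Δ Γ Γ') :
    Gen Sg Δ Γ' F E := by
  match E, h, hE with
  | .sort _, _, _ => trivial
  | .const _, ⟨K, h₁, h₂⟩, _ => exact ⟨K, h₁, h₂.ctxConv e⟩
  | .pi _ _, ⟨s, h₁, h₂⟩, hE =>
    exact ⟨s, h₁.ctxConv (.cons e (.refl hE.pi_inv.1)), h₂.ctxConv e⟩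
  | .var 0, ⟨A, Γ₀, h₁, h₂⟩, _ =>
    subst h₁
    cases e with
    | @cons _ _ Γ₁ _ A' h e' =>
      have hΓ := CtxEq.left (.cons h e')
      exact ⟨A', Γ₁, rfl, (ClassEq.of_eq
        (e'.symm.clo_sort (.refl hΓ.shift) hΓ.shift)).trans h₂ |>.ctxConv (.cons h e')⟩
  | .var (n + 1), ⟨B, Γ₀, A, h₁, h₂, h₃⟩, _ =>
    subst h₁
    cases e with
    | @cons _ _ Γ₁ _ B' h e' =>
      exact ⟨B', Γ₁, A, rfl, h₂.ctxConv h, h₃.ctxConv (.cons h e')⟩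
  | .mvar 0, ⟨Γ₀, A, Δ', h₁, h₂, h₃⟩, _ => exact ⟨Γ₀, A, Δ', h₁, h₂.trans e, h₃.ctxConv e⟩
  | .mvar (n + 1), ⟨D, Δ', Γ₀, A, h₁, h₂, h₃, h₄⟩, _ =>
    exact ⟨D, Δ', Γ₀, A, h₁, h₂, h₃.trans e, h₄.ctxConv e⟩
  | .lam _, ⟨A, B, h₁, h₂, h₃⟩, _ =>
    have e' : CtxEq Sg Δ (A :: Γ) (A :: Γ') := .cons e (.refl h₁.good.1)
    exact ⟨A, B, h₁.ctxConv e', h₂.ctxConv e', h₃.ctxConv e⟩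
  | .app _ _, ⟨A, F', h₁, h₂, h₃⟩, _ =>
    exact ⟨A, F', h₁.ctxConv e, h₂.ctxConv e, h₃.ctxConv e⟩
  | .clo _ _, ⟨Ψ, F', h₁, h₂, h₃⟩, _ =>
    exact ⟨Ψ, F', h₁.ctxConv e h₂.good.refl, h₂, h₃.ctxConv e⟩
  | .mclo _ _, ⟨Δ', Γ₀, F', h₁, h₂, h₃, h₄⟩, _ =>
    exact ⟨Δ', Γ₀, F', h₁, h₂, h₃.trans e, h₄.ctxConv e⟩

theorem HasType.gen {Δ : MCtx C} {Γ : Ctx C} {E F : Expr C} :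
    HasType Sg Δ Γ E F → Gen Sg Δ Γ F E
  | .type _ => trivial
  | .const _ hK => ⟨_, hK, .refl _⟩
  | .pi h => ⟨_, h, .refl _⟩
  | .var_zero _ => ⟨_, _, rfl, .refl _⟩
  | .var_succ h _ => ⟨_, _, _, rfl, h, .refl _⟩
  | .mvar_zero h => ⟨_, _, _, rfl, (HasType.mvar_zero h).good.refl, .refl _⟩
  | .mvar_succ h hB => ⟨_, _, _, _, rfl, h, (HasType.mvar_succ h hB).good.refl, .refl _⟩
  | .lam h hB => ⟨_, _, h, hB, .refl _⟩
  | .app h hN => ⟨_, _, h, hN, .refl _⟩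
  | .clo hσ h => ⟨_, _, hσ, h, .refl _⟩
  | .mclo hθ h => ⟨_, _, _, hθ, h, (HasType.mclo hθ h).good.refl, .refl _⟩
  | .conv h e => h.gen.classConv (.of_eq e)
  | .ctxConv h e => h.gen.ctxConv h e

/-- The conclusion of the typing rule for the outermost construction of a substitution, up to
conversion. -/
def SubGen (Sg : Sig C) (Δ : MCtx C) (Γ Ψ : Ctx C) : Sub C → Prop
  | .shift n => ∃ Γ₁ Γ₂, Γ = Γ₁ ++ Γ₂ ∧ Γ₁.length = n ∧ CtxEq Sg Δ Γ₂ Ψ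
  | .cons σ M => ∃ A Ψ', Ψ = A :: Ψ' ∧ SubHasType Sg Δ Γ σ Ψ' ∧
      HasType Sg Δ Ψ' A (.sort .type) ∧ HasType Sg Δ Γ M (.clo σ A)
  | .clo τ σ => ∃ Ψ', SubHasType Sg Δ Γ τ Ψ' ∧ SubHasType Sg Δ Ψ' σ Ψ
  | .mclo θ σ => ∃ Δ' Γ' Ψ', MSubHasType Sg Δ θ Δ' ∧ SubHasType Sg Δ' Γ' σ Ψ' ∧
      CtxEq Sg Δ (Γ'.msub θ) Γ ∧ CtxEq Sg Δ (Ψ'.msub θ) Ψ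

theorem SubGen.ctxConv (h : SubGen Sg Δ Γ Ψ σ) (e : CtxEq Sg Δ Γ Γ') (e' : CtxEq Sg Δ Ψ Ψ') :
    SubGen Sg Δ Γ' Ψ' σ := by
  match σ, h with
  | .shift n, ⟨Γ₁, Γ₂, h₁, h₂, h₃⟩ =>
    subst h₁
    obtain ⟨Γ₁', Γ₂', rfl, h₄, h₅⟩ := e.split
    exact ⟨Γ₁', Γ₂', rfl, h₄.trans h₂, (h₅.symm.trans h₃).trans e'⟩
  | .cons σ M, ⟨A, Ψ₀, h₁, h₂, h₃, h₄⟩ =>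
    subst h₁
    cases e' with
    | @cons _ _ Ψ₁ _ A' h e' =>
      exact ⟨A', Ψ₁, rfl, h₂.ctxConv e h, e'.presup.right.ctxConv h,
        (h₄.conv (e'.clo_sort (.refl h₂) h₂)).ctxConv e⟩
  | .clo τ σ, ⟨Ψ₀, h₁, h₂⟩ =>
    have h₃ := h₂.presup.dom.refl
    exact ⟨Ψ₀, h₁.ctxConv e h₃, h₂.ctxConv h₃ e'⟩
  | .mclo θ σ, ⟨Δ', Γ₀, Ψ₀, h₁, h₂, h₃, h₄⟩ =>
    exact ⟨Δ', Γ₀, Ψ₀, h₁, h₂, h₃.trans e, h₄.trans e'⟩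

theorem SubHasType.gen {Δ : MCtx C} {Γ Ψ : Ctx C} {σ : Sub C} :
    SubHasType Sg Δ Γ σ Ψ → SubGen Sg Δ Γ Ψ σ
  | .shift h hn => ⟨_, _, rfl, hn, h.good.suffix.refl⟩
  | .cons hσ hA hM => ⟨_, _, rfl, hσ, hA, hM⟩
  | .clo hτ hσ => ⟨_, hτ, hσ⟩
  | .mclo hθ hσ => by
    have h := SubHasType.mclo hθ hσ
    exact ⟨_, _, _, hθ, hσ, h.presup.dom.refl, h.presup.cod.refl⟩
  | .ctxConv hσ e e' => hσ.gen.ctxConv e e'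

end Generation

/-! ### Extension of the signature -/

mutual

theorem MCtxWf.mono {Sg' : Sig C} (hs : Sg ⊆ Sg') {Δ : MCtx C} :
    MCtxWf Sg Δ → MCtxWf Sg' Δ
  | .nil => .nil
  | .cons h => .cons (h.mono hs)

theorem CtxWf.mono {Sg' : Sig C} (hs : Sg ⊆ Sg') {Δ : MCtx C} {Γ : Ctx C} :
    CtxWf Sg Δ Γ → CtxWf Sg' Δ Γ
  | .nil h => .nil (h.mono hs)
  | .cons h => .cons (h.mono hs)

theorem CtxEq.mono {Sg' : Sig C} (hs : Sg ⊆ Sg') {Δ : MCtx C} {Γ Γ' : Ctx C} :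
    CtxEq Sg Δ Γ Γ' → CtxEq Sg' Δ Γ Γ'
  | .nil h => .nil (h.mono hs)
  | .cons h₁ h₂ => .cons (h₁.mono hs) (h₂.mono hs)

theorem HasType.mono {Sg' : Sig C} (hs : Sg ⊆ Sg') {Δ : MCtx C} {Γ : Ctx C} {E F : Expr C} :
    HasType Sg Δ Γ E F → HasType Sg' Δ Γ E F
  | .type h => .type (h.mono hs)
  | .const h₁ h₂ => .const (h₁.mono hs) (hs h₂)
  | .pi h => .pi (h.mono hs)
  | .var_zero h => .var_zero (h.mono hs)
  | .var_succ h₁ h₂ => .var_succ (h₁.mono hs) (h₂.mono hs)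
  | .mvar_zero h => .mvar_zero (h.mono hs)
  | .mvar_succ h₁ h₂ => .mvar_succ (h₁.mono hs) (h₂.mono hs)
  | .lam h₁ h₂ => .lam (h₁.mono hs) (h₂.mono hs)
  | .app h₁ h₂ => .app (h₁.mono hs) (h₂.mono hs)
  | .clo h₁ h₂ => .clo (h₁.mono hs) (h₂.mono hs)
  | .mclo h₁ h₂ => .mclo (h₁.mono hs) (h₂.mono hs)
  | .conv h₁ h₂ => .conv (h₁.mono hs) (h₂.mono hs)
  | .ctxConv h₁ h₂ => .ctxConv (h₁.mono hs) (h₂.mono hs)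

theorem SubHasType.mono {Sg' : Sig C} (hs : Sg ⊆ Sg') {Δ : MCtx C} {Γ Ψ : Ctx C} {σ : Sub C} :
    SubHasType Sg Δ Γ σ Ψ → SubHasType Sg' Δ Γ σ Ψ
  | .shift h₁ h₂ => .shift (h₁.mono hs) h₂
  | .cons h₁ h₂ h₃ => .cons (h₁.mono hs) (h₂.mono hs) (h₃.mono hs)
  | .clo h₁ h₂ => .clo (h₁.mono hs) (h₂.mono hs)
  | .mclo h₁ h₂ => .mclo (h₁.mono hs) (h₂.mono hs)
  | .ctxConv h₁ h₂ h₃ => .ctxConv (h₁.mono hs) (h₂.mono hs) (h₃.mono hs)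

theorem MSubHasType.mono {Sg' : Sig C} (hs : Sg ⊆ Sg') {Δ Δ' : MCtx C} {θ : MSub C} :
    MSubHasType Sg Δ θ Δ' → MSubHasType Sg' Δ θ Δ'
  | .shift h₁ h₂ => .shift (h₁.mono hs) h₂
  | .cons h₁ h₂ h₃ => .cons (h₁.mono hs) (h₂.mono hs) (h₃.mono hs)
  | .mclo h₁ h₂ => .mclo (h₁.mono hs) (h₂.mono hs)

theorem ExprEq.mono {Sg' : Sig C} (hs : Sg ⊆ Sg') {Δ : MCtx C} {Γ : Ctx C} {E E' F : Expr C} :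
    ExprEq Sg Δ Γ E E' F → ExprEq Sg' Δ Γ E E' F
  | .refl h => .refl (h.mono hs)
  | .symm h => .symm (h.mono hs)
  | .trans h₁ h₂ => .trans (h₁.mono hs) (h₂.mono hs)
  | .conv h₁ h₂ => .conv (h₁.mono hs) (h₂.mono hs)
  | .ctxConv h₁ h₂ => .ctxConv (h₁.mono hs) (h₂.mono hs)
  | .pi h₁ h₂ => .pi (h₁.mono hs) (h₂.mono hs)
  | .lam h₁ h₂ => .lam (h₁.mono hs) (h₂.mono hs)
  | .app h₁ h₂ => .app (h₁.mono hs) (h₂.mono hs)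
  | .clo h₁ h₂ => .clo (h₁.mono hs) (h₂.mono hs)
  | .mclo h₁ h₂ => .mclo (h₁.mono hs) (h₂.mono hs)
  | .beta h₁ h₂ h₃ => .beta (h₁.mono hs) (h₂.mono hs) (h₃.mono hs)
  | .eta h₁ h₂ => .eta (h₁.mono hs) (h₂.mono hs)
  | .clo_id h => .clo_id (h.mono hs)
  | .clo_clo h₁ h₂ h₃ => .clo_clo (h₁.mono hs) (h₂.mono hs) (h₃.mono hs)
  | .clo_type h => .clo_type (h.mono hs)
  | .clo_const h₁ h₂ => .clo_const (h₁.mono hs) (h₂.mono hs)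
  | .clo_var_zero h₁ h₂ h₃ => .clo_var_zero (h₁.mono hs) (h₂.mono hs) (h₃.mono hs)
  | .var_succ h => .var_succ (h.mono hs)
  | .clo_pi h₁ h₂ => .clo_pi (h₁.mono hs) (h₂.mono hs)
  | .clo_lam h₁ h₂ h₃ => .clo_lam (h₁.mono hs) (h₂.mono hs) (h₃.mono hs)
  | .clo_app h₁ h₂ h₃ => .clo_app (h₁.mono hs) (h₂.mono hs) (h₃.mono hs)
  | .mclo_id h => .mclo_id (h.mono hs)
  | .mclo_mclo h₁ h₂ h₃ => .mclo_mclo (h₁.mono hs) (h₂.mono hs) (h₃.mono hs)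
  | .mclo_type h₁ h₂ => .mclo_type (h₁.mono hs) (h₂.mono hs)
  | .mclo_const h₁ h₂ => .mclo_const (h₁.mono hs) (h₂.mono hs)
  | .mclo_var h₁ h₂ => .mclo_var (h₁.mono hs) (h₂.mono hs)
  | .mclo_mvar_zero h₁ h₂ h₃ => .mclo_mvar_zero (h₁.mono hs) (h₂.mono hs) (h₃.mono hs)
  | .mvar_succ h => .mvar_succ (h.mono hs)
  | .mclo_pi h₁ h₂ => .mclo_pi (h₁.mono hs) (h₂.mono hs)
  | .mclo_lam h₁ h₂ h₃ => .mclo_lam (h₁.mono hs) (h₂.mono hs) (h₃.mono hs)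
  | .mclo_app h₁ h₂ h₃ => .mclo_app (h₁.mono hs) (h₂.mono hs) (h₃.mono hs)
  | .mclo_clo h₁ h₂ h₃ => .mclo_clo (h₁.mono hs) (h₂.mono hs) (h₃.mono hs)

theorem SubEq.mono {Sg' : Sig C} (hs : Sg ⊆ Sg') {Δ : MCtx C} {Γ Ψ : Ctx C} {σ σ' : Sub C} :
    SubEq Sg Δ Γ σ σ' Ψ → SubEq Sg' Δ Γ σ σ' Ψ
  | .refl h => .refl (h.mono hs)
  | .symm h => .symm (h.mono hs)
  | .trans h₁ h₂ => .trans (h₁.mono hs) (h₂.mono hs)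
  | .ctxConv h₁ h₂ h₃ => .ctxConv (h₁.mono hs) (h₂.mono hs) (h₃.mono hs)
  | .cons h₁ h₂ h₃ => .cons (h₁.mono hs) (h₂.mono hs) (h₃.mono hs)
  | .clo h₁ h₂ => .clo (h₁.mono hs) (h₂.mono hs)
  | .mclo h₁ h₂ => .mclo (h₁.mono hs) (h₂.mono hs)
  | .cons_shift h₁ h₂ => .cons_shift (h₁.mono hs) h₂
  | .clo_cons h₁ h₂ => .clo_cons (h₁.mono hs) (h₂.mono hs)
  | .shift_shift h₁ h₂ h₃ => .shift_shift (h₁.mono hs) h₂ h₃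
  | .id_clo h => .id_clo (h.mono hs)
  | .clo_id h => .clo_id (h.mono hs)
  | .assoc h₁ h₂ h₃ => .assoc (h₁.mono hs) (h₂.mono hs) (h₃.mono hs)
  | .mclo_shift h₁ h₂ h₃ => .mclo_shift (h₁.mono hs) (h₂.mono hs) h₃
  | .mclo_cons h₁ h₂ h₃ h₄ => .mclo_cons (h₁.mono hs) (h₂.mono hs) (h₃.mono hs) (h₄.mono hs)
  | .mclo_clo h₁ h₂ h₃ => .mclo_clo (h₁.mono hs) (h₂.mono hs) (h₃.mono hs)
  | .mclo_mclo h₁ h₂ h₃ => .mclo_mclo (h₁.mono hs) (h₂.mono hs) (h₃.mono hs)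
  | .eta h₁ h₂ => .eta (h₁.mono hs) h₂

theorem MSubEq.mono {Sg' : Sig C} (hs : Sg ⊆ Sg') {Δ Δ' : MCtx C} {θ θ' : MSub C} :
    MSubEq Sg Δ θ θ' Δ' → MSubEq Sg' Δ θ θ' Δ'
  | .refl h => .refl (h.mono hs)
  | .symm h => .symm (h.mono hs)
  | .trans h₁ h₂ => .trans (h₁.mono hs) (h₂.mono hs)
  | .cons h₁ h₂ h₃ => .cons (h₁.mono hs) (h₂.mono hs) (h₃.mono hs)
  | .mclo h₁ h₂ => .mclo (h₁.mono hs) (h₂.mono hs)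
  | .cons_shift h₁ h₂ => .cons_shift (h₁.mono hs) h₂
  | .mclo_cons h₁ h₂ => .mclo_cons (h₁.mono hs) (h₂.mono hs)
  | .shift_shift h₁ h₂ h₃ => .shift_shift (h₁.mono hs) h₂ h₃
  | .id_mclo h => .id_mclo (h.mono hs)
  | .mclo_id h => .mclo_id (h.mono hs)
  | .assoc h₁ h₂ h₃ => .assoc (h₁.mono hs) (h₂.mono hs) (h₃.mono hs)
  | .eta h₁ h₂ => .eta (h₁.mono hs) h₂
end

theorem TypedCtx.mono {Sg' : Sig C} (hs : Sg ⊆ Sg') {Δ : MCtx C} :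
    ∀ {Γ : Ctx C}, TypedCtx Sg Δ Γ → TypedCtx Sg' Δ Γ
  | [], _ => trivial
  | _ :: _, h => ⟨h.1.mono hs, TypedCtx.mono hs h.2⟩

theorem ClassEq.mono {Sg' : Sig C} (hs : Sg ⊆ Sg') {Δ : MCtx C} {Γ : Ctx C} {F F' : Expr C}
    (h : ClassEq Sg Δ Γ F F') : ClassEq Sg' Δ Γ F F' :=
  h.imp id fun ⟨s, h⟩ => ⟨s, h.mono hs⟩

theorem IsClass.mono {Sg' : Sig C} (hs : Sg ⊆ Sg') {Δ : MCtx C} {Γ : Ctx C} {F : Expr C}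
    (h : IsClass Sg Δ Γ F) : IsClass Sg' Δ Γ F :=
  h.imp id fun ⟨s, h⟩ => ⟨s, h.mono hs⟩

/-! ### Invariance of plain closed expressions under substitution -/

/-- The image under `τ` and `θ` of the expression `E : F` is `E` itself. -/
structure Fixed (Sg : Sig C) (Δ : MCtx C) (Γ : Ctx C) (θ : MSub C) (τ : Sub C) (E F : Expr C) :
    Prop where
  eq : ExprEq Sg Δ Γ (.clo τ (.mclo θ E)) E ((F.tmclo θ).tclo τ)
  right : HasType Sg Δ Γ E ((F.tmclo θ).tclo τ)

section Fixed

variable {Sg₀ : Sig C} [hSg₀ : Fact (SigWf Sg₀)] [hC₀ : ConstsOk Sg₀] [hSg : Fact (SigWf Sg)]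
  {Δ : MCtx C} {Γ Γ₀ : Ctx C} {θ : MSub C} {τ : Sub C} {A E F F' : Expr C} {s : Srt}

theorem Fixed.classConv (h : Fixed Sg Δ Γ θ τ E F) (hF : IsClass Sg [] Γ₀ F)
    (e : ClassEq Sg [] Γ₀ F F') (hΓ₀ : GoodCtx Sg [] Γ₀) (hθ : MSubHasType Sg Δ θ [])
    (hτ : SubHasType Sg Δ Γ τ (Γ₀.msub θ)) : Fixed Sg Δ Γ θ τ E F' := by
  have e' := ClassEq.clo (e.mclo hF (.refl hθ) hθ hΓ₀.wf) (hF.mclo hθ hΓ₀.wf) (.refl hτ) hτ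
  exact ⟨h.eq.classConv e', h.right.classConv e'⟩

theorem ClassEq.clo_mclo_sort (hΓ₀ : GoodCtx Sg [] Γ₀) (hΓ : GoodCtx Sg Δ Γ)
    (hθ : MSubHasType Sg Δ θ []) (hτ : SubHasType Sg Δ Γ τ (Γ₀.msub θ)) (s : Srt) :
    ClassEq Sg Δ Γ (((Expr.sort s).tmclo θ).tclo τ) (.sort s) := by
  have hΓ₁ := hΓ₀.msub hθ hΓ.mctx
  refine (ClassEq.clo (.mclo_sort hθ hΓ₀.wf s) ?_ (.refl hτ) hτ).trans (.clo_sort hτ s)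
  refine IsClass.mclo ?_ hθ hΓ₀.wf
  cases s
  · exact .inl rfl
  · exact .of_sort (.type hΓ₀.wf)

theorem Fixed.lift (hs : Sg₀ ⊆ Sg) (hΓ : GoodCtx Sg Δ Γ) (hΓ₀ : GoodCtx Sg [] Γ₀)
    (hθ : MSubHasType Sg Δ θ [])
    (hτ : SubHasType Sg Δ Γ τ (Γ₀.msub θ)) (hA : HasType Sg [] Γ₀ A (.sort .type))
    (h : ∀ n B, HasType Sg₀ [] Γ₀ (.var n) B → Fixed Sg Δ Γ θ τ (.var n) B)
    (n : ℕ) (B : Expr C) (hn : HasType Sg₀ [] (A :: Γ₀) (.var n) B) :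
    Fixed Sg Δ (.clo τ (.mclo θ A) :: Γ) θ τ.lift (.var n) B := by
  have hΓ₁ := hΓ₀.msub hθ hΓ.mctx
  have hA' := hA.mclo_sort hθ hΓ₀.wf
  have hl := SubHasType.lift hΓ hτ hA'
  have hΓA₀ : GoodCtx Sg [] (A :: Γ₀) := ⟨hA, hΓ₀⟩
  have hΓA₁ : GoodCtx Sg Δ (.mclo θ A :: Γ₀.msub θ) := ⟨hA', hΓ₁⟩
  have hΓA := hΓ.cons_clo hτ hA'
  have e₁ : SubEq Sg Δ (.clo τ (.mclo θ A) :: Γ) (.clo τ.lift (.shift 1)) (.clo (.shift 1) τ)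
      (Γ₀.msub θ) := .cons_shift_one hl (.clo hΓA.shift hτ)
  have hl₁ := SubHasType.clo hl hΓA₁.shift
  have e₂ : ∀ {B}, HasType Sg [] Γ₀ B (.sort .type) → ExprEq Sg Δ (.clo τ (.mclo θ A) :: Γ)
      (.clo τ.lift (.mclo θ (.clo (.shift 1) B))) (.clo (.clo (.shift 1) τ) (.mclo θ B))
      (.sort .type) := fun hB =>
    ((ExprEq.clo_sort (ExprEq.mclo_shift_one hΓA₀ hθ hB) (.refl hl) hl).trans
      (ExprEq.clo_clo_sort (hB.mclo_sort hθ hΓ₀.wf) hl hΓA₁.shift)).trans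
      (ExprEq.clo_sort (.refl (hB.mclo_sort hθ hΓ₀.wf)) e₁ hl₁)
  have hB := hn.isClass.mono hs
  cases n with
  | zero =>
    obtain ⟨A', Γ', h₁, h₂⟩ := hn.gen
    cases h₁
    have h₂ := h₂.mono hs
    refine Fixed.classConv ?_ (.of_sort (hA.clo_sort hΓA₀.shift)) h₂ hΓA₀ hθ hl
    have hx := (HasType.var_zero (hA'.clo_sort hτ)).conv
      (ExprEq.clo_clo_sort hA' hΓA.shift hτ)
    have e := (e₂ hA).symm
    refine ⟨.trans ?_ ((ExprEq.clo_var_zero (.clo hΓA.shift hτ) hA' hx).conv e), hx.conv e⟩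
    have := ExprEq.clo (.refl hl) (ExprEq.mclo_var hθ (.var_zero hA))
    exact this
  | succ n =>
    obtain ⟨A', Γ', B', h₁, h₂, h₃⟩ := hn.gen
    cases h₁
    have h₃ := h₃.mono hs
    obtain ⟨f₁, f₂⟩ := h _ _ h₂
    have h₄ := h₂.mono hs
    obtain ⟨s, hB'⟩ := (h₂.isClass.mono hs).resolve_left h₂.var_class_ne_kind
    have hlv := (h₄.levelOk hSg.out.levels).1
    have hlv' := (hB'.levelOk hSg.out.levels).1
    have : s = .type := by cases s <;> simp_all [Expr.level]
    subst this
    refine Fixed.classConv ?_ (.of_sort (hB'.clo_sort hΓA₀.shift)) h₃ hΓA₀ hθ hl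
    rw [hB'.tmclo_eq] at f₁ f₂
    have hB₁ := hB'.mclo_sort hθ hΓ₀.wf
    have e₃ : ExprEq Sg Δ (.clo τ (.mclo θ A) :: Γ) (.clo (.shift 1) (.clo τ (.mclo θ B')))
        (.clo τ.lift (.mclo θ (.clo (.shift 1) B'))) (.sort .type) :=
      (ExprEq.clo_clo_sort hB₁ hΓA.shift hτ).trans (e₂ hB').symm
    have hx : HasType Sg Δ (.clo τ (.mclo θ A) :: Γ) (.var (n + 1))
      (.clo (.shift 1) (.clo τ (.mclo θ B'))) := f₂.var_succ (hA'.clo_sort hτ)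
    have hy := HasType.mclo hθ h₄
    rw [hB'.tmclo_eq] at hy
    refine ⟨?_, hx.conv e₃⟩
    have g₁ : ExprEq Sg [] (A :: Γ₀) (.var (n + 1)) (.clo (.shift 1) (.var n))
      (.clo (.shift 1) B') := .var_succ (h₄.var_succ hA)
    have g₂ := ExprEq.mclo (.refl hθ) g₁
    have g₃ := ExprEq.mclo_clo hθ hΓA₀.shift h₄
    rw [hB'.tmclo_eq] at g₃
    have g₃' := g₃.conv (ExprEq.mclo_clo_sort hB' hθ hΓA₀.shift hΓ₀.wf).symm
    have g₄ : ExprEq Sg Δ (.mclo θ A :: Γ₀.msub θ) (.clo (.mclo θ (.shift 1)) (.mclo θ (.var n)))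
        (.clo (.shift 1) (.mclo θ (.var n))) (.clo (.mclo θ (.shift 1)) (.mclo θ B')) :=
      .clo (.mclo_shift (Γ' := [A]) hθ hΓA₀.wf rfl) (.refl hy)
    have g₅ := (g₂.trans g₃').trans
      (g₄.conv (ExprEq.mclo_clo_sort hB' hθ hΓA₀.shift hΓ₀.wf).symm)
    have g₆ := ExprEq.clo (.refl hl) g₅
    refine (g₆ : ExprEq Sg Δ _ _ _ (.clo _ _)).trans ?_
    refine ExprEq.conv ?_ e₃
    have g₇ : ExprEq Sg Δ (.clo τ (.mclo θ A) :: Γ)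
        (.clo τ.lift (.clo (.shift 1) (.mclo θ (.var n)))) _ (.clo _ (.mclo θ B')) :=
      ExprEq.clo_clo hl hΓA₁.shift hy
    have g₈ : ExprEq Sg Δ (.clo τ (.mclo θ A) :: Γ)
        (.clo (.clo τ.lift (.shift 1)) (.mclo θ (.var n))) (.clo (.clo (.shift 1) τ) _)
        (.clo _ (.mclo θ B')) :=
      ExprEq.clo e₁ (.refl hy)
    have g₉ : ExprEq Sg Δ (.clo τ (.mclo θ A) :: Γ)
        (.clo (.shift 1) (.clo τ (.mclo θ (.var n)))) (.clo (.clo (.shift 1) τ) _)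
        (.clo _ (.mclo θ B')) :=
      ExprEq.clo_clo hΓA.shift hτ hy
    have g₁₀ : ExprEq Sg Δ (.clo τ (.mclo θ A) :: Γ)
        (.clo (.shift 1) (.clo τ (.mclo θ (.var n)))) (.clo (.shift 1) (.var n))
        (.clo (.shift 1) (.clo τ (.mclo θ B'))) :=
      ExprEq.clo (.refl hΓA.shift) f₁
    have c₁ := ExprEq.clo_sort (.refl hB₁) e₁ hl₁
    have c₂ := (ExprEq.clo_clo_sort hB₁ hΓA.shift hτ).symm
    exact ((((g₇.trans g₈).conv c₁).trans g₉.symm).conv c₂).trans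
      (g₁₀.trans (ExprEq.var_succ hx).symm)

end Fixed

section Plain

variable {Sg₀ : Sig C} [hSg₀ : Fact (SigWf Sg₀)] [hC₀ : ConstsOk Sg₀] [hSg : Fact (SigWf Sg)]

theorem Expr.IsPlain.fixed (hs : Sg₀ ⊆ Sg) (hK : ∀ a K, (a, K) ∈ Sg₀ → DeclOk Sg K)
    {E : Expr C} (hE : E.IsPlain) : ∀ {Δ : MCtx C} {Γ Γ₀ : Ctx C} {θ : MSub C} {τ : Sub C}
    {F : Expr C}, GoodCtx Sg Δ Γ → MSubHasType Sg Δ θ [] → SubHasType Sg Δ Γ τ (Γ₀.msub θ) →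
    (∀ n A, HasType Sg₀ [] Γ₀ (.var n) A → Fixed Sg Δ Γ θ τ (.var n) A) →
    HasType Sg₀ [] Γ₀ E F → Fixed Sg Δ Γ θ τ E F ∧ PiInv Sg Δ Γ E := by
  induction hE with
  | sort s =>
    intro Δ Γ Γ₀ θ τ F hΓ hθ hτ _ h
    obtain ⟨rfl, rfl⟩ := h.eq_kind_of_sort
    have hΓ₀ : GoodCtx Sg [] Γ₀ := TypedCtx.good (Δ := []) trivial (h.good.typed.mono hs)
    have hΓ₁ := hΓ₀.msub hθ hΓ.mctx
    exact ⟨⟨(ExprEq.clo (.refl hτ) (.mclo_type hθ hΓ₀.wf)).trans (.clo_type hτ), .type hΓ.wf⟩,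
      fun _ _ h => (nomatch h)⟩
  | const a =>
    intro Δ Γ Γ₀ θ τ F hΓ hθ hτ _ h
    have hΓ₀ : GoodCtx Sg [] Γ₀ := TypedCtx.good (Δ := []) trivial (h.good.typed.mono hs)
    have hΓ₁ := hΓ₀.msub hθ hΓ.mctx
    obtain ⟨K, hK₁, e⟩ := h.gen
    have hKS := hs hK₁
    have hKK := hK _ _ hK₁
    obtain ⟨s₁, e₁⟩ := hKK.mclo hΓ₀ hΓ.mctx hθ
    obtain ⟨s₂, e₂⟩ := hKK.clo hΓ hΓ₁ hτ
    obtain ⟨s₃, h₃, _⟩ := hKK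
    have hK₀ := (h₃ _ _ hΓ₀).1
    refine ⟨Fixed.classConv ?_ (.of_sort hK₀) (e.mono hs) hΓ₀ hθ hτ, fun _ _ h => (nomatch h)⟩
    have ec : ClassEq Sg Δ Γ K ((K.tmclo θ).tclo τ) := by
      rw [hK₀.tmclo_eq]
      exact .symm ((ClassEq.of_eq (e₁.clo_sort (.refl hτ) hτ)).trans (.of_eq e₂))
    refine ⟨ExprEq.trans ?_ (((ExprEq.clo_const hτ (.const hΓ₁.wf hKS)).conv e₂).classConv ec),
      (HasType.const hΓ.wf hKS).classConv ec⟩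
    rw [hK₀.tmclo_eq]
    exact ExprEq.clo (.refl hτ) (.mclo_const hθ (.const hΓ₀.wf hKS))
  | @pi A E _ _ ihA ihE =>
    intro Δ Γ Γ₀ θ τ F hΓ hθ hτ hx h
    have hΓ₀ : GoodCtx Sg [] Γ₀ := TypedCtx.good (Δ := []) trivial (h.good.typed.mono hs)
    obtain ⟨hA, _⟩ := h.pi_inv
    obtain ⟨s, hE, e⟩ := h.gen
    have hA₁ := hA.mono hs
    have hE₁ := hE.mono hs
    have hA' := hA₁.mclo_sort hθ hΓ₀.wf
    have hΓA₀ : GoodCtx Sg [] (A :: Γ₀) := ⟨hA₁, hΓ₀⟩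
    have fA := (ihA hΓ hθ hτ hx hA).1
    have cA := ClassEq.clo_mclo_sort hΓ₀ hΓ hθ hτ .type
    have hl := SubHasType.lift hΓ hτ hA'
    have hΓA := hΓ.cons_clo hτ hA'
    have fE := (ihE (Γ₀ := A :: Γ₀) hΓA hθ hl (Fixed.lift hs hΓ hΓ₀ hθ hτ hA₁ hx) hE).1
    have cE := ClassEq.clo_mclo_sort hΓA₀ hΓA hθ hl s
    have e₁ := fA.eq.classConv cA
    have h₁ := fA.right.classConv cA
    have e₂ := fE.eq.classConv cE
    have h₂ := (fE.right.classConv cE).ctxConv (.cons hΓ.refl e₁)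
    refine ⟨Fixed.classConv (F := .sort s) ?_ ?_ (e.mono hs) hΓ₀ hθ hτ,
      (PiClass.of_pi h₁ h₂).2⟩
    · have c := ClassEq.clo_mclo_sort hΓ₀ hΓ hθ hτ s
      have e₃ := ExprEq.clo (.refl hτ) (ExprEq.mclo_pi hθ hE₁)
      have e₄ := ExprEq.clo_pi hτ (hE₁.mclo_sort hθ hΓA₀.wf)
      exact ⟨((e₃.classConv (.clo_sort hτ s)).trans (e₄.trans (.pi e₁ e₂))).classConv c.symm,
        h₂.pi.classConv c.symm⟩
    · cases s
      · exact .inl rfl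
      · exact .of_sort (.type hΓ₀.wf)
  | var n =>
    intro Δ Γ Γ₀ θ τ F hΓ hθ hτ hx h
    exact ⟨hx _ _ h, fun _ _ h => (nomatch h)⟩
  | @lam M _ ihM =>
    intro Δ Γ Γ₀ θ τ F hΓ hθ hτ hx h
    have hΓ₀ : GoodCtx Sg [] Γ₀ := TypedCtx.good (Δ := []) trivial (h.good.typed.mono hs)
    obtain ⟨A, B, hM, hB, e⟩ := h.gen
    have hA₁ := hB.good.1.mono hs
    have hB₁ := hB.mono hs
    have hM₁ := hM.mono hs
    have hA' := hA₁.mclo_sort hθ hΓ₀.wf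
    have hΓA₀ : GoodCtx Sg [] (A :: Γ₀) := ⟨hA₁, hΓ₀⟩
    have hB' := hB₁.mclo_sort hθ hΓA₀.wf
    have hl := SubHasType.lift hΓ hτ hA'
    have hΓA := hΓ.cons_clo hτ hA'
    have fM := (ihM (Γ₀ := A :: Γ₀) hΓA hθ hl (Fixed.lift hs hΓ hΓ₀ hθ hτ hA₁ hx) hM).1
    refine ⟨Fixed.classConv (F := .pi A B) ?_ (.of_sort hB₁.pi) (e.mono hs) hΓ₀ hθ hτ,
      fun _ _ h => (nomatch h)⟩
    obtain ⟨f₁, f₂⟩ := fM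
    rw [hB₁.tmclo_eq, hB'.tclo_eq] at f₁ f₂
    have hB'' := hB'.clo_sort hl
    have e₁ := ExprEq.clo_mclo_pi hθ hτ hΓA₀ hB₁
    exact ⟨((ExprEq.clo_mclo_lam hθ hτ hΓA₀ hM₁ hB₁).trans (.lam f₁ hB'')).conv e₁.symm,
      (HasType.lam f₂ hB'').conv e₁.symm⟩
  | @app E N _ _ ihE ihN =>
    intro Δ Γ Γ₀ θ τ F hΓ hθ hτ hx h
    have hΓ₀ : GoodCtx Sg [] Γ₀ := TypedCtx.good (Δ := []) trivial (h.good.typed.mono hs)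
    have hΓ₁ := hΓ₀.msub hθ hΓ.mctx
    obtain ⟨A, F', hE, hN, e⟩ := h.gen
    obtain ⟨hA, s, hF⟩ := hE.class_pi_inv
    have hE₁ := hE.mono hs
    have hN₁ := hN.mono hs
    have hA₁ := hA.mono hs
    have hF₁ := hF.mono hs
    have hΓA₀ : GoodCtx Sg [] (A :: Γ₀) := ⟨hA₁, hΓ₀⟩
    have hA' := hA₁.mclo_sort hθ hΓ₀.wf
    have hF' := hF₁.mclo_sort hθ hΓA₀.wf
    have hs₀ := SubHasType.single hΓ₀ hA₁ hN₁
    refine ⟨Fixed.classConv ?_ (.of_sort (hF₁.clo_sort hs₀)) (e.mono hs) hΓ₀ hθ hτ,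
      fun _ _ h => (nomatch h)⟩
    obtain ⟨f₁, f₂⟩ := (ihE hΓ hθ hτ hx hE).1
    obtain ⟨g₁, g₂⟩ := (ihN hΓ hθ hτ hx hN).1
    rw [hA₁.tmclo_eq, hA'.tclo_eq] at g₁ g₂
    have e₁ := ExprEq.clo_mclo_pi hθ hτ hΓA₀ hF₁
    have f₁ := f₁.conv e₁
    have f₂ := f₂.conv e₁
    have hN' := hN₁.clo_mclo_arg hθ hτ hΓA₀
    have hs₁ := SubHasType.single hΓ (hA'.clo_sort hτ) hN'
    have hF'' := hF'.clo_sort (SubHasType.lift hΓ hτ hA')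
    obtain ⟨c₁, c₂⟩ := ExprEq.clo_mclo_single_sort hΓ hθ hτ hΓA₀ hF₁ hN₁
    have c₃ := (c₁.trans c₂).symm
    have c₄ := ExprEq.clo_sort (.refl hF'') (SubEq.single hΓ (hA'.clo_sort hτ) g₁) hs₁
    exact ⟨(ExprEq.clo_mclo_app hΓ hθ hτ hΓA₀ hF₁ hE₁ hN₁).trans ((ExprEq.app f₁ g₁).conv c₃),
      (HasType.app f₂ g₂).conv (c₄.symm.trans c₃)⟩

end Plain

theorem SigWf.declOk {Sg₀ : Sig C} (h : SigWf Sg₀) : ∀ {Sg : Sig C}, SigWf Sg → Sg₀ ⊆ Sg →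
    ∀ a K, (a, K) ∈ Sg₀ → DeclOk Sg K := by
  induction h with
  | nil => intro _ _ _ a K h; cases h
  | @cons Sg₀ a K s hSg₀ _ hK hKs ih =>
    intro Sg hSg hs a' K' h
    have hs₀ : Sg₀ ⊆ Sg := fun _ h => hs (List.mem_cons_of_mem _ h)
    rcases List.mem_cons.1 h with h | h
    · cases h
      have : Fact (SigWf Sg₀) := ⟨hSg₀⟩
      have : Fact (SigWf Sg) := ⟨hSg⟩
      have : ConstsOk Sg₀ := ⟨ih hSg₀ (List.Subset.refl _)⟩
      have h₀ : GoodCtx Sg ([] : MCtx C) [] := trivial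
      have key : ∀ Δ Γ θ τ, GoodCtx Sg Δ Γ → MSubHasType Sg Δ θ [] → SubHasType Sg Δ Γ τ [] →
          Fixed Sg Δ Γ θ τ K (.sort s) ∧ PiInv Sg Δ Γ K := fun Δ Γ θ τ hΓ hθ hτ =>
        hK.fixed hs₀ (ih hSg hs₀) (Γ₀ := []) hΓ hθ hτ
          (fun n A h => by cases n <;> obtain ⟨_, _, h⟩ := h.gen <;> simp at h) hKs
      have cls : ∀ Δ Γ θ τ, GoodCtx Sg Δ Γ → MSubHasType Sg Δ θ [] → SubHasType Sg Δ Γ τ [] →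
          ClassEq Sg Δ Γ (((Expr.sort s).tmclo θ).tclo τ) (.sort s) := fun Δ Γ θ τ hΓ hθ hτ =>
        ClassEq.clo_mclo_sort (Γ₀ := []) h₀ hΓ hθ hτ s
      refine ⟨s, fun Δ Γ hΓ => ?_, fun Δ Γ θ τ hΓ hθ hτ => ?_⟩
      · have h₁ := key _ _ _ _ hΓ hΓ.mctx.terminal hΓ.terminal
        exact ⟨h₁.1.right.classConv (cls _ _ _ _ hΓ hΓ.mctx.terminal hΓ.terminal), h₁.2⟩
      · exact (key _ _ _ _ hΓ hθ hτ).1.eq.classConv (cls _ _ _ _ hΓ hθ hτ)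
    · exact ih hSg hs₀ a' K' h

instance ConstsOk.of_sigWf [hSg : Fact (SigWf Sg)] : ConstsOk Sg :=
  ⟨hSg.out.declOk hSg.out (List.Subset.refl _)⟩

/-! ### Injectivity of products -/

/-- The product obtained from `Π A. F` by pushing the substitution `σ` inside. -/
def Sub.pushPi (σ : Sub C) (p : Expr C × Expr C) : Expr C × Expr C :=
  (.clo σ p.1, .clo σ.lift p.2)

/-- The product obtained from `Π A. F` by pushing the meta-substitution `θ` inside. -/
def MSub.pushPi (θ : MSub C) (p : Expr C × Expr C) : Expr C × Expr C :=
  (.mclo θ p.1, .mclo θ p.2)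

/-- The domain and the codomain of a product that may be wrapped in closures. -/
def Expr.piView : Expr C → Option (Expr C × Expr C)
  | .pi A F => some (A, F)
  | .clo σ E => E.piView.map σ.pushPi
  | .mclo θ E => E.piView.map θ.pushPi
  | _ => none

theorem Expr.piView_level (lv : C → ℕ) : ∀ (E : Expr C) {p : Expr C × Expr C},
    E.piView = some p → p.2.level lv = E.level lv
  | .pi A F, _, rfl => rfl
  | .clo σ E, p, h => by
    obtain ⟨q, hq, rfl⟩ := Option.map_eq_some_iff.1 h
    exact (E.piView_level lv hq : q.2.level lv = _)
  | .mclo θ E, p, h => by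
    obtain ⟨q, hq, rfl⟩ := Option.map_eq_some_iff.1 h
    exact (E.piView_level lv hq : q.2.level lv = _)

/-- Two optional products are both absent, or both present with equal components. -/
def PiRel (Sg : Sig C) (Δ : MCtx C) (Γ : Ctx C) :
    Option (Expr C × Expr C) → Option (Expr C × Expr C) → Prop
  | none, none => True
  | some p, some q => ExprEq Sg Δ Γ p.1 q.1 (.sort .type) ∧
      ∃ s, ExprEq Sg Δ (p.1 :: Γ) p.2 q.2 (.sort s)
  | _, _ => False

section PiRel

variable [hSg : Fact (SigWf Sg)] {Δ Δ' Δ'' : MCtx C} {Γ Γ' Ψ : Ctx C} {E A F : Expr C}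
  {σ σ' τ : Sub C} {θ θ' : MSub C} {o o₁ o₂ o₃ : Option (Expr C × Expr C)}

/-- The components of an optional product are well-typed. -/
def PiOk (Sg : Sig C) (Δ : MCtx C) (Γ : Ctx C) (o : Option (Expr C × Expr C)) : Prop :=
  ∀ p, o = some p → ∃ s, HasType Sg Δ (p.1 :: Γ) p.2 (.sort s)

theorem HasType.piOk {Δ : MCtx C} {Γ : Ctx C} {E F : Expr C} :
    HasType Sg Δ Γ E F → PiOk Sg Δ Γ E.piView
  | .pi h => by rintro _ ⟨⟩; exact ⟨_, h⟩
  | .clo hσ h => by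
    intro p hp
    obtain ⟨q, hq, rfl⟩ := Option.map_eq_some_iff.1 hp
    obtain ⟨s, h'⟩ := h.piOk q hq
    exact ⟨s, h'.clo_sort (.lift hσ.presup.dom hσ h'.good.1)⟩
  | .mclo hθ h => by
    intro p hp
    obtain ⟨q, hq, rfl⟩ := Option.map_eq_some_iff.1 hp
    obtain ⟨s, h'⟩ := h.piOk q hq
    exact ⟨s, h'.mclo_sort hθ h'.good.wf⟩
  | .conv h _ => h.piOk
  | .ctxConv h e => by
    intro p hp
    obtain ⟨s, h'⟩ := h.piOk p hp
    exact ⟨s, h'.ctxConv (.cons e (.refl h'.good.1))⟩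
  | .type _ => fun _ h => nomatch h
  | .const _ _ => fun _ h => nomatch h
  | .var_zero _ => fun _ h => nomatch h
  | .var_succ _ _ => fun _ h => nomatch h
  | .mvar_zero _ => fun _ h => nomatch h
  | .mvar_succ _ _ => fun _ h => nomatch h
  | .lam _ _ => fun _ h => nomatch h
  | .app _ _ => fun _ h => nomatch h

theorem HasType.piView_eq_none (h : HasType Sg Δ Γ E A) (hA : A.level Sg.level = 1) :
    E.piView = none := by
  by_contra hn
  obtain ⟨p, hp⟩ := Option.ne_none_iff_exists'.1 hn
  obtain ⟨s, h'⟩ := h.piOk p hp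
  have h₁ := (h'.levelOk hSg.out.levels).1
  have h₂ := (h.levelOk hSg.out.levels).1
  have h₃ := E.piView_level Sg.level hp
  cases s <;> simp only [Expr.level] at h₁ <;> omega

theorem HasType.level_of_type (h : HasType Sg Δ Γ A (.sort .type)) : A.level Sg.level = 1 :=
  (h.levelOk hSg.out.levels).level_of_type

theorem PiRel.refl (h : PiOk Sg Δ Γ o) : PiRel Sg Δ Γ o o := by
  cases o with
  | none => trivial
  | some p =>
    obtain ⟨s, h⟩ := h p rfl
    exact ⟨.refl h.good.1, s, .refl h⟩

theorem PiRel.symm (h : PiRel Sg Δ Γ o₁ o₂) : PiRel Sg Δ Γ o₂ o₁ := by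
  match o₁, o₂, h with
  | none, none, _ => trivial
  | some p, some q, ⟨h₁, s, h₂⟩ =>
    exact ⟨h₁.symm, s, h₂.symm.ctxConv (.cons h₁.presup.good.refl h₁)⟩

theorem PiRel.trans (h : PiRel Sg Δ Γ o₁ o₂) (h' : PiRel Sg Δ Γ o₂ o₃) :
    PiRel Sg Δ Γ o₁ o₃ := by
  match o₁, o₂, o₃, h, h' with
  | none, none, none, _, _ => trivial
  | some p, some q, some r, ⟨h₁, s, h₂⟩, ⟨h₃, s', h₄⟩ =>
    have h₄ := h₄.ctxConv (.cons h₁.presup.good.refl h₁.symm)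
    rcases (ClassEq.of_eq h₂).trans (.of_eq h₄) with h | h
    · exact ⟨h₁.trans h₃, s, by rw [← h]; exact .refl h₂.presup.left⟩
    · exact ⟨h₁.trans h₃, h⟩

theorem PiRel.ctxConv (h : PiRel Sg Δ Γ o₁ o₂) (e : CtxEq Sg Δ Γ Γ') : PiRel Sg Δ Γ' o₁ o₂ := by
  match o₁, o₂, h with
  | none, none, _ => trivial
  | some p, some q, ⟨h₁, s, h₂⟩ =>
    exact ⟨h₁.ctxConv e, s, h₂.ctxConv (.cons e (.refl h₁.presup.left))⟩

theorem PiRel.clo (h : PiRel Sg Δ Ψ o₁ o₂) (e : SubEq Sg Δ Γ σ σ' Ψ) :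
    PiRel Sg Δ Γ (o₁.map σ.pushPi) (o₂.map σ'.pushPi) := by
  match o₁, o₂, h with
  | none, none, _ => trivial
  | some p, some q, ⟨h₁, s, h₂⟩ =>
    have ie := e.presup
    exact ⟨h₁.clo_sort e ie.left, s, h₂.clo_sort (.lift ie.dom ie.left e h₁.presup.left)
      (.lift ie.dom ie.left h₁.presup.left)⟩

theorem PiRel.mclo (h : PiRel Sg Δ' Γ o₁ o₂) (e : MSubEq Sg Δ θ θ' Δ') :
    PiRel Sg Δ (Γ.msub θ) (o₁.map θ.pushPi) (o₂.map θ'.pushPi) := by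
  match o₁, o₂, h with
  | none, none, _ => trivial
  | some p, some q, ⟨h₁, s, h₂⟩ =>
    exact ⟨h₁.mclo_sort e e.presup.left h₁.presup.good.wf, s,
      h₂.mclo_sort e e.presup.left h₂.presup.good.wf⟩

theorem PiRel.clo_id (h : PiOk Sg Δ Γ o) :
    PiRel Sg Δ Γ (o.map (Sub.shift 0).pushPi) o := by
  cases o with
  | none => trivial
  | some p =>
    obtain ⟨s, h⟩ := h p rfl
    have hΓ := h.good
    have e := ExprEq.clo_id hΓ.1
    have hc : CtxEq Sg Δ (p.1 :: Γ) (.clo (.shift 0) p.1 :: Γ) := .cons hΓ.2.refl e.symm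
    have el := SubEq.lift_id hΓ
    exact ⟨e, s, (((ExprEq.refl h).clo_sort el el.presup.left).trans (.clo_id h)).ctxConv hc⟩

theorem PiRel.mclo_id (h : PiOk Sg Δ Γ o) :
    PiRel Sg Δ Γ (o.map (MSub.shift 0).pushPi) o := by
  cases o with
  | none => trivial
  | some p =>
    obtain ⟨s, h⟩ := h p rfl
    have hΓ := h.good
    have e := ExprEq.mclo_id hΓ.1
    exact ⟨e, s, (ExprEq.mclo_id h).ctxConv (.cons hΓ.2.refl e.symm)⟩

theorem PiRel.clo_clo (h : PiOk Sg Δ Ψ o) (hσ : SubHasType Sg Δ Γ σ Γ')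
    (hτ : SubHasType Sg Δ Γ' τ Ψ) :
    PiRel Sg Δ Γ ((o.map τ.pushPi).map σ.pushPi) (o.map (Sub.clo σ τ).pushPi) := by
  cases o with
  | none => trivial
  | some p =>
    obtain ⟨s, h⟩ := h p rfl
    have hA := h.good.1
    have iσ := hσ.presup
    have hl := SubHasType.lift iσ.cod hτ hA
    have hl' := SubHasType.lift iσ.dom hσ (hA.clo_sort hτ)
    exact ⟨ExprEq.clo_clo_sort hA hσ hτ, s, (ExprEq.clo_clo_sort h hl' hl).trans
      (ExprEq.clo_sort (.refl h) (.lift_lift iσ.dom iσ.cod hσ hτ hA) (.clo hl' hl))⟩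

theorem PiRel.mclo_mclo (h : PiOk Sg Δ'' Γ o) (hθ : MSubHasType Sg Δ θ Δ')
    (hθ' : MSubHasType Sg Δ' θ' Δ'') :
    PiRel Sg Δ (Γ.msub (.mclo θ θ')) ((o.map θ'.pushPi).map θ.pushPi)
      (o.map (MSub.mclo θ θ').pushPi) := by
  cases o with
  | none => trivial
  | some p =>
    obtain ⟨s, h⟩ := h p rfl
    have hΓ := h.good
    have iθ := hθ.presup
    have e := ExprEq.mclo_mclo_sort hΓ.1 hθ hθ' hΓ.2.wf
    exact ⟨e, s, (ExprEq.mclo_mclo_sort h hθ hθ' hΓ.wf).ctxConv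
      (.cons e.presup.good.refl e.symm)⟩

theorem PiRel.mclo_clo (h : PiOk Sg Δ' Ψ o) (hθ : MSubHasType Sg Δ θ Δ')
    (hσ : SubHasType Sg Δ' Γ σ Ψ) :
    PiRel Sg Δ (Γ.msub θ) ((o.map σ.pushPi).map θ.pushPi)
      ((o.map θ.pushPi).map (Sub.mclo θ σ).pushPi) := by
  cases o with
  | none => trivial
  | some p =>
    obtain ⟨s, h⟩ := h p rfl
    have hΨ := h.good
    have iσ := hσ.presup
    have hl := SubHasType.lift iσ.dom hσ hΨ.1
    exact ⟨ExprEq.mclo_clo_sort hΨ.1 hθ hσ hΨ.2.wf, s,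
      (ExprEq.mclo_clo_sort h hθ hl hΨ.wf).trans
        (ExprEq.clo_sort (.refl (h.mclo_sort hθ hΨ.wf)) (.mclo_lift iσ.dom iσ.cod hθ hσ hΨ.1)
          (.mclo hθ hl))⟩

theorem ExprEq.piRel {Δ : MCtx C} {Γ : Ctx C} {E E' F : Expr C} :
    ExprEq Sg Δ Γ E E' F → PiRel Sg Δ Γ E.piView E'.piView
  | .refl h => .refl h.piOk
  | .symm e => e.piRel.symm
  | .trans e e' => e.piRel.trans e'.piRel
  | .conv e _ => e.piRel
  | .ctxConv e e' => e.piRel.ctxConv e'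
  | .pi e e' => ⟨e, _, e'⟩
  | .lam _ _ => trivial
  | .app _ _ => trivial
  | .clo eσ e => e.piRel.clo eσ
  | .mclo eθ e => e.piRel.mclo eθ
  | .beta h hB _ => by
    simp only [Expr.piView, h.piView_eq_none hB.level_of_type]
    trivial
  | .eta h hB => by
    rw [h.piView_eq_none hB.level_of_type]
    trivial
  | .clo_id h => .clo_id h.piOk
  | .clo_clo hσ hτ h => .clo_clo h.piOk hσ hτ
  | .clo_type _ => trivial
  | .clo_const _ _ => trivial
  | .clo_var_zero _ hA hM => by
    rw [hM.piView_eq_none hA.level_of_type]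
    trivial
  | .var_succ _ => trivial
  | .clo_pi hσ h => .refl (HasType.clo hσ h.pi).piOk
  | .clo_lam _ _ _ => trivial
  | .clo_app _ _ _ => trivial
  | .mclo_id h => .mclo_id h.piOk
  | .mclo_mclo hθ hθ' h => .mclo_mclo h.piOk hθ hθ'
  | .mclo_type _ _ => trivial
  | .mclo_const _ _ => trivial
  | .mclo_var _ _ => trivial
  | .mclo_mvar_zero _ hA hM => by
    rw [hM.piView_eq_none hA.level_of_type]
    trivial
  | .mvar_succ _ => trivial
  | .mclo_pi hθ h => .refl (HasType.mclo hθ h.pi).piOk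
  | .mclo_lam _ _ _ => trivial
  | .mclo_app _ _ _ => trivial
  | .mclo_clo hθ hσ h => .mclo_clo h.piOk hθ hσ

theorem ClassEq.pi_inj {A A' F F' : Expr C} (h : ClassEq Sg Δ Γ (.pi A F) (.pi A' F'))
    (hF : IsClass Sg Δ Γ (.pi A F)) : ExprEq Sg Δ Γ A A' (.sort .type) ∧
      ∃ s, ExprEq Sg Δ (A :: Γ) F F' (.sort s) := by
  rcases h with h | ⟨s, h⟩
  · cases h
    obtain ⟨s, hF⟩ := hF.resolve_left (fun h => nomatch h)
    obtain ⟨h₁, s', h₂⟩ := hF.pi_inv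
    exact ⟨.refl h₁, s', .refl h₂⟩
  · exact h.piRel

end PiRel

/-! ### Evaluation of substitutions and lookup -/

section Eval

variable [hSg : Fact (SigWf Sg)] {Δ Δ' Δ'' : MCtx C} {Γ Γ' Ψ Ψ' : Ctx C} {A E F : Expr C}
  {σ τ : Sub C} {θ : MSub C} {η : MEnv C} {ρ : Env C} {n m : ℕ}

theorem MSubHasType.shift_inv (h : MSubHasType Sg Δ (.shift n) Δ') :
    ∃ Δ₁, Δ = Δ₁ ++ Δ' ∧ Δ₁.length = n := by
  cases h with
  | shift _ hn => exact ⟨_, rfl, hn⟩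

theorem MSubEq.menvEval (η : MEnv C) (θ : MSub C) : ∀ {Δ Δ' Δ'' : MCtx C},
    MSubHasType Sg Δ η.toMSub Δ' → MSubHasType Sg Δ' θ Δ'' →
    MSubEq Sg Δ (menvEval η θ).toMSub (.mclo η.toMSub θ) Δ'' := by
  fun_induction CMTT.menvEval η θ with
  | case1 m n =>
    intro Δ Δ' Δ'' hη hθ
    have hΔ := hη.presup.1
    obtain ⟨Δ₁, rfl, h₁⟩ := hη.shift_inv
    obtain ⟨Δ₂, rfl, h₂⟩ := hθ.shift_inv
    exact (MSubEq.shift_shift hΔ.wf h₂ h₁).symm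
  | case2 η M =>
    intro Δ Δ' Δ'' hη hθ
    obtain ⟨Δ₁, rfl, h₁⟩ := hθ.shift_inv
    cases List.length_eq_zero_iff.1 h₁
    exact (MSubEq.mclo_id hη).symm
  | case3 η M n ih =>
    intro Δ Δ' Δ'' hη hθ
    obtain ⟨Δ₁, rfl, h₁⟩ := hθ.shift_inv
    obtain _ | ⟨D, Δ₁⟩ := Δ₁
    · cases h₁
    have hn : Δ₁.length = n := Nat.succ_injective h₁
    have hη' := hη
    simp only [MEnv.toMSub] at hη
    cases hη with
    | cons h₂ hA hM =>
      exact (ih h₂ (.shift h₂.presup.2.wf hn)).trans (MSubEq.cons_shift hη' hn).symm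
  | case4 η θ M ih =>
    intro Δ Δ' Δ'' hη hθ
    have hθ' := hθ
    cases hθ with
    | cons hθ hA hM =>
      have e := MSubEq.mclo_cons hη hθ'
      have h := e.presup.right
      cases h with
      | cons _ _ hM' => exact ((MSubEq.cons (ih hη hθ).symm hA (.refl hM')).symm).trans e.symm
  | case5 η θ θ' ih₁ ih₂ =>
    intro Δ Δ' Δ'' hη hθ
    cases hθ with
    | mclo hθ hθ' =>
      have e := ih₁ hη hθ
      exact ((ih₂ e.presup.left hθ').trans (.mclo e (.refl hθ'))).trans
        (MSubEq.assoc hη hθ hθ').symm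

theorem SubEq.clo_mclo_shift (hθ : MSubHasType Sg Δ θ Δ') (hΨ : GoodCtx Sg Δ' (Ψ' ++ Ψ))
    (hn : Ψ'.length = n) (hσ : SubHasType Sg Δ Γ σ (Ctx.msub θ (Ψ' ++ Ψ))) :
    SubEq Sg Δ Γ (.clo σ (.mclo θ (.shift n))) (.clo σ (.shift n)) (Ψ.msub θ) := by
  rw [Ctx.msub_append] at hσ
  exact .clo (.refl hσ) (.mclo_shift hθ hΨ.wf hn)

theorem SubEq.envEval (ρ : Env C) (η : MEnv C) (σ : Sub C) :
    ∀ {Δ Δ' : MCtx C} {Γ Ψ Ψ' : Ctx C}, MSubHasType Sg Δ η.toMSub Δ' →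
    SubHasType Sg Δ' Ψ σ Ψ' → SubHasType Sg Δ Γ ρ.toSub (Ψ.msub η.toMSub) →
    SubEq Sg Δ Γ (envEval ρ η σ).toSub (.clo ρ.toSub (.mclo η.toMSub σ))
      (Ψ'.msub η.toMSub) := by
  fun_induction CMTT.envEval ρ η σ with
  | case1 k ρ η σ ih =>
    intro Δ Δ' Γ Ψ Ψ' hη hσ hρ
    obtain ⟨Γ', h₁, h₂⟩ := hρ.gen
    exact (SubEq.clo (.refl h₁) (ih hη hσ h₂)).trans (.assoc h₁ h₂ (.mclo hη hσ))
  | case2 ρ η _ =>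
    intro Δ Δ' Γ Ψ Ψ' hη hσ hρ
    have hΔ := hη.presup.1
    have hΨ := hσ.presup.dom
    obtain ⟨Γ₁, Γ₂, rfl, h₁, h₂⟩ := hσ.gen
    cases List.length_eq_zero_iff.1 h₁
    refine SubEq.ctxConv (SubEq.symm ?_) hρ.presup.dom.refl (h₂.msub hη hΔ h₂.left)
    exact (SubEq.clo_mclo_shift (Ψ' := []) hη hΨ rfl hρ).trans (.clo_id hρ)
  | case3 k η n _ =>
    intro Δ Δ' Γ Ψ Ψ' hη hσ hρ
    have hΔ := hη.presup.1
    have hΨ := hσ.presup.dom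
    have hΓ := hρ.presup.dom
    obtain ⟨Ψ₁, Ψ₂, rfl, h₁, h₂⟩ := hσ.gen
    refine SubEq.ctxConv (SubEq.symm ?_) hΓ.refl (h₂.msub hη hΔ h₂.left)
    refine (SubEq.clo_mclo_shift hη hΨ h₁ hρ).trans ?_
    obtain ⟨Γ₁, Γ₂, rfl, h₃, h₄⟩ := hρ.gen
    rw [Ctx.msub_append] at h₄
    obtain ⟨Γ₃, Γ₄, rfl, h₅, h₆⟩ := h₄.symm.split
    exact (SubEq.shift_shift hΓ.wf (by simpa [h₁] using h₅) h₃).ctxConv hΓ.refl h₆.symm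
  | case4 ρ L η n ih =>
    intro Δ Δ' Γ Ψ Ψ' hη hσ hρ
    have hΔ := hη.presup.1
    have hΨ := hσ.presup.dom
    have hΓ := hρ.presup.dom
    obtain ⟨Ψ₁, Ψ₂, rfl, h₁, h₂⟩ := hσ.gen
    obtain _ | ⟨B, Ψ₁⟩ := Ψ₁
    · cases h₁
    have h₁' : Ψ₁.length = n := Nat.succ_injective h₁
    have hρ' := hρ
    simp only [Env.toSub] at hρ
    obtain ⟨A, Ψ₀, h₃, h₄, h₅, h₆⟩ := hρ.gen
    cases h₃
    have c := h₂.msub hη hΔ h₂.left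
    refine (ih hη (.ctxConv (.shift hΨ.2.wf h₁') hΨ.2.refl h₂) h₄).trans ?_
    refine SubEq.ctxConv ?_ hΓ.refl c
    refine (SubEq.clo_mclo_shift hη hΨ.2 h₁' h₄).trans
      (SubEq.trans ?_ (SubEq.clo_mclo_shift hη hΨ h₁ hρ').symm)
    refine (SubEq.cons_shift (A := .mclo η.toMSub B) (Ψ' := Ctx.msub η.toMSub Ψ₁) ?_ (by simpa using h₁')).symm
    rw [← Ctx.msub_append]
    exact hρ
  | case5 ρ η σ M _ ih =>
    intro Δ Δ' Γ Ψ Ψ' hη hσ hρ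
    have hΨ := hσ.presup.dom
    obtain ⟨A, Ψ₀, rfl, h₁, h₂, h₃⟩ := hσ.gen
    have e₁ := SubEq.mclo_cons hη h₁ h₂ h₃
    have e₂ := SubEq.clo_cons hρ e₁.presup.right
    obtain ⟨_, _, h₄, h₅, h₆, h₇⟩ := e₂.presup.right.gen
    cases h₄
    exact (SubEq.cons (ih hη h₁ hρ).symm h₆ (.refl h₇)).symm.trans
      ((SubEq.clo (.refl hρ) e₁).trans e₂).symm
  | case6 ρ η σ τ _ ih₁ ih₂ =>
    intro Δ Δ' Γ Ψ Ψ' hη hσ hρ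
    obtain ⟨Ψ₀, h₁, h₂⟩ := hσ.gen
    have e := ih₁ hη h₁ hρ
    have h₁' := SubHasType.mclo hη h₁
    have h₂' := SubHasType.mclo hη h₂
    exact (ih₂ hη h₂ e.presup.left).trans ((SubEq.clo e (.refl h₂')).trans
      ((SubEq.assoc hρ h₁' h₂').symm.trans (SubEq.clo (.refl hρ) (SubEq.mclo_clo hη h₁ h₂).symm)))
  | case7 ρ η θ σ _ ih =>
    intro Δ Δ' Γ Ψ Ψ' hη hσ hρ
    have hΔ := hη.presup.1
    have hΓ := hρ.presup.dom
    obtain ⟨Δ₀, Γ₀, Ψ₀, hθ, h₁, h₂, h₃⟩ := hσ.gen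
    have hΓ₀ := h₁.presup.dom
    have hΨ₀ := h₁.presup.cod
    have e := MSubEq.menvEval η θ hη hθ
    have he := e.presup.left
    have c := fun {Γ₀ : Ctx C} (h : GoodCtx Sg Δ₀ Γ₀) =>
      (h.msub_congr e he hΔ).trans (h.msub_msub hη hθ hΔ).2
    have cΓ := (c hΓ₀).trans (h₂.msub hη hΔ h₂.left)
    have cΨ := (c hΨ₀).trans (h₃.msub hη hΔ h₃.left)
    have e₁ := ih he h₁ (hρ.ctxConv hΓ.refl cΓ.symm)
    have e₂ : SubEq Sg Δ (Ψ.msub η.toMSub) (.mclo (CMTT.menvEval η θ).toMSub σ)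
        (.mclo η.toMSub (.mclo θ σ)) (Ψ'.msub η.toMSub) :=
      (SubEq.mclo e (.refl h₁)).ctxConv cΓ cΨ |>.trans
        (((SubEq.mclo_mclo hη hθ h₁).symm.ctxConv (hΓ₀.msub_msub hη hθ hΔ).2
          (hΨ₀.msub_msub hη hθ hΔ).2).ctxConv (h₂.msub hη hΔ h₂.left) (h₃.msub hη hΔ h₃.left))
    exact (e₁.ctxConv hΓ.refl cΨ).trans (.clo (.refl hρ) e₂)

theorem ExprEq.mvar_add : ∀ {Δ₁ : MCtx C} {n : ℕ}, GoodMCtx Sg (Δ₁ ++ Δ) → Δ₁.length = n →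
    HasType Sg Δ Ψ (.mvar m) A →
    ExprEq Sg (Δ₁ ++ Δ) (Ψ.msub (.shift n)) (.mvar (n + m)) (.mclo (.shift n) (.mvar m))
      (.mclo (.shift n) A)
  | [], _, _, rfl, h => by
    have hΨ := h.good
    have e := (ExprEq.mclo_id h).symm.ctxConv hΨ.msub_id.2
    have c := (ClassEq.mclo_id h.isClass).symm.ctxConv hΨ.msub_id.2
    rw [Expr.tmclo_eq h.mvar_class_ne_kind] at c
    simpa using e.classConv c
  | D :: Δ₁, _, hΔ, rfl, h => by
    have hΨ := h.good
    have ih := ExprEq.mvar_add hΔ.2 rfl h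
    have h₁ : MSubHasType Sg (Δ₁ ++ Δ) (.shift Δ₁.length) Δ := .shift hΔ.2.wf rfl
    have hs : MSubHasType Sg (D :: Δ₁ ++ Δ) (.shift 1) (Δ₁ ++ Δ) := GoodMCtx.shift hΔ
    obtain ⟨s, hA⟩ := h.isClass.resolve_left h.mvar_class_ne_kind
    have hA' := hA.mclo_sort h₁ hΨ.wf
    have e₁ := ExprEq.mvar_succ (ih.presup.left.mvar_succ hΔ.1.1)
    have e₂ := ExprEq.mclo (.refl hs) ih
    have e₃ := ExprEq.mclo_mclo hs h₁ h
    rw [hA'.tmclo_eq] at e₂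
    rw [hA.tmclo_eq] at e₃
    have c₁ := ExprEq.mclo_mclo_sort hA hs h₁ hΨ.wf
    have cx := hΨ.msub_msub hs h₁ hΔ
    have e₄ : MSubEq Sg (D :: Δ₁ ++ Δ) (.mclo (.shift 1) (.shift Δ₁.length))
        (.shift (1 + Δ₁.length)) Δ :=
      .shift_shift (Δ₁ := Δ₁) (Δ₂ := [D]) hΔ.wf rfl rfl
    have e₅ := ExprEq.mclo e₄ (.refl h)
    rw [hA.tmclo_eq] at e₅
    have c₂ := ExprEq.mclo_sort (.refl hA) e₄ e₄.presup.left hΨ.wf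
    have e₆ := ((((e₁.trans e₂).ctxConv cx.1).conv c₁).trans (e₃.trans e₅)).conv c₂
    have e₇ := e₆.ctxConv (hΨ.msub_congr e₄ e₄.presup.left hΔ)
    rw [List.length_cons, Nat.add_right_comm, Nat.add_comm Δ₁.length 1]
    exact e₇

theorem ExprEq.mlookup (η : MEnv C) (m : ℕ) : ∀ {Δ Δ' : MCtx C} {Ψ : Ctx C} {A : Expr C},
    MSubHasType Sg Δ η.toMSub Δ' → HasType Sg Δ' Ψ (.mvar m) A →
    ExprEq Sg Δ (Ψ.msub η.toMSub) (mlookup η m) (.mclo η.toMSub (.mvar m))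
      (.mclo η.toMSub A) := by
  fun_induction CMTT.mlookup η m with
  | case1 n m =>
    intro Δ Δ' Ψ A hη h
    have hΔ := hη.presup.1
    obtain ⟨Δ₁, rfl, h₁⟩ := hη.shift_inv
    exact ExprEq.mvar_add hΔ h₁ h
  | case2 η E =>
    intro Δ Δ' Ψ A hη h
    have hΔ := hη.presup
    obtain ⟨Γ₀, A₀, Δ₀, rfl, h₁, h₂⟩ := h.gen
    have hη' := hη
    simp only [MEnv.toMSub] at hη
    cases hη with
    | cons h₃ hA hM =>
      have hΓ₀ := hA.good
      have hs := hΔ.2.shift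
      have e := MSubEq.cons_shift_one hη' h₃
      have he := e.presup.left
      have cx := ((hΓ₀.msub_congr e he hΔ.1).symm.trans (hΓ₀.msub_msub hη' hs hΔ.1).2).trans
        (h₁.msub hη' hΔ.1 h₁.left)
      have c₁ := ((ExprEq.mclo_sort (.refl hA) e he hΓ₀.wf).symm.ctxConv
        (hΓ₀.msub_congr e he hΔ.1)).ctxConv cx
      have c₂ := ((ExprEq.mclo_mclo_sort hA hη' hs hΓ₀.wf).symm.ctxConv
        (hΓ₀.msub_congr e he hΔ.1)).ctxConv cx
      have hA₁ := (hA.mclo_sort hs hΓ₀.wf).ctxConv h₁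
      have c₃ := h₂.mclo (.of_sort hA₁) (.refl hη') hη' h.good.wf
      rw [hA₁.tmclo_eq, Expr.tmclo_eq h.mvar_class_ne_kind] at c₃
      exact (((ExprEq.mclo_mvar_zero h₃ hA hM).symm.ctxConv cx).conv (c₁.trans c₂)).classConv c₃
  | case3 η M m ih =>
    intro Δ Δ' Ψ A hη h
    have hΔ := hη.presup
    obtain ⟨D, Δ₀, Γ₀, A₀, rfl, h₁, h₂, h₃⟩ := h.gen
    have hη' := hη
    simp only [MEnv.toMSub] at hη
    cases hη with
    | cons h₄ hA hM =>
      have hΓ₀ := h₁.good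
      have hs := hΔ.2.shift
      have e := MSubEq.cons_shift_one hη' h₄
      have he := e.presup.left
      obtain ⟨s, hA₀⟩ := h₁.isClass.resolve_left h₁.mvar_class_ne_kind
      have cx₁ := hΓ₀.msub_congr e he hΔ.1
      have cx₂ := hΓ₀.msub_msub hη' hs hΔ.1
      have cx₃ := h₂.msub hη' hΔ.1 h₂.left
      have e₁ := (ih h₄ h₁).ctxConv cx₁.symm
      have e₂ := ExprEq.mclo e (.refl h₁)
      rw [hA₀.tmclo_eq] at e₂
      have c₁ := ExprEq.mclo_sort (.refl hA₀) e he hΓ₀.wf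
      have e₃ := ExprEq.mclo_mclo hη' hs h₁
      rw [hA₀.tmclo_eq] at e₃
      have c₂ := ExprEq.mclo_mclo_sort hA₀ hη' hs hΓ₀.wf
      have e₄ := ((((e₁.conv c₁.symm).trans (e₂.symm.trans e₃.symm)).conv c₂.symm).ctxConv
        cx₂.2).ctxConv cx₃
      have hA₁ := (hA₀.mclo_sort hs hΓ₀.wf).ctxConv h₂
      have c₃ := h₃.mclo (.of_sort hA₁) (.refl hη') hη' h.good.wf
      rw [hA₁.tmclo_eq, Expr.tmclo_eq h.mvar_class_ne_kind] at c₃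
      have e₅ := ExprEq.mclo (.refl hη') (ExprEq.mvar_succ h)
      rw [Expr.tmclo_eq h.mvar_class_ne_kind] at e₅
      exact (e₄.classConv c₃).trans e₅.symm

theorem ExprEq.var_add : ∀ {Γ₁ : Ctx C} {n : ℕ}, GoodCtx Sg Δ (Γ₁ ++ Ψ) → Γ₁.length = n →
    HasType Sg Δ Ψ (.var m) A →
    ExprEq Sg Δ (Γ₁ ++ Ψ) (.var (n + m)) (.clo (.shift n) (.var m)) (.clo (.shift n) A)
  | [], _, _, rfl, h => by
    have c := ClassEq.clo_id h.isClass
    rw [Expr.tclo_eq h.var_class_ne_kind] at c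
    simpa using (ExprEq.clo_id h).symm.classConv c.symm
  | B :: Γ₁, _, hΓ, rfl, h => by
    have ih := ExprEq.var_add hΓ.2 rfl h
    have h₁ : SubHasType Sg Δ (Γ₁ ++ Ψ) (.shift Γ₁.length) Ψ := .shift hΓ.2.wf rfl
    have hs : SubHasType Sg Δ (B :: Γ₁ ++ Ψ) (.shift 1) (Γ₁ ++ Ψ) := GoodCtx.shift hΓ
    obtain ⟨s, hA⟩ := h.isClass.resolve_left h.var_class_ne_kind
    have hA' := hA.clo_sort h₁
    have e₁ := ExprEq.var_succ (ih.presup.left.var_succ hΓ.1)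
    have e₂ := ExprEq.clo (.refl hs) ih
    have e₃ := ExprEq.clo_clo hs h₁ h
    rw [hA'.tclo_eq] at e₂
    rw [hA.tclo_eq] at e₃
    have c₁ := ExprEq.clo_clo_sort hA hs h₁
    have e₄ : SubEq Sg Δ (B :: Γ₁ ++ Ψ) (.clo (.shift 1) (.shift Γ₁.length))
        (.shift (1 + Γ₁.length)) Ψ :=
      .shift_shift (Γ₁ := Γ₁) (Γ₂ := [B]) hΓ.wf rfl rfl
    have e₅ := ExprEq.clo e₄ (.refl h)
    rw [hA.tclo_eq] at e₅
    have c₂ := ExprEq.clo_sort (.refl hA) e₄ e₄.presup.left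
    have e₆ := (((e₁.trans e₂).conv c₁).trans (e₃.trans e₅)).conv c₂
    rw [List.length_cons, Nat.add_right_comm, Nat.add_comm Γ₁.length 1]
    exact e₆

theorem ExprEq.clo_shift_var (h : HasType Sg Δ Ψ (.var m) A)
    (hσ : SubHasType Sg Δ Γ (.shift n) Ψ) :
    ExprEq Sg Δ Γ (.var (n + m)) (.clo (.shift n) (.var m)) (.clo (.shift n) A) := by
  have hΓ := hσ.presup.dom
  obtain ⟨Γ₁, Γ₂, rfl, h₁, h₂⟩ := hσ.gen
  exact ExprEq.var_add hΓ h₁ (h.ctxConv h₂.symm)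

theorem ExprEq.shiftBy {L : Clos C} (h : HasType Sg Δ Ψ L.toExpr F)
    (hσ : SubHasType Sg Δ Γ (.shift n) Ψ) :
    ExprEq Sg Δ Γ (L.shiftBy n).toExpr (.clo (.shift n) L.toExpr) (F.tclo (.shift n)) := by
  cases L with
  | var m =>
    simp only [Clos.toExpr] at h
    rw [Expr.tclo_eq h.var_class_ne_kind]
    exact ExprEq.clo_shift_var h hσ
  | clo ρ η E =>
    obtain ⟨Ψ', F', h₁, h₂, h₃⟩ := h.gen
    exact (ExprEq.clo_clo hσ h₁ h₂).symm.classConv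
      ((ClassEq.clo_clo h₂.isClass hσ h₁).symm.trans (h₃.clo (h₂.isClass.clo h₁) (.refl hσ) hσ))

theorem ExprEq.lookup (ρ : Env C) (m : ℕ) : ∀ {Γ Ψ : Ctx C} {A : Expr C},
    HasType Sg Δ Ψ (.var m) A → SubHasType Sg Δ Γ ρ.toSub Ψ →
    ExprEq Sg Δ Γ (lookup ρ m).toExpr (.clo ρ.toSub (.var m)) (.clo ρ.toSub A) := by
  fun_induction CMTT.lookup ρ m with
  | case1 n m =>
    intro Γ Ψ A h hρ
    exact ExprEq.clo_shift_var h hρ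
  | case2 ρ L =>
    intro Γ Ψ A h hρ
    have hΨ := h.good
    obtain ⟨A₀, Ψ₀, rfl, h₁⟩ := h.gen
    have hρ' := hρ
    simp only [Env.toSub] at hρ
    obtain ⟨_, _, h₂, h₃, h₄, h₅⟩ := hρ.gen
    cases h₂
    have c₁ := (ExprEq.clo_clo_sort h₄ hρ hΨ.shift).trans
      (ExprEq.clo_sort (.refl h₄) (SubEq.cons_shift_one hρ h₃) (.clo hρ hΨ.shift))
    have hA := h₄.clo_sort hΨ.shift
    have c₂ := h₁.clo (.of_sort hA) (.refl hρ) hρ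
    rw [hA.tclo_eq, Expr.tclo_eq h.var_class_ne_kind] at c₂
    exact ((ExprEq.clo_var_zero h₃ h₄ h₅).symm.conv c₁.symm).classConv c₂
  | case3 ρ L m ih =>
    intro Γ Ψ A h hρ
    have hΨ := h.good
    obtain ⟨B, Ψ₀, A₀, rfl, h₁, h₂⟩ := h.gen
    have hρ' := hρ
    simp only [Env.toSub] at hρ
    obtain ⟨_, _, h₃, h₄, h₅, h₆⟩ := hρ.gen
    cases h₃
    obtain ⟨s, hA₀⟩ := h₁.isClass.resolve_left h₁.var_class_ne_kind
    have e := SubEq.cons_shift_one hρ h₄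
    have e₁ := ih h₁ h₄
    have e₂ := ExprEq.clo e (.refl h₁)
    have e₃ := ExprEq.clo_clo hρ hΨ.shift h₁
    have e₄ := ExprEq.clo (.refl hρ) (ExprEq.var_succ h)
    rw [hA₀.tclo_eq] at e₂ e₃
    rw [Expr.tclo_eq h.var_class_ne_kind] at e₄
    have c₁ := ExprEq.clo_sort (.refl hA₀) e e.presup.left
    have c₂ := ExprEq.clo_clo_sort hA₀ hρ hΨ.shift
    have hA := hA₀.clo_sort hΨ.shift
    have c₃ := h₂.clo (.of_sort hA) (.refl hρ) hρ
    rw [hA.tclo_eq, Expr.tclo_eq h.var_class_ne_kind] at c₃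
    exact ((((e₁.conv c₁.symm).trans (e₂.symm.trans e₃.symm)).conv c₂.symm).classConv c₃).trans
      e₄.symm
  | case4 n ρ m ih =>
    intro Γ Ψ A h hρ
    obtain ⟨Ψ₀, h₁, h₂⟩ := hρ.gen
    have e₁ := ih h h₂
    have e₂ := ExprEq.shiftBy e₁.presup.left h₁
    have e₃ := ExprEq.clo (.refl h₁) e₁
    have e₄ := ExprEq.clo_clo h₁ h₂ h
    have c := ClassEq.clo_clo h.isClass h₁ h₂
    rw [Expr.tclo_eq h.var_class_ne_kind] at e₄
    rw [Expr.tclo_eq h.var_class_ne_kind, Expr.tclo_eq h.var_class_ne_kind] at c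
    exact ((e₂.trans e₃).classConv c).trans e₄

end Eval

/-! ### Evaluation to weak head normal form -/

section Whnf

variable [hSg : Fact (SigWf Sg)] {Δ Δ' Δ'' : MCtx C} {Γ Ψ Ψ' : Ctx C} {A E F M N : Expr C}
  {σ τ τ' : Sub C} {θ θ' θ'' : MSub C} {L : Clos C} {W W' : Whnf C}

theorem HasType.clo_mclo_gen (h : HasType Sg Δ Γ (.clo σ (.mclo θ E)) F) :
    ∃ Δ' Ψ F', MSubHasType Sg Δ θ Δ' ∧ SubHasType Sg Δ Γ σ (Ψ.msub θ) ∧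
      HasType Sg Δ' Ψ E F' ∧ ClassEq Sg Δ Γ ((F'.tmclo θ).tclo σ) F := by
  obtain ⟨Ψ₁, F₁, hσ, h₁, c₁⟩ := h.gen
  obtain ⟨Δ', Ψ, F', hθ, hE, e, c₂⟩ := h₁.gen
  refine ⟨Δ', Ψ, F', hθ, hσ.ctxConv h.good.refl e.symm, hE, ?_⟩
  exact (c₂.clo ((hE.isClass.mclo hθ hE.good.wf).ctxConv e) (.refl hσ) hσ).trans c₁

theorem HasType.clo_mclo (hθ : MSubHasType Sg Δ θ Δ') (hσ : SubHasType Sg Δ Γ σ (Ψ.msub θ))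
    (h : HasType Sg Δ' Ψ E F) :
    HasType Sg Δ Γ (.clo σ (.mclo θ E)) ((F.tmclo θ).tclo σ) :=
  .clo hσ (.mclo hθ h)

theorem ExprEq.clo_mclo_clo (hθ : MSubHasType Sg Δ θ Δ') (hσ : SubHasType Sg Δ Γ σ (Ψ.msub θ))
    (hτ : SubHasType Sg Δ' Ψ τ Ψ') (h : HasType Sg Δ' Ψ' E F)
    (e : SubEq Sg Δ Γ τ' (.clo σ (.mclo θ τ)) (Ψ'.msub θ)) :
    ExprEq Sg Δ Γ (.clo σ (.mclo θ (.clo τ E))) (.clo τ' (.mclo θ E))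
      (((F.tclo τ).tmclo θ).tclo σ) := by
  have hc := h.isClass.mclo hθ h.good.wf
  have hτ' := SubHasType.mclo hθ hτ
  have c₁ := (ClassEq.mclo_clo h.isClass hθ hτ h.good.wf).symm
  have c₂ := (c₁.clo (hc.clo hτ') (.refl hσ) hσ)
  exact (ExprEq.clo (.refl hσ) ((ExprEq.mclo_clo hθ hτ h).classConv c₁)).trans
    (((ExprEq.clo_clo hσ hτ' (.mclo hθ h)).trans (.clo e.symm (.refl (.mclo hθ h)))).classConv
      ((ClassEq.clo_clo hc hσ hτ').symm.trans c₂))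

theorem ExprEq.clo_mclo_mclo (hθ : MSubHasType Sg Δ θ Δ') (hθ' : MSubHasType Sg Δ' θ' Δ'')
    (h : HasType Sg Δ'' Ψ E F) (hΨ : CtxEq Sg Δ' (Ψ.msub θ') Ψ')
    (hσ : SubHasType Sg Δ Γ σ (Ψ'.msub θ)) (e : MSubEq Sg Δ θ'' (.mclo θ θ') Δ'') :
    ExprEq Sg Δ Γ (.clo σ (.mclo θ (.mclo θ' E))) (.clo σ (.mclo θ'' E))
      (((F.tmclo θ').tmclo θ).tclo σ) := by
  have hΔ := hθ.presup.1
  have c := (h.good.msub_msub hθ hθ' hΔ).2.trans (hΨ.msub hθ hΔ hΨ.left)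
  exact .clo (.refl hσ) ((((ExprEq.mclo_mclo hθ hθ' h).trans (.mclo e.symm (.refl h))).classConv
    (ClassEq.mclo_mclo h.isClass hθ hθ' h.good.wf).symm).ctxConv c)

mutual

theorem WhnfTo.exprEq : ∀ {L : Clos C} {W : Whnf C}, WhnfTo L W → ∀ {Γ : Ctx C} {F : Expr C},
    HasType Sg Δ Γ L.toExpr F → ExprEq Sg Δ Γ W.toExpr L.toExpr F
  | _, _, .var, _, _, h => .refl h
  | _, _, .sort, _, _, h => by
    obtain ⟨Δ', Ψ, F', hη, hρ, hE, c⟩ := h.clo_mclo_gen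
    obtain ⟨rfl, rfl⟩ := hE.eq_kind_of_sort
    exact ((((ExprEq.mclo_type hη hE.good.wf).clo (.refl hρ)).trans
      (.clo_type hρ)).symm).classConv c
  | _, _, .const, _, _, h => by
    obtain ⟨Δ', Ψ, F', hη, hρ, hE, c⟩ := h.clo_mclo_gen
    have e := ExprEq.mclo_const hη hE
    obtain ⟨s, hF'⟩ := hE.isClass.resolve_left hE.const_class_ne_kind
    have hF'' := hF'.mclo_sort hη hE.good.wf
    have e₁ := ExprEq.clo (.refl hρ) e
    rw [hF''.tclo_eq] at e₁
    rw [hF'.tmclo_eq, hF''.tclo_eq] at c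
    exact (e₁.trans (.clo_const hρ e.presup.right)).symm.classConv c
  | _, _, .clo_var h', _, _, h => by
    obtain ⟨Δ', Ψ, F', hη, hρ, hE, c⟩ := h.clo_mclo_gen
    have e := ExprEq.mclo_var hη hE
    have e₁ := ExprEq.lookup _ _ e.presup.right hρ
    have e₂ := ExprEq.clo (.refl hρ) e
    obtain ⟨s, hF'⟩ := hE.isClass.resolve_left hE.var_class_ne_kind
    rw [(hF'.mclo_sort hη hE.good.wf).tclo_eq] at e₂
    rw [hF'.tmclo_eq, (hF'.mclo_sort hη hE.good.wf).tclo_eq] at c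
    exact ((h'.exprEq e₁.presup.left).trans (e₁.trans e₂.symm)).classConv c
  | _, _, .mvar_id, _, _, h => by
    obtain ⟨Δ', Ψ, F', hη, hρ, hE, c⟩ := h.clo_mclo_gen
    obtain ⟨Δ₁, rfl, h₁⟩ := hη.shift_inv
    cases List.length_eq_zero_iff.1 h₁
    have cx := hE.good.msub_id.2
    have e := (ExprEq.mclo_id hE).symm.classConv (ClassEq.mclo_id hE.isClass).symm
    exact (ExprEq.clo (.refl hρ) (e.ctxConv cx)).classConv c
  | _, _, .mvar (η := η) (m := m) _ h', _, _, h => by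
    obtain ⟨Δ', Ψ, F', hη, hρ, hE, c⟩ := h.clo_mclo_gen
    have e₁ := ExprEq.mlookup _ _ hη hE
    rw [← Expr.tmclo_eq hE.mvar_class_ne_kind] at e₁
    have e₂ := ExprEq.clo (.refl hρ) ((ExprEq.mclo_id e₁.presup.left).trans e₁)
    exact (h'.exprEq (e₂.presup.left.classConv c)).trans (e₂.classConv c)
  | _, _, .pi, _, _, h => .refl h
  | _, _, .lam, _, _, h => .refl h
  | _, _, .app h₁ h₂, _, _, h => by
    obtain ⟨Δ', Ψ, F₀, hη, hρ, hE, c⟩ := h.clo_mclo_gen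
    obtain ⟨A, F', hM, hN, c'⟩ := hE.gen
    obtain ⟨hA, s, hF'⟩ := hM.class_pi_inv
    have hΨ : GoodCtx Sg Δ' (A :: Ψ) := hF'.good
    have hs := SubHasType.single hΨ.2 hA hN
    have hN' := hN.clo_mclo_arg hη hρ hΨ
    have hM' := (HasType.clo_mclo hη hρ hM).conv (ExprEq.clo_mclo_pi hη hρ hΨ hF')
    have e₁ := h₁.exprEq hM'
    have e₂ := h₂.exprEq e₁.presup.left hN'
    have e₃ := ExprEq.app e₁ (.refl hN')
    obtain ⟨c₁, c₂⟩ := ExprEq.clo_mclo_single_sort h.good hη hρ hΨ hF' hN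
    have e₄ := ((e₂.trans e₃).conv (c₁.trans c₂).symm).trans
      (ExprEq.clo_mclo_app h.good hη hρ hΨ hF' hM hN).symm
    have c₃ := (c'.mclo (.of_sort (hF'.clo_sort hs)) (.refl hη) hη hΨ.2.wf).clo
      (IsClass.mclo (.of_sort (hF'.clo_sort hs)) hη hΨ.2.wf) (.refl hρ) hρ
    exact e₄.classConv (c₃.trans c)
  | _, _, .clo h', _, _, h => by
    obtain ⟨Δ', Ψ, F₀, hη, hρ, hE, c⟩ := h.clo_mclo_gen
    obtain ⟨Ψ', F', hσ, hM, c'⟩ := hE.gen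
    have hc := hM.isClass.clo hσ
    have c₁ := (c'.mclo hc (.refl hη) hη hE.good.wf).clo (hc.mclo hη hE.good.wf) (.refl hρ) hρ
    have e := (ExprEq.clo_mclo_clo hη hρ hσ hM (SubEq.envEval _ _ _ hη hσ hρ)).classConv
      (c₁.trans c)
    exact (h'.exprEq e.presup.right).trans e.symm
  | _, _, .mclo h', _, _, h => by
    obtain ⟨Δ', Ψ, F₀, hη, hρ, hE, c⟩ := h.clo_mclo_gen
    obtain ⟨Δ'', Ψ', F', hθ, hM, e, c'⟩ := hE.gen
    have hc := (hM.isClass.mclo hθ hM.good.wf).ctxConv e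
    have c₁ := (c'.mclo hc (.refl hη) hη hE.good.wf).clo (hc.mclo hη hE.good.wf) (.refl hρ) hρ
    have e₁ := (ExprEq.clo_mclo_mclo hη hθ hM e hρ (MSubEq.menvEval _ _ hη hθ)).classConv
      (c₁.trans c)
    exact (h'.exprEq e₁.presup.right).trans e₁.symm

theorem AppTo.exprEq : ∀ {W : Whnf C} {L : Clos C} {W' : Whnf C}, AppTo W L W' →
    ∀ {Γ : Ctx C} {A F : Expr C}, HasType Sg Δ Γ W.toExpr (.pi A F) →
    HasType Sg Δ Γ L.toExpr A →
    ExprEq Sg Δ Γ W'.toExpr (.app W.toExpr L.toExpr) (.clo (.single L.toExpr) F)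
  | _, _, _, .lam (ρ := ρ) (L := L) h', _, A, F, h, hL => by
    have hΓ := h.good
    obtain ⟨hA, s, hF⟩ := h.class_pi_inv
    obtain ⟨Δ', Ψ, F₀, hη, hρ, hE, c⟩ := h.clo_mclo_gen
    obtain ⟨A₀, B, hM, hB, c'⟩ := hE.gen
    have hΨ := hB.good
    have hc := IsClass.of_sort hB.pi
    have e₁ := ExprEq.clo_mclo_pi hη hρ hΨ hB
    have e₂ := ExprEq.clo_mclo_lam hη hρ hΨ hM hB
    have c₁ := (((c'.mclo hc (.refl hη) hη hΨ.2.wf).clo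
      (hc.mclo hη hΨ.2.wf) (.refl hρ) hρ).trans c)
    have c₂ := (ClassEq.of_eq e₁).symm.trans c₁
    obtain ⟨eA, s', eB⟩ := c₂.pi_inj (.of_sort e₁.presup.right)
    have hB' := hB.mclo_sort hη hΨ.wf
    have hl := SubHasType.lift hΓ hρ (hΨ.1.mclo_sort hη hΨ.2.wf)
    have hM' := HasType.clo_mclo (Ψ := A₀ :: Ψ) hη hl hM
    rw [hB.tmclo_eq, hB'.tclo_eq] at hM'
    have hL' := hL.conv eA.symm
    have hs := SubHasType.single hΓ eA.presup.left hL'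
    have e₃ := (ExprEq.app e₂ (.refl hL')).trans (.beta hM' (hB'.clo_sort hl) hL')
    have e₄ := SubEq.single_lift hΓ hρ (hΨ.1.mclo_sort hη hΨ.2.wf) hL'
    have hM'' := HasType.mclo hη hM
    rw [hB.tmclo_eq] at hM''
    have e₅ := (ExprEq.clo_clo hs hl hM'').trans (.clo e₄ (.refl hM''))
    rw [hB'.tclo_eq] at e₅
    have e₆ := (e₃.trans (e₅.conv (ExprEq.clo_clo_sort hB' hs hl).symm)).conv
      (eB.clo_sort (.refl hs) hs)
    exact (h'.exprEq e₆.presup.right).trans e₆.symm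
  | _, _, _, .neut, _, _, _, h, hL => .refl (.app h hL)

end

end Whnf

end CMTT

theorem mainTheorem1 {C : Type u} (Sg : CMTT.Sig C) (hSg : CMTT.SigWf Sg)
    (Δ Δ' : CMTT.MCtx C) (η : CMTT.MEnv C) (hη : CMTT.MSubHasType Sg Δ η.toMSub Δ') :
    -- meta-substitution evaluation
    (∀ (θ : CMTT.MSub C) (Δ'' : CMTT.MCtx C), CMTT.MSubHasType Sg Δ' θ Δ'' →
      CMTT.MSubEq Sg Δ (CMTT.menvEval η θ).toMSub (.mclo η.toMSub θ) Δ'') ∧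
    -- substitution evaluation
    (∀ (σ : CMTT.Sub C) (ρ : CMTT.Env C) (Ψ Ψ' Γ : CMTT.Ctx C),
      CMTT.SubHasType Sg Δ' Ψ σ Ψ' →
      CMTT.SubHasType Sg Δ Γ ρ.toSub (Ψ.msub η.toMSub) →
      CMTT.SubEq Sg Δ Γ (CMTT.envEval ρ η σ).toSub (.clo ρ.toSub (.mclo η.toMSub σ))
        (Ψ'.msub η.toMSub)) ∧
    -- meta-variable lookup
    (∀ (m : ℕ) (Ψ : CMTT.Ctx C) (A : CMTT.Expr C),
      CMTT.HasType Sg Δ' Ψ (.mvar m) A →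
      CMTT.ExprEq Sg Δ (Ψ.msub η.toMSub) (CMTT.mlookup η m) (.mclo η.toMSub (.mvar m))
        (.mclo η.toMSub A)) ∧
    -- variable lookup
    (∀ (m : ℕ) (ρ : CMTT.Env C) (Ψ Γ : CMTT.Ctx C) (A : CMTT.Expr C),
      CMTT.HasType Sg Δ Ψ (.var m) A →
      CMTT.SubHasType Sg Δ Γ ρ.toSub Ψ →
      CMTT.ExprEq Sg Δ Γ (CMTT.lookup ρ m).toExpr (.clo ρ.toSub (.var m))
        (.clo ρ.toSub A)) ∧
    -- weak head evaluation
    (∀ (E F : CMTT.Expr C) (ρ : CMTT.Env C) (Ψ Γ : CMTT.Ctx C),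
      CMTT.HasType Sg Δ' Ψ E F →
      CMTT.SubHasType Sg Δ Γ ρ.toSub (Ψ.msub η.toMSub) →
      ∀ W : CMTT.Whnf C, CMTT.WhnfTo (.clo ρ η E) W →
        CMTT.ExprEq Sg Δ Γ W.toExpr (.clo ρ.toSub (.mclo η.toMSub E))
          ((F.tmclo η.toMSub).tclo ρ.toSub)) ∧
    -- evaluation of applications
    (∀ (W : CMTT.Whnf C) (L : CMTT.Clos C) (Γ : CMTT.Ctx C) (A F : CMTT.Expr C),
      CMTT.HasType Sg Δ Γ W.toExpr (.pi A F) →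
      CMTT.HasType Sg Δ Γ L.toExpr A →
      ∀ W' : CMTT.Whnf C, CMTT.AppTo W L W' →
        CMTT.ExprEq Sg Δ Γ W'.toExpr (.app W.toExpr L.toExpr)
          (.clo (.single L.toExpr) F)) := by
  have : Fact (CMTT.SigWf Sg) := ⟨hSg⟩
  exact ⟨fun θ _ hθ => CMTT.MSubEq.menvEval η θ hη hθ,
    fun σ ρ _ _ _ hσ hρ => CMTT.SubEq.envEval ρ η σ hη hσ hρ,
    fun m _ _ h => CMTT.ExprEq.mlookup η m hη h,
    fun m ρ _ _ _ h hρ => CMTT.ExprEq.lookup ρ m h hρ,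
    fun _ _ _ _ _ hE hρ _ h => h.exprEq (.clo_mclo hη hρ hE),
    fun _ _ _ _ _ hW hL _ h => h.exprEq hW hL⟩
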